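/- Conventions: $\mathbb N=\{1,2,\dots\}$, $[n]=\{1,\dots,n\}$. A signature $\Sigma$ is a finite set of relation symbols $R$ with arities $\mathrm{ar}(R)\in\mathbb N$; for $\Sigma$-structures, $A\to B$ means that there is a homomorphism from $A$ to $B$. A minion $\mathscr M$ consists of sets $\mathscr M(n)$, $n\in\mathbb N$, and maps $f\mapsto f^\pi$, $\mathscr M(n)\to\mathscr M(m)$, for each $\pi:[n]\to[m]$, with $f^{\mathrm{id}}=f$ and $(f^{\pi})^{\sigma}=f^{\sigma\circ\pi}$. A property $Q$ over $\mathscr M$ is a subset of $\mathscr M(n)$ for some $n=:\mathrm{ar}(Q)$; a description $\mathcal D$ is a set of properties. For $f,g\in\mathscr M(n)$ write $f\sim_{\mathcal D}g$ if for all $P\in\mathcal D$ and $\pi:[n]\to[\mathrm{ar}(P)]$ one has $f^\pi\in P\iff g^\pi\in P$. Then $\mathscr M/\mathcal D$ is the quotient minion and $Q/\mathcal D$ the image of $Q$; $Q$ is $\mathcal D$-stable if it is closed under $\sim_{\mathcal D}$. Primitive positive (pp) formulas are built from equations between terms in variables (each with an arity) and the operations $\cdot^\pi$, by finite conjunction and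 existential quantification; the arity of a formula is the maximal arity of its terms, quantified variables included. A minor condition is a closed pp-formula. An internal reference to $Q$ w.r.t. $\mathcal D$ is a pp-formula $\varphi(x)$ with one free variable $x$, of arity $\mathrm{ar}(Q)$, such that every element of $(\mathscr M/\mathcal D)(\mathrm{ar}(Q))$ that satisfies $\varphi$ in $\mathscr M/\mathcal D$ lies in $Q/\mathcal D$. A $\Sigma$-interpretation $\mathcal I$ over $\mathscr M$ consists of properties $U^{\mathcal I}$ and $R^{\mathcal I}$ ($R\in\Sigma$) and maps $\Pi_{R,i}:[\mathrm{ar}(R^{\mathcal I})]\to[\mathrm{ar}(U^{\mathcal I})]$ ($R\in\Sigma$, $i\in[\mathrm{ar}(R)]$). Its global structure $S_{\mathcal I}$ has universe $U^{\mathcal I}$, and $(f_1,\dots,f_{\mathrm{ar}(R)})$ is in its relation $R$ iff there is $g\in R^{\mathcal I}$ with $f_i=g^{\Pi_{R,i}}$ for all $i$. A $\Sigma$-pattern $(\mathcal I,\mathcal D,\Psi,h)$ over $\mathscr M$ consists of $h\in\mathbb N$, a description $\mathcal D$, an interpretation $\mathcal I$ all of whose properties are $\mathcal D$-stable, and a polynomial-time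 computable map $\Psi$ that sends every finite $\Sigma$-structure $X$ with $X\to S_{\mathcal I}$ to a minor condition $\Psi_X$ of arity at most $h$ with $\mathscr M\models\Psi_X$, of the form $$\exists (x_v)_{v\in X}\ \exists (x_t)_{R\in\Sigma,\,t\in R^X}\ \Big(\bigwedge_{v\in X}\psi_v(x_v)\Big)\wedge\bigwedge_{R\in\Sigma,\,t\in R^X}\Big(\psi_t(x_t)\wedge\bigwedge_{i\in[\mathrm{ar}(R)]}x_t^{\Pi_{R,i}}=x_{t(i)}\Big),$$ where each $\psi_v$ is an internal reference to $U^{\mathcal I}$ and each $\psi_t$, $t\in R^X$, is an internal reference to $R^{\mathcal I}$, w.r.t. $\mathcal D$. For structures $A$ and $B$ with $A\to B$ and $B$ finite, $\mathrm{sPCSP}(A,B)$ is the promise search problem: given a finite structure $X$ with $X\to A$, find a homomorphism $X\to B$. A (polynomial-time) many-one reduction from one promise search problem to another is a pair $(\alpha,\beta)$ of polynomial-time computable functions such that $\alpha$ sends promised inputs of the first problem to promised inputs of the second, and for every promised input $x$ and every word $z$, $z$ is a solution of $\alpha(x)$ if and only if $\beta(x,z)$ is a solution of $x$. For $r,h\in\mathbb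 N$ let $\pi_1,\dots,\pi_m$ ($m=r^h$) be the lexicographic ordering of the maps $[h]\to[r]$. The structure $K_r^h$ has universe $[r]$ and one $m$-ary relation $\{(\pi_1(i),\dots,\pi_m(i)): i\in[h]\}$. For a finite structure $A$ with universe $[n]$, the free structure $F_{\mathscr M}(A)$ has universe $\mathscr M(n)$, and $(f_1,\dots,f_{\mathrm{ar}(R)})$ is in its relation $R$ iff, for a fixed enumeration $R^A=\{t_1,\dots,t_k\}$, there is $g\in\mathscr M(k)$ with $f_i=g^{(t_1(i),\dots,t_k(i))}$ for all $i$ (the relation is empty if $R^A$ is). **Theorem.** Let $G$ be a $\Sigma$-structure, $\mathscr M$ a minion, $(\mathcal I,\mathcal D,\Psi,h)$ a $\Sigma$-pattern over $\mathscr M$ whose description $\mathcal D$ is finite, and $r\le h$ a natural number. Suppose that (1) $S_{\mathcal I}$ is finitely equivalent to $G$, that is, $X\to S_{\mathcal I}\iff X\to G$ for every finite $\Sigma$-structure $X$, and (2) $r\ge\mathrm{ar}(U^{\mathcal I})$ and $r\ge\mathrm{ar}(Q)$ for every $Q\in\mathcal D$. Then for each finite $\Sigma$-structure $T$ with $G\to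 T$ there is a finite structure $B$ with $K_r^h\to B$ and $F_{\mathscr M}(K_r^h)\to B$ such that $\mathrm{sPCSP}(G,T)$ is polynomial-time many-one reducible to $\mathrm{sPCSP}(F_{\mathscr M}(K_r^h),B)$. -/

import Mathlib

universe u v

namespace MinionPattern

/-! ### Relational structures -/

/-- A finite relational signature; all arities are positive. -/
structure Signature where
  Symb : Type
  [fin : Finite Symb]
  ar : Symb → ℕ
  ar_pos : ∀ R, 0 < ar R

attribute [instance] Signature.fin

/-- A relational structure: a universe and a set of tuples for each symbol. -/
structure RelStr (S : Signature) where
  carrier : Type u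
  rel : (R : S.Symb) → Set (Fin (S.ar R) → carrier)

variable {S : Signature}

/-- `F` is a homomorphism from `A` to `B`. -/
def IsHom (A : RelStr.{u} S) (B : RelStr.{v} S) (F : A.carrier → B.carrier) : Prop :=
  ∀ (R : S.Symb) (t : Fin (S.ar R) → A.carrier), t ∈ A.rel R → F ∘ t ∈ B.rel R

/-- There is a homomorphism from `A` to `B`. -/
def HomTo (A : RelStr.{u} S) (B : RelStr.{v} S) : Prop :=
  ∃ F : A.carrier → B.carrier, IsHom A B F

/-- The same finite structures map homomorphically to `A` and to `B`. -/
def FinitelyEquivalent (A : RelStr.{u} S) (B : RelStr.{v} S) : Prop :=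
  ∀ I : RelStr.{0} S, Finite I.carrier → (HomTo I A ↔ HomTo I B)

/-! ### Minions -/

/-- An abstract minion; arities are positive integers, `minor π f` is the minor `f^π`. -/
structure Minion where
  obj : ℕ+ → Type u
  minor : {n m : ℕ+} → (Fin n → Fin m) → obj n → obj m
  minor_id : ∀ {n : ℕ+} (f : obj n), minor (id : Fin n → Fin n) f = f
  minor_comp : ∀ {n m k : ℕ+} (σ : Fin m → Fin k) (π : Fin n → Fin m) (f : obj n),
    minor (σ ∘ π) f = minor σ (minor π f)

/-- A property over `M`: an arity together with a set of elements of that arity. -/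
structure MProperty (M : Minion.{u}) where
  ar : ℕ+
  carrier : Set (M.obj ar)

/-- A description: a set of properties. -/
abbrev Description (M : Minion.{u}) := Set (MProperty M)

/-- The equivalence relation on `M(n)` induced by a description. -/
def Description.setoid {M : Minion.{u}} (D : Description M) (n : ℕ+) : Setoid (M.obj n) where
  r f g := ∀ P ∈ D, ∀ π : Fin n → Fin P.ar, M.minor π f ∈ P.carrier ↔ M.minor π g ∈ P.carrier
  iseqv :=
    ⟨fun _ _ _ _ => Iff.rfl, fun h P hP π => (h P hP π).symm,
      fun h₁ h₂ P hP π => (h₁ P hP π).trans (h₂ P hP π)⟩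

/-- The quotient minion `M/D`. -/
def Minion.quot (M : Minion.{u}) (D : Description M) : Minion.{u} where
  obj n := Quotient (D.setoid n)
  minor {n m} π := Quotient.map' (s₁ := D.setoid n) (s₂ := D.setoid m) (M.minor π) (by
    intro f g hfg P hP σ
    rw [← M.minor_comp, ← M.minor_comp]
    exact hfg P hP (σ ∘ π))
  minor_id f := by
    induction f using Quotient.inductionOn
    exact congrArg _ (M.minor_id _)
  minor_comp σ π f := by
    induction f using Quotient.inductionOn
    exact congrArg _ (M.minor_comp _ _ _)

/-- The class of `f` in `M/D`. -/
def Minion.toQuot (M : Minion.{u}) (D : Description M) {n : ℕ+} (f : M.obj n) :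
    (M.quot D).obj n :=
  Quotient.mk (D.setoid n) f

/-- The property `Q/D` over `M/D`. -/
def MProperty.quot {M : Minion.{u}} (Q : MProperty M) (D : Description M) :
    MProperty (M.quot D) where
  ar := Q.ar
  carrier := M.toQuot D '' Q.carrier

/-- `Q` is `D`-stable: it is closed under the equivalence induced by `D`. -/
def MProperty.Stable {M : Minion.{u}} (Q : MProperty M) (D : Description M) : Prop :=
  ∀ f g : M.obj Q.ar, (D.setoid Q.ar) f g → f ∈ Q.carrier → g ∈ Q.carrier

/-! ### Primitive positive formulas in the multi-sorted language of minions

The sort of a variable is its arity.  Bound variables are de Bruijn indices; a context is the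
list of the sorts of the variables in scope, the innermost one first. -/

/-- `Var Γ n`: the variables of arity `n` in the context `Γ`. -/
inductive Var : List ℕ+ → ℕ+ → Type
  | zero {Γ : List ℕ+} {n : ℕ+} : Var (n :: Γ) n
  | succ {Γ : List ℕ+} {n m : ℕ+} : Var Γ n → Var (m :: Γ) n

/-- Terms of arity `n`. -/
inductive Tm (Γ : List ℕ+) : ℕ+ → Type
  | var {n : ℕ+} : Var Γ n → Tm Γ n
  | minor {n m : ℕ+} : (Fin n → Fin m) → Tm Γ n → Tm Γ m

/-- Primitive positive formulas whose free variables lie in the context. -/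
inductive PP : List ℕ+ → Type
  | top {Γ : List ℕ+} : PP Γ
  | eq {Γ : List ℕ+} {n : ℕ+} : Tm Γ n → Tm Γ n → PP Γ
  | and {Γ : List ℕ+} : PP Γ → PP Γ → PP Γ
  | ex {Γ : List ℕ+} (n : ℕ+) : PP (n :: Γ) → PP Γ

/-- Minor conditions: closed primitive positive formulas. -/
abbrev MinorCondition := PP []

/-- Assignments of elements of `M` to the variables of a context. -/
abbrev Env (M : Minion.{u}) (Γ : List ℕ+) := (n : ℕ+) → Var Γ n → M.obj n

/-- The assignment on the empty context. -/
def Env.nil (M : Minion.{u}) : Env M [] := fun _ x => nomatch x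

/-- Extension of an assignment by a value of the innermost variable. -/
def Env.cons {M : Minion.{u}} {Γ : List ℕ+} {m : ℕ+} (f : M.obj m) (e : Env M Γ) :
    Env M (m :: Γ)
  | _, .zero => f
  | _, .succ x => e _ x

/-- The value of a term. -/
def Tm.eval {M : Minion.{u}} {Γ : List ℕ+} (e : Env M Γ) : {n : ℕ+} → Tm Γ n → M.obj n
  | _, .var x => e _ x
  | _, .minor π t => M.minor π (t.eval e)

/-- Satisfaction of a primitive positive formula in `M` under an assignment. -/
def PP.Sat (M : Minion.{u}) : {Γ : List ℕ+} → Env M Γ → PP Γ → Prop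
  | _, _, .top => True
  | _, e, .eq s t => s.eval e = t.eval e
  | _, e, .and φ ψ => φ.Sat M e ∧ ψ.Sat M e
  | _, e, .ex n φ => ∃ f : M.obj n, φ.Sat M (Env.cons f e)

/-- `M ⊨ φ` for a minor condition. -/
def Models (M : Minion.{u}) (φ : MinorCondition) : Prop := φ.Sat M (Env.nil M)

/-- `M ⊨ φ(f)` for a formula with one free variable. -/
def ModelsAt (M : Minion.{u}) {n : ℕ+} (φ : PP [n]) (f : M.obj n) : Prop :=
  φ.Sat M (Env.cons f (Env.nil M))

/-- All subterms of a term have arity at most `h`. -/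
def Tm.ArityLE (h : ℕ+) {Γ : List ℕ+} : {n : ℕ+} → Tm Γ n → Prop
  | n, .var _ => n ≤ h
  | n, .minor _ t => n ≤ h ∧ t.ArityLE h

/-- All terms in a formula (quantified variables included) have arity at most `h`. -/
def PP.ArityLE (h : ℕ+) : {Γ : List ℕ+} → PP Γ → Prop
  | _, .top => True
  | _, .eq s t => s.ArityLE h ∧ t.ArityLE h
  | _, .and φ ψ => φ.ArityLE h ∧ ψ.ArityLE h
  | _, .ex n φ => n ≤ h ∧ φ.ArityLE h

/-- Renamings of variables between contexts. -/
abbrev Ren (Γ Δ : List ℕ+) := (n : ℕ+) → Var Γ n → Var Δ n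

/-- The extension of a renaming under a quantifier. -/
def Ren.lift {Γ Δ : List ℕ+} {m : ℕ+} (ρ : Ren Γ Δ) : Ren (m :: Γ) (m :: Δ)
  | _, .zero => .zero
  | _, .succ x => .succ (ρ _ x)

/-- Renaming of the variables of a term. -/
def Tm.rename {Γ Δ : List ℕ+} (ρ : Ren Γ Δ) : {n : ℕ+} → Tm Γ n → Tm Δ n
  | _, .var x => .var (ρ _ x)
  | _, .minor π t => .minor π (t.rename ρ)

/-- Renaming of the free variables of a formula. -/
def PP.rename : {Γ Δ : List ℕ+} → Ren Γ Δ → PP Γ → PP Δ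
  | _, _, _, .top => .top
  | _, _, ρ, .eq s t => .eq (s.rename ρ) (t.rename ρ)
  | _, _, ρ, .and φ ψ => .and (φ.rename ρ) (ψ.rename ρ)
  | _, _, ρ, .ex n φ => .ex n (φ.rename ρ.lift)

/-- The renaming that sends the only variable of the context `[m]` to `x`. -/
def Ren.single {Γ : List ℕ+} {m : ℕ+} (x : Var Γ m) : Ren [m] Γ
  | _, .zero => x

/-- `ψ(x)` for a formula `ψ` with one free variable. -/
def PP.at {Γ : List ℕ+} {m : ℕ+} (ψ : PP [m]) (x : Var Γ m) : PP Γ := ψ.rename (Ren.single x)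

/-- Finite conjunctions. -/
def PP.conj {Γ : List ℕ+} (l : List (PP Γ)) : PP Γ := l.foldr PP.and PP.top

/-- Existential closure: quantifies all the variables of the context. -/
def PP.exAll : (Γ : List ℕ+) → PP Γ → MinorCondition
  | [], φ => φ
  | n :: Γ, φ => PP.exAll Γ (.ex n φ)

/-! ### Interpretations -/

/-- An `S`-interpretation over `M`. -/
structure Interpretation (S : Signature) (M : Minion.{u}) where
  U : MProperty M
  R : S.Symb → MProperty M
  proj : (P : S.Symb) → Fin (S.ar P) → (Fin (R P).ar → Fin U.ar)

/-- The global structure induced by an interpretation. -/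
def Interpretation.global {M : Minion.{u}} (J : Interpretation S M) : RelStr.{u} S where
  carrier := {f : M.obj J.U.ar // f ∈ J.U.carrier}
  rel P := {t | ∃ g ∈ (J.R P).carrier, ∀ i, (t i).1 = M.minor (J.proj P i) g}

/-- All the properties of the interpretation are `D`-stable. -/
def Interpretation.Stable {M : Minion.{u}} (J : Interpretation S M) (D : Description M) : Prop :=
  J.U.Stable D ∧ ∀ P, (J.R P).Stable D

/-- `φ(x)` is an internal reference to `Q` with respect to `D`. -/
def InternalRef {M : Minion.{u}} (Q : MProperty M) (D : Description M) (φ : PP [Q.ar]) : Prop :=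
  ∀ f : (M.quot D).obj Q.ar, ModelsAt (M.quot D) φ f → f ∈ (Q.quot D).carrier

/-! ### Finite structures and formulas as words -/

/-- A finite structure as an input: a universe `{0, …, size - 1}` and a list of facts `R(t)`. -/
structure Instance (S : Signature) where
  size : ℕ
  facts : List ((R : S.Symb) × (Fin (S.ar R) → Fin size))

/-- The finite structure that an input presents. -/
def Instance.toStr (X : Instance S) : RelStr.{0} S where
  carrier := Fin X.size
  rel R := {t | ⟨R, t⟩ ∈ X.facts}

/-- The alphabet of inputs: a digit `inl true`, a delimiter `inl false`, and the symbols. -/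
abbrev InstSym (S : Signature) := Bool ⊕ S.Symb

/-- A natural number in unary, followed by the delimiter. -/
def InstSym.nat (S : Signature) (n : ℕ) : List (InstSym S) :=
  List.replicate n (.inl true) ++ [.inl false]

/-- The word of an input: the size of the universe, then the facts one after another. -/
def Instance.encode (X : Instance S) : List (InstSym S) :=
  InstSym.nat S X.size ++
    X.facts.flatMap fun a => .inr a.1 :: (List.ofFn a.2).flatMap fun x => InstSym.nat S x.1

/-- The alphabet of formulas. -/
inductive FmSym
  | top | eq | and | ex | var | minor | digit | stop_mark

/-- A natural number in unary, followed by a delimiter. -/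
def FmSym.nat (n : ℕ) : List FmSym := List.replicate n .digit ++ [.stop_mark]

/-- The de Bruijn index of a variable. -/
def Var.index : {Γ : List ℕ+} → {n : ℕ+} → Var Γ n → ℕ
  | _, _, .zero => 0
  | _, _, .succ x => x.index + 1

/-- The word of a term, in prefix notation; a map is written as the table of its values. -/
def Tm.encode {Γ : List ℕ+} : {n : ℕ+} → Tm Γ n → List FmSym
  | _, .var x => .var :: FmSym.nat x.index
  | _, .minor (n := n) (m := m) π t =>
      .minor :: FmSym.nat n ++ FmSym.nat m ++ ((List.ofFn π).flatMap fun i => FmSym.nat i) ++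
        t.encode

/-- The word of a formula, in prefix notation. -/
def PP.encode : {Γ : List ℕ+} → PP Γ → List FmSym
  | _, .top => [.top]
  | _, .eq s t => .eq :: s.encode ++ t.encode
  | _, .and φ ψ => .and :: φ.encode ++ ψ.encode
  | _, .ex n φ => .ex :: FmSym.nat n ++ φ.encode

/-- `f` is computable in polynomial time by a (multi-stack) Turing machine, under encodings of its
arguments and values as words. -/
def PolyTime {α β A B : Type} (ea : α → List A) (eb : β → List B) (f : α → β) : Prop :=
  Nonempty (Turing.TM2ComputableInPolyTime ea eb f)

/-! ### Patterns -/

/-- Variables of a context, seen in a longer context. -/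
def Var.left {Γ Δ : List ℕ+} : {n : ℕ+} → Var Γ n → Var (Γ ++ Δ) n
  | _, .zero => .zero
  | _, .succ x => .succ x.left

/-- Variables of a context, seen in a longer context. -/
def Var.right {Δ : List ℕ+} {n : ℕ+} : (Γ : List ℕ+) → Var Δ n → Var (Γ ++ Δ) n
  | [], x => x
  | _ :: Γ, x => .succ (Var.right Γ x)

/-- The variable that belongs to the `i`-th entry of a list. -/
def Var.ofList {ι : Type} (s : ι → ℕ+) : (l : List ι) → (i : Fin l.length) →
    Var (l.map s) (s (l.get i))
  | _ :: _, ⟨0, _⟩ => .zero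
  | _ :: l, ⟨i + 1, hi⟩ => .succ (Var.ofList s l ⟨i, Nat.lt_of_succ_lt_succ hi⟩)

/-- The `i`-th variable in a context of `k` variables of the same arity. -/
def Var.ofReplicate (m : ℕ+) : (k : ℕ) → Fin k → Var (List.replicate k m) m
  | _ + 1, ⟨0, _⟩ => .zero
  | k + 1, ⟨i + 1, hi⟩ => .succ (Var.ofReplicate m k ⟨i, Nat.lt_of_succ_lt_succ hi⟩)

section Pattern

variable {M : Minion.{u}} (J : Interpretation S M) (X : Instance S)

/-- The arity of the variable `x_r` of a fact `r`. -/
def factAr (a : (R : S.Symb) × (Fin (S.ar R) → Fin X.size)) : ℕ+ := (J.R a.1).ar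

/-- The variables `x_r` for the facts `r` of `X` and `x_v` for its elements `v`. -/
def patternCtx : List ℕ+ :=
  X.facts.map (factAr J X) ++ List.replicate X.size J.U.ar

/-- The variable `x_v`. -/
def elemVar (v : Fin X.size) : Var (patternCtx J X) J.U.ar :=
  Var.right _ (Var.ofReplicate J.U.ar X.size v)

/-- The variable `x_r`, where `r` is the `k`-th fact. -/
def factVar (k : Fin X.facts.length) : Var (patternCtx J X) (J.R (X.facts.get k).1).ar :=
  Var.left (Var.ofList (factAr J X) X.facts k)

/-- The minor condition
`∃ x_v ∃ x_r, (⋀_v ψ_v(x_v)) ∧ ⋀_r (ψ_r(x_r) ∧ ⋀_i x_r^{Π_{R,i}} = x_{r(i)})`. -/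
def patternFormula (ψV : Fin X.size → PP [J.U.ar])
    (ψR : (k : Fin X.facts.length) → PP [(J.R (X.facts.get k).1).ar]) : MinorCondition :=
  PP.exAll (patternCtx J X) <|
    .and
      (PP.conj <| List.ofFn fun v => (ψV v).at (elemVar J X v))
      (PP.conj <| List.ofFn fun k =>
        .and ((ψR k).at (factVar J X k)) <|
          PP.conj <| List.ofFn fun i : Fin (S.ar (X.facts.get k).1) =>
            .eq (.minor (J.proj (X.facts.get k).1 i) (.var (factVar J X k)))
              (.var (elemVar J X ((X.facts.get k).2 i))))

end Pattern

/-- `(J, D, Ψ, h)` is a pattern over `M`: the interpretation is `D`-stable, and `Ψ` is a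
polynomial-time computable map that sends each finite structure with a homomorphism to the global
structure of `J` to a minor condition of arity at most `h`, true in `M`, and of the form above
with internal references `ψ_v` to `U` and `ψ_r` to the properties of the symbols. -/
structure IsPattern {M : Minion.{u}} (J : Interpretation S M) (D : Description M)
    (Ψ : {X : Instance S // HomTo X.toStr J.global} → MinorCondition) (h : ℕ+) : Prop where
  stable : J.Stable D
  polyTime : PolyTime (fun X => X.1.encode) PP.encode Ψ
  arity : ∀ X, (Ψ X).ArityLE h
  holds : ∀ X, Models M (Ψ X)
  shape : ∀ X, ∃ (ψV : Fin X.1.size → PP [J.U.ar])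
    (ψR : (k : Fin X.1.facts.length) → PP [(J.R (X.1.facts.get k).1).ar]),
      (∀ v, InternalRef J.U D (ψV v)) ∧
      (∀ k, InternalRef (J.R (X.1.facts.get k).1) D (ψR k)) ∧
      Ψ X = patternFormula J X.1 ψV ψR

/-! ### Promise search problems -/

/-- A promise search problem on words: given a word in `promise`, find a word related to it. -/
structure SearchProblem where
  A : Type
  V : Type
  promise : Set (List A)
  rel : List A → List V → Prop

/-- Polynomial-time many-one reducibility: `α` maps promised inputs of the first problem to promised
inputs of the second one, and `z` solves `α x` if and only if `β (x, z)` solves `x`.  A pair of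
words is written as their concatenation over disjoint alphabets. -/
def PolyManyOneReducible (P Q : SearchProblem) : Prop :=
  ∃ (α : {x // x ∈ P.promise} → {y // y ∈ Q.promise})
    (β : {x // x ∈ P.promise} × List Q.V → List P.V),
    PolyTime Subtype.val Subtype.val α ∧
    PolyTime (fun p => p.1.1.map (Sum.inl : P.A → P.A ⊕ Q.V) ++ p.2.map Sum.inr) id β ∧
    ∀ x z, Q.rel (α x).1 z ↔ P.rel x.1 (β (x, z))

/-- The word of a map: its values in order.  The alphabet has one further letter, so that not
every word is made of values. -/
def encodeMap {k : ℕ} {B : Type} (F : Fin k → B) : List (Option B) :=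
  List.ofFn fun v => some (F v)

/-- The search problem `sPCSP(A, B)`: given a finite structure that maps homomorphically to `A`,
find a homomorphism from it to `B`. -/
def sPCSP (A : RelStr.{u} S) (B : RelStr.{0} S) : SearchProblem where
  A := InstSym S
  V := Option B.carrier
  promise := {x | ∃ X : Instance S, x = X.encode ∧ HomTo X.toStr A}
  rel x y := ∃ X : Instance S, x = X.encode ∧
    ∃ F : Fin X.size → B.carrier, IsHom X.toStr B F ∧ y = encodeMap F

/-! ### Complete structures and free structures -/

/-- The signature with a single symbol, of arity `r ^ h`. -/
def completeSig (r h : ℕ+) : Signature where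
  Symb := Unit
  ar _ := (r : ℕ) ^ (h : ℕ)
  ar_pos _ := Nat.pow_pos r.pos

/-- The `j`-th map `[h] → [r]` in the lexicographic order. -/
def lexMap (r h : ℕ) (j : Fin (r ^ h)) : Fin h → Fin r :=
  fun i => finFunctionFinEquiv.symm j i.rev

/-- The complete structure `K_r^h`. -/
def completeStr (r h : ℕ+) : RelStr.{0} (completeSig r h) where
  carrier := Fin r
  rel _ := Set.range fun (i : Fin h) (j : Fin ((r : ℕ) ^ (h : ℕ))) => lexMap r h j i

/-- The free structure of `M` generated by a structure `A` with universe enumerated by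
`e : [n] ≃ A`.  The enumeration of `R^A` by some `[m]` is immaterial; if `R^A` is empty then the
relation is empty. -/
def freeStr (M : Minion.{u}) (A : RelStr.{v} S) {n : ℕ+} (e : Fin n ≃ A.carrier) :
    RelStr.{u} S where
  carrier := M.obj n
  rel R := {t | ∃ (m : ℕ+) (ε : Fin m ≃ A.rel R) (g : M.obj m),
    ∀ i, t i = M.minor (fun j => e.symm ((ε j).1 i)) g}

end MinionPattern

open MinionPattern

/-! Since `T` is finite and `S_J` and `G` receive the same finite structures, compactness
(`FinitelyEquivalent.homTo`) gives a homomorphism `φ` from `S_J` to `T`. Adding the fibres of `φ` to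
`D` yields a finite description `D'` (`fibreDescription`), still with all arities at most `r`. The
target `B` is the free structure of `M/D'` generated by `K_r^h`. It is finite because `M/D'` has
finitely many elements of each arity, and it receives `F_M(K_r^h)` through the quotient map. The
cases `r = 1` and `M(1)` empty are degenerate, and one point suffices as `B`.

An input `X` is turned into `Ψ_X`, this into a system of equations `x^κ₁ = y^κ₂` between variables
of arity `h`, and the system into a structure: each variable contributes `r ^ h` elements, standing
for its minors of arity `r`, and each equation contributes one fact. A solution in `M` gives a
homomorphism to `F_M(K_r^h)` (`homTo_freeStr_of_models`). Conversely, a homomorphism to `B` gives a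
solution in `M/D'` (`exists_holds_of_isHom_quotStr`). The reason is that a class of `M/D'` is
determined by its minors of arity `r`, and already by those along maps with a prescribed first
value. So one fact can record `x^κ₁` at some positions and `y^κ₂` at the others, and still force the
two to be equal.

Hence `Ψ_X` holds in `M/D'`. This minion maps to `M/D`, so the internal references and stability put
the values of the variables into `U` and into the properties of the symbols. As `φ` is constant on
`D'`-classes of `U`, the values of the `x_v` give a homomorphism from `X` to `T`
(`exists_isHom_of_holds`). Each of its values is read off a single element of the constructed
structure.

A many-one reduction demands an equivalence, so `β` first checks that `z` is a homomorphism and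
otherwise outputs a word that encodes no map (`polyManyOneReducible_of_decoder`). Polynomial time is
shown with explicit machines: one translates formulas (`Conv.polyTime_toInstance`), another checks
and decodes tables (`polyTime_checkHom`), and they are combined by `PolyTime.comp` and
`PolyTime.withSide`. -/

namespace MinionPattern

open Turing Function

/-! ### Program fragments for multi-stack machines -/

section Fragments

variable {K : Type} [DecidableEq K] {Γ : K → Type} {σ Λ Λ' : Type}

/-- Replace the labels of a statement along `emb`, and `halt` by a jump to `exit`. -/
def relabel (emb : Λ → Λ') (exit : Option Λ') : TM2.Stmt Γ Λ σ → TM2.Stmt Γ Λ' σ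
  | .push k f q => .push k f (relabel emb exit q)
  | .peek k f q => .peek k f (relabel emb exit q)
  | .pop k f q => .pop k f (relabel emb exit q)
  | .load f q => .load f (relabel emb exit q)
  | .branch f q₁ q₂ => .branch f (relabel emb exit q₁) (relabel emb exit q₂)
  | .goto f => .goto fun v => emb (f v)
  | .halt => match exit with
    | none => .halt
    | some l => .goto fun _ => l

theorem stepAux_relabel (emb : Λ → Λ') (exit : Option Λ') (q : TM2.Stmt Γ Λ σ) (v : σ)
    (S : ∀ k, List (Γ k)) :
    TM2.stepAux (relabel emb exit q) v S =
      ⟨((TM2.stepAux q v S).l.map emb).orElse fun _ => exit, (TM2.stepAux q v S).var,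
        (TM2.stepAux q v S).stk⟩ := by
  induction q generalizing v S with
  | push k f q ih => simp [relabel, ih]
  | peek k f q ih => simp [relabel, ih]
  | pop k f q ih => simp [relabel, ih]
  | load f q ih => simp [relabel, ih]
  | branch f q₁ q₂ ih₁ ih₂ => cases hf : f v <;> simp [relabel, ih₁, ih₂, hf]
  | goto f => simp [relabel]
  | halt => cases exit <;> simp [relabel]

/-- `n` steps of a machine lead from one configuration to another one. -/
def Steps (m : Λ → TM2.Stmt Γ Λ σ) (n : ℕ) (c c' : TM2.Cfg Γ Λ σ) : Prop :=
  (flip bind (TM2.step m))^[n] (some c) = some c'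

theorem steps_none_iterate (m : Λ → TM2.Stmt Γ Λ σ) (n : ℕ) :
    (flip bind (TM2.step m))^[n] none = none := by
  induction n with
  | zero => rfl
  | succ n ih => rw [iterate_succ_apply]; exact ih

theorem Steps.head_iff (m : Λ → TM2.Stmt Γ Λ σ) (n : ℕ) (l : Λ) (v : σ) (S : ∀ k, List (Γ k))
    (c' : TM2.Cfg Γ Λ σ) :
    Steps m (n + 1) ⟨some l, v, S⟩ c' ↔ Steps m n (TM2.stepAux (m l) v S) c' := by
  unfold Steps
  rw [iterate_succ_apply]
  rfl

/-- `Steps` counts steps exactly and `TM2.step` is undefined on a halted configuration, so only zero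
steps can follow. -/
theorem Steps.halt_eq {m : Λ → TM2.Stmt Γ Λ σ} {n : ℕ} {v : σ} {S : ∀ k, List (Γ k)}
    {c' : TM2.Cfg Γ Λ σ} (hs : Steps m n ⟨none, v, S⟩ c') : c' = ⟨none, v, S⟩ := by
  cases n with
  | zero => exact (Option.some.inj hs).symm
  | succ n =>
    unfold Steps at hs
    rw [iterate_succ_apply] at hs
    have : flip bind (TM2.step m) (some (⟨none, v, S⟩ : TM2.Cfg Γ Λ σ)) = none := rfl
    rw [this, steps_none_iterate] at hs
    cases hs

theorem Steps.trans {m : Λ → TM2.Stmt Γ Λ σ} {n n' : ℕ} {c c' c'' : TM2.Cfg Γ Λ σ}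
    (h₁ : Steps m n c c') (h₂ : Steps m n' c' c'') : Steps m (n + n') c c'' := by
  unfold Steps at *
  rw [add_comm, iterate_add_apply, h₁, h₂]

/-- The step in which the original program halts becomes the jump to `exit`. Gluing programs
therefore costs no step, and times simply add in `Runs.seq`. -/
theorem Steps.relabel {m : Λ → TM2.Stmt Γ Λ σ} {m' : Λ' → TM2.Stmt Γ Λ' σ} {emb : Λ → Λ'}
    {exit : Option Λ'} (hm : ∀ l, m' (emb l) = MinionPattern.relabel emb exit (m l)) {n : ℕ}
    {l : Λ} {v v' : σ} {S S' : ∀ k, List (Γ k)}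
    (hs : Steps m n ⟨some l, v, S⟩ ⟨none, v', S'⟩) :
    Steps m' n ⟨some (emb l), v, S⟩ ⟨exit, v', S'⟩ := by
  induction n generalizing l v S with
  | zero => cases Option.some.inj hs
  | succ n ih =>
    rw [Steps.head_iff] at hs ⊢
    rw [hm, stepAux_relabel]
    rcases hc : TM2.stepAux (m l) v S with ⟨l₁, v₁, S₁⟩
    rw [hc] at hs
    cases l₁ with
    | some l₁ => exact ih hs
    | none =>
      have h₁ := hs.halt_eq
      cases h₁
      cases n with
      | zero => rfl
      | succ n =>
        unfold Steps at hs
        rw [iterate_succ_apply] at hs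
        have : flip bind (TM2.step m) (some (⟨none, v', S'⟩ : TM2.Cfg Γ Λ σ)) = none := rfl
        rw [this, steps_none_iterate] at hs
        cases hs

/-- A program fragment: finitely many labels with a statement for each, and a first label. -/
structure Frag (Γ : K → Type) (σ : Type) where
  Λ : Type
  fin : Finite Λ
  main : Λ
  m : Λ → TM2.Stmt Γ Λ σ

namespace Frag

/-- The fragment halts within `t` steps, and transforms the state as given. -/
def Runs (F : Frag Γ σ) (v : σ) (S : ∀ k, List (Γ k)) (v' : σ) (S' : ∀ k, List (Γ k))
    (t : ℕ) : Prop :=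
  ∃ n ≤ t, Steps F.m n ⟨some F.main, v, S⟩ ⟨none, v', S'⟩

theorem Runs.mono {F : Frag Γ σ} {v v' : σ} {S S' : ∀ k, List (Γ k)} {t t' : ℕ}
    (hr : F.Runs v S v' S' t) (ht : t ≤ t') : F.Runs v S v' S' t' :=
  hr.imp fun _ hn => ⟨hn.1.trans ht, hn.2⟩

/-- Run two fragments one after the other. -/
def seq (F G : Frag Γ σ) : Frag Γ σ where
  Λ := F.Λ ⊕ G.Λ
  fin := by have := F.fin; have := G.fin; infer_instance
  main := .inl F.main
  m
    | .inl l => relabel .inl (some (.inr G.main)) (F.m l)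
    | .inr l => relabel .inr none (G.m l)

theorem Runs.seq {F G : Frag Γ σ} {v v₁ v₂ : σ} {S S₁ S₂ : ∀ k, List (Γ k)} {t t' : ℕ}
    (hF : F.Runs v S v₁ S₁ t) (hG : G.Runs v₁ S₁ v₂ S₂ t') :
    (F.seq G).Runs v S v₂ S₂ (t + t') := by
  obtain ⟨n, hn, hF⟩ := hF
  obtain ⟨n', hn', hG⟩ := hG
  refine ⟨n + n', by omega, ?_⟩
  exact (hF.relabel (m' := (F.seq G).m) (emb := .inl) (exit := some (.inr G.main))
    fun _ => rfl).trans (hG.relabel (m' := (F.seq G).m) (emb := .inr) (exit := none) fun _ => rfl)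

/-- The fragment that does nothing. -/
def skip : Frag Γ σ where
  Λ := Unit
  fin := inferInstance
  main := ()
  m _ := .halt

theorem runs_skip (v : σ) (S : ∀ k, List (Γ k)) : (skip : Frag Γ σ).Runs v S v S 1 :=
  ⟨1, le_rfl, rfl⟩

/-- Conditional execution. -/
def ite (b : σ → Bool) (F G : Frag Γ σ) : Frag Γ σ where
  Λ := Option (F.Λ ⊕ G.Λ)
  fin := by have := F.fin; have := G.fin; infer_instance
  main := none
  m
    | none => .branch b (.goto fun _ => some (.inl F.main)) (.goto fun _ => some (.inr G.main))
    | some (.inl l) => relabel (fun l => some (.inl l)) none (F.m l)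
    | some (.inr l) => relabel (fun l => some (.inr l)) none (G.m l)

theorem Runs.ite_true {b : σ → Bool} {F G : Frag Γ σ} {v v' : σ} {S S' : ∀ k, List (Γ k)}
    {t : ℕ} (hF : F.Runs v S v' S' t) (hb : b v = true) : (ite b F G).Runs v S v' S' (t + 1) := by
  obtain ⟨n, hn, hF⟩ := hF
  refine ⟨n + 1, by omega, ?_⟩
  rw [Steps.head_iff]
  have := hF.relabel (m' := (ite b F G).m) (emb := fun l => some (.inl l)) (exit := none)
    fun _ => rfl
  simpa [ite, hb] using this

theorem Runs.ite_false {b : σ → Bool} {F G : Frag Γ σ} {v v' : σ} {S S' : ∀ k, List (Γ k)}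
    {t : ℕ} (hG : G.Runs v S v' S' t) (hb : b v = false) :
    (ite b F G).Runs v S v' S' (t + 1) := by
  obtain ⟨n, hn, hG⟩ := hG
  refine ⟨n + 1, by omega, ?_⟩
  rw [Steps.head_iff]
  have := hG.relabel (m' := (ite b F G).m) (emb := fun l => some (.inr l)) (exit := none)
    fun _ => rfl
  simpa [ite, hb] using this

/-- Repeated execution while a condition holds. -/
def loop (b : σ → Bool) (F : Frag Γ σ) : Frag Γ σ where
  Λ := Option F.Λ
  fin := by have := F.fin; infer_instance
  main := none
  m
    | none => .branch b (.goto fun _ => some F.main) .halt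
    | some l => relabel some (some none) (F.m l)

theorem runs_loop_false {b : σ → Bool} {F : Frag Γ σ} {v : σ} (hb : b v = false)
    (S : ∀ k, List (Γ k)) : (loop b F).Runs v S v S 1 := by
  refine ⟨1, le_rfl, ?_⟩
  rw [Steps.head_iff]
  simp [loop, hb, Steps]

theorem Runs.loop_true {b : σ → Bool} {F : Frag Γ σ} {v v₁ v₂ : σ}
    {S S₁ S₂ : ∀ k, List (Γ k)} {t t' : ℕ} (hF : F.Runs v S v₁ S₁ t) (hb : b v = true)
    (hL : (loop b F).Runs v₁ S₁ v₂ S₂ t') : (loop b F).Runs v S v₂ S₂ (t + 1 + t') := by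
  obtain ⟨n, hn, hF⟩ := hF
  obtain ⟨n', hn', hL⟩ := hL
  refine ⟨n + 1 + n', by omega, ?_⟩
  refine Steps.trans ?_ hL
  rw [Steps.head_iff]
  have := hF.relabel (m' := (loop b F).m) (emb := some) (exit := some none) fun _ => rfl
  simpa [loop, hb] using this

/-- Push a list of symbols, the head first. -/
def pushAll (S : ∀ k, List (Γ k)) (l : List (Σ k, Γ k)) : ∀ k, List (Γ k) :=
  l.foldl (fun S p => update S p.1 (p.2 :: S p.1)) S

@[simp] theorem pushAll_nil (S : ∀ k, List (Γ k)) : pushAll S [] = S := rfl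

@[simp] theorem pushAll_cons (S : ∀ k, List (Γ k)) (p : Σ k, Γ k) (l : List (Σ k, Γ k)) :
    pushAll S (p :: l) = pushAll (update S p.1 (p.2 :: S p.1)) l := rfl

theorem pushAll_append (S : ∀ k, List (Γ k)) (l l' : List (Σ k, Γ k)) :
    pushAll S (l ++ l') = pushAll (pushAll S l) l' := by
  simp [pushAll]

theorem pushAll_replicate (S : ∀ k, List (Γ k)) (k : K) (a : Γ k) (n : ℕ) :
    pushAll S (List.replicate n ⟨k, a⟩) = update S k (List.replicate n a ++ S k) := by
  induction n generalizing S with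
  | zero => simp
  | succ n ih =>
    rw [List.replicate_succ, pushAll_cons, ih]
    simp [List.replicate_succ']

/-- The statement that pushes fixed symbols and halts. -/
def pushStmt : List (Σ k, Γ k) → TM2.Stmt Γ Λ σ
  | [] => .halt
  | p :: l => .push p.1 (fun _ => p.2) (pushStmt l)

theorem stepAux_pushStmt (l : List (Σ k, Γ k)) (v : σ) (S : ∀ k, List (Γ k)) :
    TM2.stepAux (pushStmt l : TM2.Stmt Γ Λ σ) v S = ⟨none, v, pushAll S l⟩ := by
  induction l generalizing S with
  | nil => rfl
  | cons p l ih => simp [pushStmt, ih]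

/-- Pop a symbol, update the internal state, and push symbols that depend on the new state. -/
def op [Finite σ] (k : K) (upd : σ → Option (Γ k) → σ) (out : σ → List (Σ k, Γ k)) :
    Frag Γ σ where
  Λ := Option σ
  fin := inferInstance
  main := none
  m
    -- Which stacks a statement pushes on cannot depend on the state, so the new state is turned
    -- into a label.
    | none => .pop k upd (.goto some)
    | some v => pushStmt (out v)

theorem runs_op [Finite σ] (k : K) (upd : σ → Option (Γ k) → σ) (out : σ → List (Σ k, Γ k))
    (v : σ) (S : ∀ k, List (Γ k)) :
    (op k upd out).Runs v S (upd v (S k).head?)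
      (pushAll (update S k (S k).tail) (out (upd v (S k).head?))) 2 := by
  refine ⟨2, le_rfl, ?_⟩
  rw [Steps.head_iff]
  simp only [op, TM2.stepAux]
  rw [show (1 : ℕ) = 0 + 1 from rfl, Steps.head_iff]
  simp only [stepAux_pushStmt]
  rfl

/-- Update the internal state, and push symbols that depend on the new state. -/
def act [Finite σ] (upd : σ → σ) (out : σ → List (Σ k, Γ k)) : Frag Γ σ where
  Λ := Option σ
  fin := inferInstance
  main := none
  m
    | none => .load upd (.goto some)
    | some v => pushStmt (out v)

theorem runs_act [Finite σ] (upd : σ → σ) (out : σ → List (Σ k, Γ k))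
    (v : σ) (S : ∀ k, List (Γ k)) :
    (act upd out).Runs v S (upd v) (pushAll S (out (upd v))) 2 := by
  refine ⟨2, le_rfl, ?_⟩
  rw [Steps.head_iff]
  simp only [act, TM2.stepAux]
  rw [show (1 : ℕ) = 0 + 1 from rfl, Steps.head_iff]
  simp only [stepAux_pushStmt]
  rfl

theorem Runs.congr {F : Frag Γ σ} {v v' w w' : σ} {S S' T T' : ∀ k, List (Γ k)} {t t' : ℕ}
    (hr : F.Runs v S v' S' t) (h₁ : v = w) (h₂ : S = T) (h₃ : v' = w') (h₄ : S' = T')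
    (ht : t ≤ t') : F.Runs w T w' T' t' := by
  subst h₁ h₂ h₃ h₄
  exact hr.mono ht

theorem runs_op' [Finite σ] {k : K} {upd : σ → Option (Γ k) → σ} {out : σ → List (Σ k, Γ k)}
    {v v' : σ} {S S' : ∀ k, List (Γ k)} {t : ℕ} (hv : upd v (S k).head? = v')
    (hS : pushAll (update S k (S k).tail) (out v') = S') (ht : 2 ≤ t) :
    (op k upd out).Runs v S v' S' t :=
  (runs_op k upd out v S).congr rfl rfl hv (by rw [hv, hS]) ht

theorem runs_act' [Finite σ] {upd : σ → σ} {out : σ → List (Σ k, Γ k)}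
    {v v' : σ} {S S' : ∀ k, List (Γ k)} {t : ℕ} (hv : upd v = v')
    (hS : pushAll S (out v') = S') (ht : 2 ≤ t) :
    (act upd out).Runs v S v' S' t :=
  (runs_act upd out v S).congr rfl rfl hv (by rw [hv, hS]) ht

end Frag

end Fragments

/-! ### Extra stacks and extra internal states -/

section Lift

variable {K₁ K₂ : Type} {Γ₁ : K₁ → Type} {Γ₂ : K₂ → Type} {σ₁ σ₂ Λ : Type}

/-- The alphabets of two families of stacks side by side. -/
@[reducible] def SumAlph (Γ₁ : K₁ → Type) (Γ₂ : K₂ → Type) : K₁ ⊕ K₂ → Type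
  | .inl k => Γ₁ k
  | .inr k => Γ₂ k

/-- Two families of stacks side by side. -/
def joinStk (S₁ : ∀ k, List (Γ₁ k)) (S₂ : ∀ k, List (Γ₂ k)) : ∀ k, List (SumAlph Γ₁ Γ₂ k)
  | .inl k => S₁ k
  | .inr k => S₂ k

@[simp] theorem joinStk_inl (S₁ : ∀ k, List (Γ₁ k)) (S₂ : ∀ k, List (Γ₂ k)) (k : K₁) :
    joinStk S₁ S₂ (.inl k) = S₁ k := rfl

@[simp] theorem joinStk_inr (S₁ : ∀ k, List (Γ₁ k)) (S₂ : ∀ k, List (Γ₂ k)) (k : K₂) :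
    joinStk S₁ S₂ (.inr k) = S₂ k := rfl

variable [DecidableEq K₁] [DecidableEq K₂]

theorem update_joinStk_inl (S₁ : ∀ k, List (Γ₁ k)) (S₂ : ∀ k, List (Γ₂ k)) (k : K₁)
    (l : List (Γ₁ k)) :
    update (joinStk S₁ S₂) (.inl k) l = joinStk (update S₁ k l) S₂ := by
  funext j
  rcases j with j | j
  · by_cases hj : j = k
    · subst hj; simp
    · rw [update_of_ne (by simpa using hj)]; simp [hj]
  · rw [update_of_ne (by simp)]; rfl

theorem update_joinStk_inr (S₁ : ∀ k, List (Γ₁ k)) (S₂ : ∀ k, List (Γ₂ k)) (k : K₂)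
    (l : List (Γ₂ k)) :
    update (joinStk S₁ S₂) (.inr k) l = joinStk S₁ (update S₂ k l) := by
  funext j
  rcases j with j | j
  · rw [update_of_ne (by simp)]; rfl
  · by_cases hj : j = k
    · subst hj; simp
    · rw [update_of_ne (by simpa using hj)]; simp [hj]

/-- A statement, executed on the first family of stacks. -/
def liftL : TM2.Stmt Γ₁ Λ σ₁ → TM2.Stmt (SumAlph Γ₁ Γ₂) Λ (σ₁ × σ₂)
  | .push k f q => .push (.inl k) (fun v => f v.1) (liftL q)
  | .peek k f q => .peek (.inl k) (fun v a => (f v.1 a, v.2)) (liftL q)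
  | .pop k f q => .pop (.inl k) (fun v a => (f v.1 a, v.2)) (liftL q)
  | .load f q => .load (fun v => (f v.1, v.2)) (liftL q)
  | .branch f q₁ q₂ => .branch (fun v => f v.1) (liftL q₁) (liftL q₂)
  | .goto f => .goto fun v => f v.1
  | .halt => .halt

/-- A statement, executed on the second family of stacks. -/
def liftR : TM2.Stmt Γ₂ Λ σ₂ → TM2.Stmt (SumAlph Γ₁ Γ₂) Λ (σ₁ × σ₂)
  | .push k f q => .push (.inr k) (fun v => f v.2) (liftR q)
  | .peek k f q => .peek (.inr k) (fun v a => (v.1, f v.2 a)) (liftR q)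
  | .pop k f q => .pop (.inr k) (fun v a => (v.1, f v.2 a)) (liftR q)
  | .load f q => .load (fun v => (v.1, f v.2)) (liftR q)
  | .branch f q₁ q₂ => .branch (fun v => f v.2) (liftR q₁) (liftR q₂)
  | .goto f => .goto fun v => f v.2
  | .halt => .halt

theorem stepAux_liftL (q : TM2.Stmt Γ₁ Λ σ₁) (v : σ₁ × σ₂) (S₁ : ∀ k, List (Γ₁ k))
    (S₂ : ∀ k, List (Γ₂ k)) :
    TM2.stepAux (liftL q) v (joinStk S₁ S₂) = ⟨(TM2.stepAux q v.1 S₁).l,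
      ((TM2.stepAux q v.1 S₁).var, v.2), joinStk (TM2.stepAux q v.1 S₁).stk S₂⟩ := by
  induction q generalizing v S₁ with
  | push k f q ih => simp only [liftL, TM2.stepAux]; rw [update_joinStk_inl, ih]; rfl
  | peek k f q ih => simp only [liftL, TM2.stepAux]; rw [ih]; rfl
  | pop k f q ih => simp only [liftL, TM2.stepAux]; rw [update_joinStk_inl, ih]; rfl
  | load f q ih => simp only [liftL, TM2.stepAux]; rw [ih]
  | branch f q₁ q₂ ih₁ ih₂ =>
    simp only [liftL, TM2.stepAux]
    cases f v.1
    · exact ih₂ _ _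
    · exact ih₁ _ _
  | goto f => rfl
  | halt => rfl

theorem stepAux_liftR (q : TM2.Stmt Γ₂ Λ σ₂) (v : σ₁ × σ₂) (S₁ : ∀ k, List (Γ₁ k))
    (S₂ : ∀ k, List (Γ₂ k)) :
    TM2.stepAux (liftR q) v (joinStk S₁ S₂) = ⟨(TM2.stepAux q v.2 S₂).l,
      (v.1, (TM2.stepAux q v.2 S₂).var), joinStk S₁ (TM2.stepAux q v.2 S₂).stk⟩ := by
  induction q generalizing v S₂ with
  | push k f q ih => simp only [liftR, TM2.stepAux]; rw [update_joinStk_inr, ih]; rfl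
  | peek k f q ih => simp only [liftR, TM2.stepAux]; rw [ih]; rfl
  | pop k f q ih => simp only [liftR, TM2.stepAux]; rw [update_joinStk_inr, ih]; rfl
  | load f q ih => simp only [liftR, TM2.stepAux]; rw [ih]
  | branch f q₁ q₂ ih₁ ih₂ =>
    simp only [liftR, TM2.stepAux]
    cases f v.2
    · exact ih₂ _ _
    · exact ih₁ _ _
  | goto f => rfl
  | halt => rfl

theorem Steps.liftL {m : Λ → TM2.Stmt Γ₁ Λ σ₁} {n : ℕ} {l l' : Option Λ} {v v' : σ₁}
    {S S' : ∀ k, List (Γ₁ k)} (hs : Steps m n ⟨l, v, S⟩ ⟨l', v', S'⟩) (w : σ₂)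
    (S₂ : ∀ k, List (Γ₂ k)) :
    Steps (fun l => MinionPattern.liftL (m l)) n ⟨l, (v, w), joinStk S S₂⟩
      ⟨l', (v', w), joinStk S' S₂⟩ := by
  induction n generalizing l v S with
  | zero => cases hs; rfl
  | succ n ih =>
    cases l with
    | none =>
      unfold Steps at hs
      rw [iterate_succ_apply] at hs
      exact absurd (hs.symm.trans (steps_none_iterate m n)) (by simp)
    | some l =>
      rw [Steps.head_iff] at hs ⊢
      rw [stepAux_liftL]
      exact ih hs

theorem Steps.liftR {m : Λ → TM2.Stmt Γ₂ Λ σ₂} {n : ℕ} {l l' : Option Λ} {v v' : σ₂}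
    {S S' : ∀ k, List (Γ₂ k)} (hs : Steps m n ⟨l, v, S⟩ ⟨l', v', S'⟩) (w : σ₁)
    (S₁ : ∀ k, List (Γ₁ k)) :
    Steps (fun l => MinionPattern.liftR (m l)) n ⟨l, (w, v), joinStk S₁ S⟩
      ⟨l', (w, v'), joinStk S₁ S'⟩ := by
  induction n generalizing l v S with
  | zero => cases hs; rfl
  | succ n ih =>
    cases l with
    | none =>
      unfold Steps at hs
      rw [iterate_succ_apply] at hs
      exact absurd (hs.symm.trans (steps_none_iterate m n)) (by simp)
    | some l =>
      rw [Steps.head_iff] at hs ⊢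
      rw [stepAux_liftR]
      exact ih hs

namespace Frag

/-- A fragment, executed on the first family of stacks. -/
def liftL (F : Frag Γ₁ σ₁) : Frag (SumAlph Γ₁ Γ₂) (σ₁ × σ₂) where
  Λ := F.Λ
  fin := F.fin
  main := F.main
  m l := MinionPattern.liftL (F.m l)

/-- A fragment, executed on the second family of stacks. -/
def liftR (F : Frag Γ₂ σ₂) : Frag (SumAlph Γ₁ Γ₂) (σ₁ × σ₂) where
  Λ := F.Λ
  fin := F.fin
  main := F.main
  m l := MinionPattern.liftR (F.m l)

theorem Runs.liftL {F : Frag Γ₁ σ₁} {v v' : σ₁} {S S' : ∀ k, List (Γ₁ k)} {t : ℕ}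
    (hr : F.Runs v S v' S' t) (w : σ₂) (S₂ : ∀ k, List (Γ₂ k)) :
    (F.liftL : Frag (SumAlph Γ₁ Γ₂) (σ₁ × σ₂)).Runs (v, w) (joinStk S S₂) (v', w)
      (joinStk S' S₂) t :=
  hr.imp fun _ hn => ⟨hn.1, hn.2.liftL w S₂⟩

theorem Runs.liftR {F : Frag Γ₂ σ₂} {v v' : σ₂} {S S' : ∀ k, List (Γ₂ k)} {t : ℕ}
    (hr : F.Runs v S v' S' t) (w : σ₁) (S₁ : ∀ k, List (Γ₁ k)) :
    (F.liftR : Frag (SumAlph Γ₁ Γ₂) (σ₁ × σ₂)).Runs (w, v) (joinStk S₁ S) (w, v')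
      (joinStk S₁ S') t :=
  hr.imp fun _ hn => ⟨hn.1, hn.2.liftR w S₁⟩

end Frag

end Lift

/-! ### Growth of the stacks -/

section Growth

variable {K : Type} [DecidableEq K] {Γ : K → Type} {σ Λ : Type}

/-- An upper bound for the number of symbols that a statement pushes. -/
def pushCount : TM2.Stmt Γ Λ σ → ℕ
  | .push _ _ q => pushCount q + 1
  | .peek _ _ q => pushCount q
  | .pop _ _ q => pushCount q
  | .load _ q => pushCount q
  | .branch _ q₁ q₂ => pushCount q₁ + pushCount q₂
  | .goto _ => 0
  | .halt => 0

theorem length_stepAux_le (q : TM2.Stmt Γ Λ σ) (v : σ) (S : ∀ k, List (Γ k)) (k : K) :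
    ((TM2.stepAux q v S).stk k).length ≤ (S k).length + pushCount q := by
  induction q generalizing v S with
  | push j f q ih =>
    refine (ih _ _).trans ?_
    by_cases hj : k = j
    · subst hj; simp [pushCount]; omega
    · simp [pushCount, hj]
  | peek j f q ih => exact ih _ _
  | pop j f q ih =>
    refine (ih _ _).trans ?_
    by_cases hj : k = j
    · subst hj; simp [pushCount]
    · simp [pushCount, hj]
  | load f q ih => exact ih _ _
  | branch f q₁ q₂ ih₁ ih₂ =>
    simp only [TM2.stepAux, pushCount]
    cases f v
    · have := ih₂ v S; simp only [cond_false]; omega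
    · have := ih₁ v S; simp only [cond_true]; omega
  | goto f => simp [pushCount, TM2.stepAux]
  | halt => simp [pushCount, TM2.stepAux]

/-- There are finitely many labels, so one constant bounds the number of pushes in a single step.
Output lengths are thereby controlled by running times. -/
theorem exists_growth_bound [Finite Λ] (m : Λ → TM2.Stmt Γ Λ σ) :
    ∃ C : ℕ, ∀ (n : ℕ) (c c' : TM2.Cfg Γ Λ σ), Steps m n c c' → ∀ k,
      (c'.stk k).length ≤ (c.stk k).length + C * n := by
  obtain ⟨C, hC⟩ := (Set.finite_range fun l => pushCount (m l)).bddAbove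
  refine ⟨C, fun n => ?_⟩
  induction n with
  | zero => intro c c' hs k; cases hs; simp
  | succ n ih =>
    rintro ⟨l, v, S⟩ c' hs k
    cases l with
    | none =>
      unfold Steps at hs
      rw [iterate_succ_apply] at hs
      exact absurd (hs.symm.trans (steps_none_iterate m n)) (by simp)
    | some l =>
      rw [Steps.head_iff] at hs
      have h₁ := ih _ _ hs k
      have h₂ := length_stepAux_le (m l) v S k
      have h₃ : pushCount (m l) ≤ C := hC ⟨l, rfl⟩
      simp only at *
      rw [mul_add]
      omega

end Growth

/-! ### Scanning a stack -/

section Scan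

variable {K : Type} [DecidableEq K] {Γ : K → Type} {R Y : Type}

theorem pushAll_update {S : ∀ k, List (Γ k)} {k : K} {l : List (Γ k)} {ps : List (Σ k, Γ k)}
    (hps : ∀ p ∈ ps, p.1 ≠ k) :
    Frag.pushAll (update S k l) ps = update (Frag.pushAll S ps) k l := by
  induction ps generalizing S with
  | nil => rfl
  | cons p ps ih =>
    simp only [List.mem_cons, forall_eq_or_imp] at hps
    rw [Frag.pushAll_cons, Frag.pushAll_cons, ← ih hps.2, update_comm hps.1.symm,
      update_of_ne hps.1]

theorem pushAll_apply_of_ne {S : ∀ k, List (Γ k)} {k : K} {ps : List (Σ k, Γ k)}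
    (hps : ∀ p ∈ ps, p.1 ≠ k) : Frag.pushAll S ps k = S k := by
  induction ps generalizing S with
  | nil => rfl
  | cons p ps ih =>
    simp only [List.mem_cons, forall_eq_or_imp] at hps
    rw [Frag.pushAll_cons, ih hps.2, update_of_ne hps.1.symm]

namespace Frag

variable [Finite R] [Finite Y] {k : K} {e : Γ k → Y} {u : R → Y → R}
  {halts : R → Y → Bool} {w : R → Y → List (Σ k, Γ k)}

/-- One round of `scan`. -/
def scanBody (k : K) (e : Γ k → Y) (u : R → Y → R) (halts : R → Y → Bool)
    (w : R → Y → List (Σ k, Γ k)) : Frag Γ (R × Option (Option Y)) :=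
  (op k
    (fun v a => match a with
      | none => (v.1, none)
      | some a => (u v.1 (e a), some (some (e a))))
    (fun v => match v.2 with
      | some (some a) => w v.1 a
      | _ => [])).seq
  (act
    (fun v => match v.2 with
      | some (some a) => if halts v.1 a then (v.1, none) else v
      | _ => v)
    (fun _ => []))

/-- The loop of `scan`. -/
def scanLoop (k : K) (e : Γ k → Y) (u : R → Y → R) (halts : R → Y → Bool)
    (w : R → Y → List (Σ k, Γ k)) : Frag Γ (R × Option (Option Y)) :=
  loop (fun v => v.2.isSome) (scanBody k e u halts w)

/-- Pop the symbols of a stack one after another, update the registers, and push symbols on other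
stacks, until the stack is empty or a condition is met. -/
def scan (k : K) (e : Γ k → Y) (u : R → Y → R) (halts : R → Y → Bool)
    (w : R → Y → List (Σ k, Γ k)) : Frag Γ (R × Option (Option Y)) :=
  (act (fun v => (v.1, some none)) (fun _ => [])).seq (scanLoop k e u halts w)

/-- A round takes two steps for the pop, two for the stopping condition and one for the loop test;
leaving the loop takes one more. -/
theorem runs_scanLoop_nil {ρ : R} {S : ∀ k, List (Γ k)} (hS : S k = []) (y : Option Y) :
    (scanLoop k e u halts w).Runs (ρ, some y) S (ρ, none) S 6 := by
  refine (Runs.loop_true (t := 4) (t' := 1) (v₁ := (ρ, none)) (S₁ := S) ?_ rfl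
    (runs_loop_false rfl S)).mono le_rfl
  refine Runs.seq (t := 2) (t' := 2) (v₁ := (ρ, none)) (S₁ := S)
    (runs_op' ?_ ?_ le_rfl) (runs_act' rfl rfl le_rfl)
  · simp [hS]
  · have : update S k [] = S := by rw [← hS, update_eq_self]
    simp [hS, this]

theorem runs_scanBody {ρ : R} {S : ∀ k, List (Γ k)} {a : Γ k} {l : List (Γ k)}
    (hS : S k = a :: l) (y : Option Y) :
    (scanBody k e u halts w).Runs (ρ, some y) S
      (u ρ (e a), if halts (u ρ (e a)) (e a) then none else some (some (e a)))
      (pushAll (update S k l) (w (u ρ (e a)) (e a))) 4 := by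
  refine Runs.seq (t := 2) (t' := 2) (v₁ := (u ρ (e a), some (some (e a))))
    (S₁ := pushAll (update S k l) (w (u ρ (e a)) (e a)))
    (runs_op' ?_ ?_ le_rfl) (runs_act' ?_ rfl le_rfl)
  · simp [hS]
  · simp only [hS, List.tail_cons]
  · cases hs : halts (u ρ (e a)) (e a) <;> simp [hs]

theorem Runs.scanLoop_cons {ρ ρ' : R} {S S' : ∀ k, List (Γ k)} {a : Γ k} {l : List (Γ k)} {t : ℕ}
    (hS : S k = a :: l) (hs : halts (u ρ (e a)) (e a) = false)
    (hL : ∀ y, (scanLoop k e u halts w).Runs (u ρ (e a), some y)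
      (pushAll (update S k l) (w (u ρ (e a)) (e a))) (ρ', none) S' t) (y : Option Y) :
    (scanLoop k e u halts w).Runs (ρ, some y) S (ρ', none) S' (t + 5) := by
  have hB := runs_scanBody (e := e) (u := u) (halts := halts) (w := w) (ρ := ρ) hS y
  rw [hs] at hB
  exact (Runs.loop_true hB rfl (hL _)).mono (by omega)

theorem runs_scanLoop_stop {ρ : R} {S : ∀ k, List (Γ k)} {a : Γ k} {l : List (Γ k)}
    (hS : S k = a :: l) (hs : halts (u ρ (e a)) (e a) = true) (y : Option Y) :
    (scanLoop k e u halts w).Runs (ρ, some y) S (u ρ (e a), none)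
      (pushAll (update S k l) (w (u ρ (e a)) (e a))) 6 := by
  have hB := runs_scanBody (e := e) (u := u) (halts := halts) (w := w) (ρ := ρ) hS y
  rw [hs] at hB
  exact Runs.loop_true hB rfl (runs_loop_false rfl _)

theorem Runs.scan {ρ ρ' : R} {S S' : ∀ k, List (Γ k)} {t : ℕ} {z : Option (Option Y)}
    (hL : ∀ y, (scanLoop k e u halts w).Runs (ρ, some y) S (ρ', none) S' t) :
    (scan k e u halts w).Runs (ρ, z) S (ρ', none) S' (t + 2) :=
  (Runs.seq (runs_act' (t := 2) rfl rfl le_rfl) (hL none)).mono (by omega)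

/-- Empty a stack, and push symbols for each of its symbols. -/
def drain (k : K) (e : Γ k → Y) (w : R → Y → List (Σ k, Γ k)) : Frag Γ (R × Option (Option Y)) :=
  scan k e (fun ρ _ => ρ) (fun _ _ => false) w

/-- Pushing one symbol per popped symbol reverses a word, so transfers come in pairs when the order
matters. The condition `hw` keeps the drained stack from being refilled. -/
theorem runs_drain {ρ : R} {z : Option (Option Y)} (S : ∀ k, List (Γ k))
    (hw : ∀ a, ∀ p ∈ w ρ a, p.1 ≠ k) :
    (drain k e w).Runs (ρ, z) S (ρ, none)
      (pushAll (update S k []) ((S k).flatMap fun a => w ρ (e a))) (5 * (S k).length + 8) := by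
  suffices H : ∀ (l : List (Γ k)) (S : ∀ k, List (Γ k)) (y), S k = l →
      (scanLoop k e (fun ρ _ => ρ) (fun _ _ => false) w).Runs (ρ, some y) S (ρ, none)
        (pushAll (update S k []) (l.flatMap fun a => w ρ (e a))) (5 * l.length + 6) from
    (Runs.scan fun y => H _ S y rfl).mono (by omega)
  intro l
  induction l with
  | nil =>
    intro S y hS
    refine (runs_scanLoop_nil hS y).congr rfl rfl rfl ?_ (by simp)
    have : update S k [] = S := by rw [← hS, update_eq_self]
    simp [this]
  | cons a l ih =>
    intro S y hS
    refine (Runs.scanLoop_cons hS rfl (fun y => ih _ y ?_) y).congr rfl rfl rfl ?_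
      (by simp; omega)
    · rw [pushAll_apply_of_ne (hw _)]; simp
    · rw [List.flatMap_cons, pushAll_append]
      congr 1
      rw [← pushAll_update (hw _)]
      simp

end Frag
end Scan

/-! ### Functions computable in polynomial time -/

section PolyTime

theorem polynomial_eval_mono (p : Polynomial ℕ) {m n : ℕ} (hmn : m ≤ n) : p.eval m ≤ p.eval n := by
  rw [Polynomial.eval_eq_sum_range, Polynomial.eval_eq_sum_range]
  gcongr

variable {α β A B : Type} {ea : α → List A} {eb : β → List B} {f : α → β}

theorem dite_eq_update {K : Type} [DecidableEq K] {Γ : K → Type} (k₀ : K) (s : List (Γ k₀)) :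
    (fun k => if h : k = k₀ then (by rw [h]; exact s : List (Γ k)) else []) = update (fun _ => []) k₀ s := by
  funext k
  by_cases hk : k = k₀
  · subst hk
    simp
  · simp [hk]

/-- The final configuration must have the initial internal state and only the output on its stacks,
so a fragment has to clean up after itself. -/
theorem polyTime_of_frag {K : Type} [DecidableEq K] [Finite K] {Γ : K → Type} {σ : Type}
    [Finite σ] (k₀ k₁ : K) [Finite (Γ k₀)] (F : Frag Γ σ) (v₀ : σ) (i : Γ k₀ ≃ A) (o : Γ k₁ ≃ B)
    (p : Polynomial ℕ)
    (hF : ∀ a, F.Runs v₀ (update (fun _ => []) k₀ ((ea a).map i.symm)) v₀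
      (update (fun _ => []) k₁ ((eb (f a)).map o.symm)) (p.eval (ea a).length)) :
    PolyTime ea eb f := by
  have := F.fin
  have := Fintype.ofFinite F.Λ
  have := Fintype.ofFinite K
  have := Fintype.ofFinite σ
  have := Fintype.ofFinite (Γ k₀)
  let tm : FinTM2 := { k₀ := k₀, k₁ := k₁, Γ := Γ, Λ := F.Λ, main := F.main, σ := σ,
                       initialState := v₀, m := F.m }
  have hi : ∀ s : List (Γ k₀), initList tm s = ⟨some F.main, v₀, update (fun _ => []) k₀ s⟩ := by
    intro s
    unfold initList
    congr 1
    exact dite_eq_update (Γ := Γ) _ s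
  have ho : ∀ s : List (Γ k₁), haltList tm s = ⟨none, v₀, update (fun _ => []) k₁ s⟩ := by
    intro s
    unfold haltList
    congr 1
    exact dite_eq_update (Γ := Γ) _ s
  refine ⟨⟨⟨tm, i, o⟩, p, fun a => ?_⟩⟩
  have h₁ := (hF a).choose_spec
  refine ⟨⟨(hF a).choose, ?_⟩, h₁.1⟩
  have h₂ := h₁.2
  unfold Steps at h₂
  refine Eq.trans ?_ (h₂.trans ?_)
  · exact congrArg _ (congrArg some (hi _))
  · exact congrArg some (ho _).symm

theorem polyTime_of_frag_refl {K : Type} [DecidableEq K] [Finite K] {Γ : K → Type} {σ : Type}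
    [Finite σ] (k₀ k₁ : K) [Finite (Γ k₀)] {ea : α → List (Γ k₀)} {eb : β → List (Γ k₁)}
    (F : Frag Γ σ) (v₀ : σ) (p : Polynomial ℕ)
    (hF : ∀ a, F.Runs v₀ (update (fun _ => []) k₀ (ea a)) v₀
      (update (fun _ => []) k₁ (eb (f a))) (p.eval (ea a).length)) :
    PolyTime ea eb f :=
  polyTime_of_frag k₀ k₁ F v₀ (Equiv.refl _) (Equiv.refl _) p (by simpa using hF)

theorem PolyTime.exists_frag (hf : PolyTime ea eb f) :
    ∃ (K : Type) (_ : DecidableEq K) (_ : Finite K) (Γ : K → Type) (σ : Type) (_ : Finite σ)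
      (k₀ k₁ : K) (F : Frag Γ σ) (v₀ : σ) (_ : Finite (Γ k₀)) (i : Γ k₀ ≃ A) (o : Γ k₁ ≃ B)
      (p : Polynomial ℕ), ∀ a, F.Runs v₀ (update (fun _ => []) k₀ ((ea a).map i.symm)) v₀
      (update (fun _ => []) k₁ ((eb (f a)).map o.symm)) (p.eval (ea a).length) := by
  obtain ⟨⟨⟨tm, i, o⟩, p, hp⟩⟩ := hf
  have hK := tm.kFin
  have hΛ := tm.ΛFin
  have hσ := tm.σFin
  have hΓ := tm.Γk₀Fin
  refine ⟨tm.K, tm.kDecidableEq, inferInstance, tm.Γ, tm.σ, inferInstance, tm.k₀, tm.k₁,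
    ⟨tm.Λ, inferInstance, tm.main, tm.m⟩, tm.initialState, inferInstance, i, o, p, fun a => ?_⟩
  have hi : ∀ s : List (tm.Γ tm.k₀),
      initList tm s = ⟨some tm.main, tm.initialState, update (fun _ => []) tm.k₀ s⟩ := by
    intro s
    unfold initList
    congr 1
    exact dite_eq_update (Γ := tm.Γ) _ s
  have ho : ∀ s : List (tm.Γ tm.k₁),
      haltList tm s = ⟨none, tm.initialState, update (fun _ => []) tm.k₁ s⟩ := by
    intro s
    unfold haltList
    congr 1
    exact dite_eq_update (Γ := tm.Γ) _ s
  refine ⟨(hp a).steps, (hp a).steps_le_m, ?_⟩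
  have h₁ := (hp a).evals_in_steps
  refine Eq.trans ?_ (h₁.trans ?_)
  · exact congrArg _ (congrArg some (hi _).symm)
  · exact congrArg some (ho _)

/-- The length of the output is polynomially bounded. -/
theorem PolyTime.exists_length_le (hf : PolyTime ea eb f) :
    ∃ p : Polynomial ℕ, ∀ a, (eb (f a)).length ≤ p.eval (ea a).length := by
  obtain ⟨K, _, _, Γ, σ, _, k₀, k₁, F, v₀, _, i, o, p, hF⟩ := hf.exists_frag
  have := F.fin
  obtain ⟨C, hC⟩ := exists_growth_bound F.m
  refine ⟨Polynomial.X + Polynomial.C C * p, fun a => ?_⟩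
  obtain ⟨n, hn, hs⟩ := hF a
  have h₁ := hC n _ _ hs k₁
  have h₂ : (update (fun _ => []) k₀ ((ea a).map i.symm) k₁ : List (Γ k₁)).length
      ≤ (ea a).length := by
    by_cases hk : k₁ = k₀
    · subst hk; simp
    · simp [hk]
  have h₃ : C * n ≤ C * p.eval (ea a).length := Nat.mul_le_mul_left _ hn
  simp at h₁ ⊢
  omega

/-- A machine sees only words, so the data behind them can be exchanged. This is how promised words,
the instances behind them and their formulas are identified. -/
theorem PolyTime.reindex {α' β' : Type} {ea' : α' → List A} {eb' : β' → List B} {f' : α' → β'}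
    (hf : PolyTime ea eb f) (g : α' → α) (ha : ∀ a, ea' a = ea (g a))
    (hb : ∀ a, eb' (f' a) = eb (f (g a))) : PolyTime ea' eb' f' := by
  obtain ⟨⟨tm, p, hp⟩⟩ := hf
  exact ⟨⟨tm, p, fun a => by rw [ha, hb]; exact hp (g a)⟩⟩

end PolyTime
end MinionPattern

namespace MinionPattern

open Turing Function

/-! ### Composition and side inputs -/

theorem pushAll_flatMap_singleton {K : Type} [DecidableEq K] {Γ : K → Type} {T : Type}
    (S : ∀ k, List (Γ k)) (k : K) (l : List T) (g : T → Γ k) :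
    Frag.pushAll S (l.flatMap fun a => [⟨k, g a⟩]) = update S k ((l.map g).reverse ++ S k) := by
  induction l generalizing S with
  | nil => simp
  | cons a l ih => rw [List.flatMap_cons, Frag.pushAll_append, ih]; simp

theorem joinStk_nil {K₁ K₂ : Type} {Γ₁ : K₁ → Type} {Γ₂ : K₂ → Type} :
    joinStk (fun k => ([] : List (Γ₁ k))) (fun k => ([] : List (Γ₂ k))) = fun _ => [] := by
  funext k
  cases k <;> rfl

section Comp

variable {α β γ A B C : Type} {ea : α → List A} {eb : β → List B} {ec : γ → List C}
  {f : α → β} {g : β → γ}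

/-- The two machines run on disjoint families of stacks. The intermediate word is drained twice,
through an extra stack, which restores its order. Its length is polynomial by `exists_length_le`,
hence so is the second running time. `B` must be finite because a drained symbol passes through the
internal state. -/
theorem PolyTime.comp [Finite B] (hg : PolyTime eb ec g) (hf : PolyTime ea eb f) :
    PolyTime ea ec (g ∘ f) := by
  obtain ⟨q, hq⟩ := hf.exists_length_le
  obtain ⟨K₁, _, _, Γ₁, σ₁, _, i₁, o₁, F, v₁, _, eA, eB, p₁, hF⟩ := hf.exists_frag
  obtain ⟨K₂, _, _, Γ₂, σ₂, _, i₂, o₂, G, v₂, _, eB', eC, p₂, hG⟩ := hg.exists_frag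
  let Γ₃ : Unit → Type := fun _ => B
  let Γ := SumAlph (SumAlph Γ₁ Γ₂) Γ₃
  let F' : Frag Γ ((σ₁ × σ₂) × Option (Option B)) := F.liftL.liftL
  let G' : Frag Γ ((σ₁ × σ₂) × Option (Option B)) := G.liftR.liftL
  let D₁ : Frag Γ ((σ₁ × σ₂) × Option (Option B)) :=
    Frag.drain (.inl (.inl o₁)) eB fun _ b => [⟨.inr (), b⟩]
  let D₂ : Frag Γ ((σ₁ × σ₂) × Option (Option B)) :=
    Frag.drain (.inr ()) id fun _ b => [⟨.inl (.inr i₂), eB'.symm b⟩]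
  have : Finite (Γ (.inl (.inl i₁))) := inferInstanceAs (Finite (Γ₁ i₁))
  refine polyTime_of_frag (Γ := Γ) (.inl (.inl i₁)) (.inl (.inr o₂))
    (F'.seq (D₁.seq (D₂.seq G'))) ((v₁, v₂), none) eA eC
    (p₁ + 10 * q + 16 + p₂.comp q) fun a => ?_
  have e₁ : ∀ s : List (Γ₁ i₁), (update (fun _ => []) (Sum.inl (Sum.inl i₁)) s :
      ∀ k, List (Γ k)) = (joinStk (joinStk (update (fun _ => []) i₁ s) fun _ => []) fun _ => [] :
        ∀ k, List (Γ k)) := by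
    intro s
    rw [← update_joinStk_inl, ← update_joinStk_inl, joinStk_nil, joinStk_nil]
  have e₂ : ∀ s : List (Γ₂ o₂), (update (fun _ => []) (Sum.inl (Sum.inr o₂)) s :
      ∀ k, List (Γ k)) = (joinStk (joinStk (fun _ => []) (update (fun _ => []) o₂ s)) fun _ => [] :
        ∀ k, List (Γ k)) := by
    intro s
    rw [← update_joinStk_inr, ← update_joinStk_inl, joinStk_nil, joinStk_nil]
  have R₁ := ((hF a).liftL v₂ (fun k => ([] : List (Γ₂ k)))).liftL (none : Option (Option B))
    (fun k => ([] : List (Γ₃ k)))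
  have R₄ := ((hG (f a)).liftR v₁ (fun k => ([] : List (Γ₁ k)))).liftL
    (none : Option (Option B)) (fun k => ([] : List (Γ₃ k)))
  have R₂ := Frag.runs_drain (Γ := Γ) (k := .inl (.inl o₁)) (e := eB)
    (w := fun (_ : σ₁ × σ₂) b => [⟨.inr (), b⟩]) (ρ := (v₁, v₂)) (z := none)
    (joinStk (joinStk (update (fun _ => []) o₁ ((eb (f a)).map eB.symm)) fun _ => [])
      fun _ => []) (by simp)
  have R₃ := Frag.runs_drain (Γ := Γ) (k := .inr ()) (e := id)
    (w := fun (_ : σ₁ × σ₂) b => [⟨.inl (.inr i₂), eB'.symm b⟩]) (ρ := (v₁, v₂)) (z := none)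
    (joinStk (fun _ => []) (update (fun _ => []) () (eb (f a)).reverse)) (by simp)
  have hq' : (eb (f a)).length ≤ q.eval (ea a).length := hq a
  refine (Frag.Runs.seq R₁ (Frag.Runs.seq (R₂.congr rfl rfl rfl ?_ le_rfl)
    (Frag.Runs.seq (R₃.congr rfl rfl rfl ?_ le_rfl) R₄))).congr rfl (e₁ _).symm rfl (e₂ _).symm ?_
  · rw [pushAll_flatMap_singleton (Γ := Γ), update_joinStk_inl, update_joinStk_inl,
      update_joinStk_inr]
    simp [joinStk_nil, Γ₃]
  · rw [pushAll_flatMap_singleton (Γ := Γ), update_joinStk_inr, ← joinStk_nil,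
      update_joinStk_inl, update_joinStk_inr]
    simp
  · have h₂ := polynomial_eval_mono p₂ hq'
    simp [Polynomial.eval_comp]
    omega

end Comp

/-- The stacks that carry a side input past a computation. -/
inductive PassStk
  | inp | fst | snd | res | out
  deriving DecidableEq

instance : Finite PassStk :=
  Finite.of_surjective (fun i : Fin 5 => [PassStk.inp, .fst, .snd, .res, .out][i])
    (by intro k; cases k <;> decide)

/-- The alphabets of the stacks that carry a side input. -/
@[reducible] def PassAlph (A B C : Type) : PassStk → Type
  | .inp => A ⊕ C
  | .fst => A
  | .snd => C
  | .res => B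
  | .out => B ⊕ C

namespace PassStk

variable {A B C : Type} (i : List (A ⊕ C)) (f : List A) (s : List C) (r : List B)
  (o : List (B ⊕ C))

/-- The contents of the stacks. -/
def mk : ∀ k, List (PassAlph A B C k)
  | .inp => i
  | .fst => f
  | .snd => s
  | .res => r
  | .out => o

theorem update_inp (x) : update (mk i f s r o) inp x = mk x f s r o := by
  funext k; cases k <;> rfl

theorem update_fst (x) : update (mk i f s r o) fst x = mk i x s r o := by
  funext k; cases k <;> rfl

theorem update_snd (x) : update (mk i f s r o) snd x = mk i f x r o := by
  funext k; cases k <;> rfl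

theorem update_res (x) : update (mk i f s r o) res x = mk i f s x o := by
  funext k; cases k <;> rfl

theorem update_out (x) : update (mk i f s r o) out x = mk i f s r x := by
  funext k; cases k <;> rfl

theorem mk_nil : mk [] [] [] [] [] = fun k => ([] : List (PassAlph A B C k)) := by
  funext k; cases k <;> rfl

end PassStk

/-- A word next to a side input. -/
def withSide {α A C : Type} (ea : α → List A) (p : α × List C) : List (A ⊕ C) :=
  (ea p.1).map .inl ++ p.2.map .inr

/-- The side input is parked on a stack of its own while the machine runs. It goes to the output
stack before the result, since it has to end up below it. -/
theorem PolyTime.withSide {α β A B C : Type} {ea : α → List A} {eb : β → List B} {f : α → β}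
    [Finite A] [Finite B] [Finite C] (hf : PolyTime ea eb f) :
    PolyTime (MinionPattern.withSide (C := C) ea) (MinionPattern.withSide eb)
      (Prod.map f id) := by
  obtain ⟨q, hq⟩ := hf.exists_length_le
  obtain ⟨K, _, _, Γ₁, σ, _, k₀, k₁, F, v₀, _, eA, eB, p, hF⟩ := hf.exists_frag
  let Y := (A ⊕ C) ⊕ B
  let Γ := SumAlph Γ₁ (PassAlph A B C)
  let T := σ × Option (Option Y)
  let D₁ : Frag Γ T := Frag.drain (.inr .inp) .inl fun _ y => match y with
    | .inl (.inl a) => [⟨.inr .fst, a⟩]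
    | .inl (.inr c) => [⟨.inr .snd, c⟩]
    | .inr _ => []
  let D₂ : Frag Γ T := Frag.drain (.inr .fst) (fun a => .inl (.inl a)) fun _ y => match y with
    | .inl (.inl a) => [⟨.inl k₀, eA.symm a⟩]
    | _ => []
  let D₃ : Frag Γ T := Frag.drain (.inl k₁) (fun b => .inr (eB b)) fun _ y => match y with
    | .inr b => [⟨.inr .res, b⟩]
    | _ => []
  let D₄ : Frag Γ T := Frag.drain (.inr .snd) (fun c => .inl (.inr c)) fun _ y => match y with
    | .inl (.inr c) => [⟨.inr .out, .inr c⟩]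
    | _ => []
  let D₅ : Frag Γ T := Frag.drain (.inr .res) .inr fun _ y => match y with
    | .inr b => [⟨.inr .out, .inl b⟩]
    | _ => []
  have : Finite (Γ (.inr .inp)) := inferInstanceAs (Finite (A ⊕ C))
  refine polyTime_of_frag_refl (Γ := Γ) (.inr .inp) (.inr .out)
    (D₁.seq (D₂.seq (F.liftL.seq (D₃.seq (D₄.seq D₅))))) (v₀, none)
    (15 * Polynomial.X + p + 10 * q + 40) fun ⟨a, z⟩ => ?_
  have N : (fun _ => []) = (joinStk (fun _ => []) (PassStk.mk [] [] [] [] []) :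
      ∀ k, List (Γ k)) := by rw [PassStk.mk_nil, joinStk_nil]
  have R₁ : D₁.Runs (v₀, none) (joinStk (fun _ => [])
      (PassStk.mk (MinionPattern.withSide ea (a, z)) [] [] [] [])) (v₀, none)
      (joinStk (fun _ => []) (PassStk.mk [] (ea a).reverse z.reverse [] []))
      (5 * ((ea a).length + z.length) + 8) := by
    refine (Frag.runs_drain (Γ := Γ) _ ?_).congr rfl rfl rfl ?_ ?_
    · rintro ((_ | _) | _) <;> simp
    · rw [joinStk_inr]
      simp only [PassStk.mk, MinionPattern.withSide, List.flatMap_append, List.flatMap_map]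
      rw [Frag.pushAll_append, pushAll_flatMap_singleton (Γ := Γ),
        pushAll_flatMap_singleton (Γ := Γ)]
      rw [update_joinStk_inr, PassStk.update_inp, update_joinStk_inr, PassStk.update_fst,
        update_joinStk_inr, PassStk.update_snd]
      simp [PassStk.mk]
    · simp [PassStk.mk, MinionPattern.withSide]
  have R₂ : D₂.Runs (v₀, none)
      (joinStk (fun _ => []) (PassStk.mk [] (ea a).reverse z.reverse [] [])) (v₀, none)
      (joinStk (update (fun _ => []) k₀ ((ea a).map eA.symm))
        (PassStk.mk [] [] z.reverse [] [])) (5 * (ea a).length + 8) := by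
    refine (Frag.runs_drain (Γ := Γ) _ ?_).congr rfl rfl rfl ?_ ?_
    · rintro ((_ | _) | _) <;> simp
    · rw [joinStk_inr]
      simp only [PassStk.mk]
      rw [pushAll_flatMap_singleton (Γ := Γ), update_joinStk_inr, PassStk.update_fst,
        update_joinStk_inl]
      simp
    · simp [PassStk.mk]
  have R₃ := (hF a).liftL (none : Option (Option Y))
    (PassStk.mk ([] : List (A ⊕ C)) [] z.reverse ([] : List B) [])
  have R₄ : D₃.Runs (v₀, none)
      (joinStk (update (fun _ => []) k₁ ((eb (f a)).map eB.symm))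
        (PassStk.mk [] [] z.reverse [] [])) (v₀, none)
      (joinStk (fun _ => []) (PassStk.mk [] [] z.reverse (eb (f a)).reverse []))
      (5 * (eb (f a)).length + 8) := by
    refine (Frag.runs_drain (Γ := Γ) _ ?_).congr rfl rfl rfl ?_ ?_
    · rintro ((_ | _) | _) <;> simp
    · rw [joinStk_inl]
      rw [pushAll_flatMap_singleton (Γ := Γ), update_joinStk_inl, update_joinStk_inr,
        PassStk.update_res]
      simp [PassStk.mk]
    · simp
  have R₅ : D₄.Runs (v₀, none)
      (joinStk (fun _ => []) (PassStk.mk [] [] z.reverse (eb (f a)).reverse [])) (v₀, none)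
      (joinStk (fun _ => []) (PassStk.mk [] [] [] (eb (f a)).reverse (z.map .inr)))
      (5 * z.length + 8) := by
    refine (Frag.runs_drain (Γ := Γ) _ ?_).congr rfl rfl rfl ?_ ?_
    · rintro ((_ | _) | _) <;> simp
    · rw [joinStk_inr]
      simp only [PassStk.mk]
      rw [pushAll_flatMap_singleton (Γ := Γ), update_joinStk_inr, PassStk.update_snd,
        update_joinStk_inr, PassStk.update_out]
      simp [PassStk.mk]
    · simp [PassStk.mk]
  have R₆ : D₅.Runs (v₀, none)
      (joinStk (fun _ => []) (PassStk.mk [] [] [] (eb (f a)).reverse (z.map .inr))) (v₀, none)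
      (joinStk (fun _ => []) (PassStk.mk [] [] [] []
        (MinionPattern.withSide eb (f a, z)))) (5 * (eb (f a)).length + 8) := by
    refine (Frag.runs_drain (Γ := Γ) _ ?_).congr rfl rfl rfl ?_ ?_
    · rintro ((_ | _) | _) <;> simp
    · rw [joinStk_inr]
      simp only [PassStk.mk]
      rw [pushAll_flatMap_singleton (Γ := Γ), update_joinStk_inr, PassStk.update_res,
        update_joinStk_inr, PassStk.update_out]
      simp [PassStk.mk, MinionPattern.withSide]
    · simp [PassStk.mk]
  refine (R₁.seq (R₂.seq (R₃.seq (R₄.seq (R₅.seq R₆))))).congr rfl ?_ rfl ?_ ?_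
  · rw [N, update_joinStk_inr, PassStk.update_inp]
  · rw [N, update_joinStk_inr, PassStk.update_out]
    rfl
  · have h₁ := hq a
    have h₂ : (ea a).length ≤ (MinionPattern.withSide ea (a, z)).length := by
      simp [MinionPattern.withSide]
    have h₃ : (MinionPattern.withSide ea (a, z)).length = (ea a).length + z.length := by
      simp [MinionPattern.withSide]
    have h₄ := polynomial_eval_mono p h₂
    have h₅ := polynomial_eval_mono q h₂
    simp only [Polynomial.eval_add, Polynomial.eval_mul, Polynomial.eval_X,
      Polynomial.eval_ofNat]
    omega

end MinionPattern

namespace MinionPattern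

open Turing Function

/-! ### Formulas as systems of constraints -/

/-- The map `[a] → [b]` that fixes the numbers below `b` and sends the others to the first one. -/
def clip (a b : ℕ+) (i : Fin a) : Fin b := if hi : i.1 < b then ⟨i, hi⟩ else ⟨0, b.pos⟩

theorem clip_comp_clip {a b : ℕ+} (hab : a ≤ b) : clip b a ∘ clip a b = id := by
  funext i
  have h₁ : (i : ℕ) < b := i.2.trans_le hab
  simp [clip, h₁]

variable {S : Signature} {M : Minion.{u}} {Γ Δ : List ℕ+} {h r : ℕ+}

/-- A term of arity `n`, lifted to arity `h`, is this minor of its variable. -/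
def Tm.kappa (h : ℕ+) : {n : ℕ+} → Tm Γ n → Fin h → Fin h
  | _, .var _ => id
  | _, .minor (n := n) (m := m) σ t => (clip m h ∘ σ ∘ clip h n) ∘ t.kappa h

/-- The index of the variable of a term. -/
def Tm.varIndex : {n : ℕ+} → Tm Γ n → ℕ
  | _, .var x => x.index
  | _, .minor _ t => t.varIndex

/-- The equation `x ^ κ₁ = y ^ κ₂` between variables of arity `h`. -/
structure Constraint (h : ℕ+) where
  κ₁ : Fin h → Fin h
  κ₂ : Fin h → Fin h
  x : ℕ
  y : ℕ

/-- An assignment satisfies a constraint. -/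
def Constraint.Holds (M : Minion.{u}) (val : ℕ → M.obj h) (k : Constraint h) : Prop :=
  M.minor k.κ₁ (val k.x) = M.minor k.κ₂ (val k.y)

/-- The number of quantifiers. -/
def PP.exCount : {Γ : List ℕ+} → PP Γ → ℕ
  | _, .top => 0
  | _, .eq _ _ => 0
  | _, .and φ ψ => φ.exCount + ψ.exCount
  | _, .ex _ φ => φ.exCount + 1

/-- The constraints of a formula.  The free variables are named by the numbers in `ids`, and the
bound variables are numbered consecutively from `c` on. -/
def PP.constraints (h : ℕ+) : {Γ : List ℕ+} → PP Γ → List ℕ → ℕ → List (Constraint h)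
  | _, .top, _, _ => []
  | _, .eq s t, ids, _ =>
    [⟨s.kappa h, t.kappa h, ids.getD s.varIndex 0, ids.getD t.varIndex 0⟩]
  | _, .and φ ψ, ids, c => φ.constraints h ids c ++ ψ.constraints h ids (c + φ.exCount)
  -- The trivial equation gives every variable a fact of its own. A homomorphism to the target then
  -- has to take all the minors of the variable from one element of arity `h`.
  | _, .ex _ φ, ids, c => ⟨id, id, c, c⟩ :: φ.constraints h (c :: ids) (c + 1)

theorem Var.index_lt {n : ℕ+} (x : Var Γ n) : x.index < Γ.length := by
  induction x with
  | zero => simp [Var.index]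
  | succ x ih => simpa [Var.index] using ih

theorem Tm.varIndex_lt {n : ℕ+} (t : Tm Γ n) : t.varIndex < Γ.length := by
  induction t with
  | var x => exact x.index_lt
  | minor σ t ih => exact ih

theorem Tm.ArityLE.le {n : ℕ+} {t : Tm Γ n} (ht : t.ArityLE h) : n ≤ h := by
  cases t with
  | var x => exact ht
  | minor σ t => exact ht.1

theorem getD_lt {ids : List ℕ} {c i : ℕ} (hids : ∀ j ∈ ids, j < c) (hi : i < ids.length) :
    ids.getD i 0 < c := by
  rw [List.getD_eq_getElem _ _ hi]
  exact hids _ (List.getElem_mem hi)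

theorem PP.constraints_lt (φ : PP Γ) {ids : List ℕ} {c : ℕ} (hlen : ids.length = Γ.length)
    (hids : ∀ j ∈ ids, j < c) :
    ∀ k ∈ φ.constraints h ids c, k.x < c + φ.exCount ∧ k.y < c + φ.exCount := by
  induction φ generalizing ids c with
  | top => simp [PP.constraints]
  | eq s t =>
    simpa [PP.constraints, PP.exCount] using
      And.intro (getD_lt hids (hlen ▸ s.varIndex_lt)) (getD_lt hids (hlen ▸ t.varIndex_lt))
  | and φ ψ ih₁ ih₂ =>
    intro k hk
    simp only [PP.constraints, PP.exCount, List.mem_append] at hk ⊢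
    rcases hk with hk | hk
    · have := ih₁ hlen hids k hk; omega
    · have := ih₂ hlen (fun j hj => (hids j hj).trans_le (Nat.le_add_right c φ.exCount)) k hk
      omega
  | ex n φ ih =>
    intro k hk
    simp only [PP.constraints, PP.exCount, List.mem_cons] at hk ⊢
    rcases hk with rfl | hk
    · simp only; omega
    · have := ih (ids := c :: ids) (c := c + 1) (by simp [hlen]) (by
        intro j hj
        rcases List.mem_cons.1 hj with rfl | hj
        · omega
        · have := hids j hj; omega) k hk
      omega

/-- Every value is lifted to arity `h`. An operation on lifted values first undoes the lift, and
`clip h n` does so because the subterms have arity at most `h`. -/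
theorem Tm.minor_kappa {n : ℕ+} (t : Tm Γ n) (ht : t.ArityLE h) {e : Env M Γ} {ids : List ℕ}
    {val : ℕ → M.obj h}
    (hval : ∀ m (x : Var Γ m), val (ids.getD x.index 0) = M.minor (clip m h) (e m x)) :
    M.minor (t.kappa h) (val (ids.getD t.varIndex 0)) = M.minor (clip n h) (t.eval e) := by
  induction t with
  | var x => exact (M.minor_id _).trans (hval _ x)
  | minor σ t ih =>
    simp only [Tm.kappa, Tm.varIndex, Tm.eval]
    rw [M.minor_comp, ih ht.2, ← M.minor_comp, ← M.minor_comp, comp_assoc, comp_assoc,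
      clip_comp_clip ht.2.le, comp_id]

/-- A true formula gives a solution of its constraints. -/
theorem PP.Sat.exists_holds {φ : PP Γ} (hφ : φ.ArityLE h) {e : Env M Γ} (hs : φ.Sat M e)
    {ids : List ℕ} {c : ℕ} (hlen : ids.length = Γ.length) (hids : ∀ j ∈ ids, j < c)
    {val : ℕ → M.obj h}
    (hval : ∀ m (x : Var Γ m), val (ids.getD x.index 0) = M.minor (clip m h) (e m x)) :
    ∃ val' : ℕ → M.obj h, (∀ j < c, val' j = val j) ∧
      (∀ j, c + φ.exCount ≤ j → val' j = val j) ∧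
      ∀ k ∈ φ.constraints h ids c, k.Holds M val' := by
  induction φ generalizing ids c val with
  | top => exact ⟨val, by simp [PP.constraints]⟩
  | eq s t =>
    refine ⟨val, by simp, by simp, ?_⟩
    simp only [PP.constraints, List.mem_singleton, forall_eq, Constraint.Holds]
    rw [s.minor_kappa hφ.1 hval, t.minor_kappa hφ.2 hval]
    exact congrArg _ hs
  | and φ ψ ih₁ ih₂ =>
    obtain ⟨val₁, h₁, h₁', h₁''⟩ := ih₁ hφ.1 hs.1 hlen hids hval
    have hids' : ∀ j ∈ ids, j < c + φ.exCount := fun j hj =>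
      (hids j hj).trans_le (Nat.le_add_right _ _)
    -- The two conjuncts use disjoint ranges of numbers for their bound variables, so the second
    -- solution does not disturb the first.
    obtain ⟨val₂, h₂, h₂', h₂''⟩ := ih₂ hφ.2 hs.2 hlen hids' (val := val₁) (by
      intro m x
      rw [h₁ _ (getD_lt hids (hlen ▸ x.index_lt)), hval])
    refine ⟨val₂, fun j hj => ?_, fun j hj => ?_, fun k hk => ?_⟩
    · rw [h₂ j (by omega), h₁ j hj]
    · simp only [PP.exCount] at hj
      rw [h₂' j (by omega), h₁' j (by omega)]
    · rcases List.mem_append.1 hk with hk | hk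
      · have hlt := φ.constraints_lt hlen hids k hk
        have := h₁'' k hk
        unfold Constraint.Holds at this ⊢
        rwa [h₂ _ hlt.1, h₂ _ hlt.2]
      · exact h₂'' k hk
  | ex n φ ih =>
    obtain ⟨f, hf⟩ := hs
    have hids' : ∀ j ∈ c :: ids, j < c + 1 := by
      intro j hj
      rcases List.mem_cons.1 hj with rfl | hj
      · omega
      · have := hids j hj; omega
    obtain ⟨val', h₁, h₂, h₃⟩ := ih hφ.2 hf (ids := c :: ids) (by simp [hlen]) hids'
      (val := update val c (M.minor (clip n h) f)) (by
        intro m x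
        cases x with
        | zero => simp [Var.index, Env.cons]
        | succ x =>
          have hlt := getD_lt hids (hlen ▸ x.index_lt)
          simp only [Var.index, List.getD_cons_succ, Env.cons]
          rw [update_of_ne hlt.ne, hval])
    refine ⟨val', fun j hj => ?_, fun j hj => ?_, fun k hk => ?_⟩
    · rw [h₁ j (by omega), update_of_ne hj.ne]
    · simp only [PP.exCount] at hj
      rw [h₂ j (by omega), update_of_ne (by omega)]
    · rcases List.mem_cons.1 hk with rfl | hk
      · rfl
      · exact h₃ k hk

/-- A true quantifier has a witness, and minors carry it to every arity. This provides a default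
value for the numbers that name no variable. -/
theorem PP.Sat.nonempty_obj {φ : PP Γ} {e : Env M Γ} (hs : φ.Sat M e) (hφ : 0 < φ.exCount)
    (n : ℕ+) : Nonempty (M.obj n) := by
  induction φ with
  | top => simp [PP.exCount] at hφ
  | eq s t => simp [PP.exCount] at hφ
  | and φ ψ ih₁ ih₂ =>
    simp only [PP.exCount] at hφ
    rcases Nat.eq_zero_or_pos φ.exCount with h₀ | h₀
    · exact ih₂ hs.2 (by omega)
    · exact ih₁ hs.1 h₀
  | ex m φ ih =>
    obtain ⟨f, hf⟩ := hs
    exact ⟨M.minor (clip m n) f⟩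

/-- A solution of the constraints makes the formula true. -/
theorem PP.sat_of_holds {φ : PP Γ} (hφ : φ.ArityLE h) {ids : List ℕ} {c : ℕ}
    {val : ℕ → M.obj h} (hval : ∀ k ∈ φ.constraints h ids c, k.Holds M val) {e : Env M Γ}
    (he : ∀ m (x : Var Γ m), e m x = M.minor (clip h m) (val (ids.getD x.index 0))) :
    φ.Sat M e := by
  have ht : ∀ {Γ : List ℕ+} {ids : List ℕ} {e : Env M Γ}
      (he : ∀ m (x : Var Γ m), e m x = M.minor (clip h m) (val (ids.getD x.index 0))) {n : ℕ+}
      (t : Tm Γ n), t.ArityLE h →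
      t.eval e = M.minor (clip h n) (M.minor (t.kappa h) (val (ids.getD t.varIndex 0))) := by
    intro Γ ids e he n t ht
    induction t with
    | var x => exact (he _ x).trans (congrArg _ (M.minor_id _).symm)
    | minor σ t ih =>
      simp only [Tm.kappa, Tm.varIndex, Tm.eval]
      rw [ih ht.2, M.minor_comp _ (t.kappa h), ← M.minor_comp, ← M.minor_comp (clip h _),
        ← comp_assoc, clip_comp_clip ht.1, id_comp]
  induction φ generalizing ids c with
  | top => trivial
  | eq s t =>
    simp only [PP.constraints, List.mem_singleton, forall_eq, Constraint.Holds] at hval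
    exact (ht he s hφ.1).trans ((congrArg _ hval).trans (ht he t hφ.2).symm)
  | and φ ψ ih₁ ih₂ =>
    simp only [PP.constraints, List.mem_append] at hval
    exact ⟨ih₁ hφ.1 (fun k hk => hval k (.inl hk)) he, ih₂ hφ.2 (fun k hk => hval k (.inr hk)) he⟩
  | ex n φ ih =>
    simp only [PP.constraints, List.mem_cons] at hval
    -- The value `val c` need not be a lift from arity `n`. Its truncation still works, because by
    -- `ht` each side of an equation evaluates to the truncation of the corresponding side of the
    -- constraint.
    refine ⟨M.minor (clip h n) (val c), ih hφ.2 (fun k hk => hval k (.inr hk)) ?_⟩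
    intro m x
    cases x with
    | zero => simp [Var.index, Env.cons]
    | succ x => simpa [Var.index, Env.cons] using he m x

/-- The head of the context is quantified innermost, and numbers are given from the outside in. So
the variable of index `i` receives the number `Γ.length - 1 - i`, which is the source of the
reversals in the decoding. -/
theorem PP.forall_constraints_of_exAll {P : Constraint h → Prop} {φ : PP Γ}
    (hP : ∀ k ∈ (PP.exAll Γ φ).constraints h [] 0, P k) :
    ∀ k ∈ φ.constraints h (List.range Γ.length).reverse Γ.length, P k := by
  induction Γ with
  | nil => exact hP
  | cons n Γ ih =>
    intro k hk
    refine ih (φ := .ex n φ) hP k (List.mem_cons_of_mem _ ?_)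
    simpa [List.range_succ] using hk

theorem PP.ArityLE.of_exAll {φ : PP Γ} (hφ : (PP.exAll Γ φ).ArityLE h) : φ.ArityLE h := by
  induction Γ with
  | nil => exact hφ
  | cons n Γ ih => exact (ih (φ := .ex n φ) hφ).2

/-! ### Satisfaction of renamed formulas -/

theorem Tm.eval_rename {n : ℕ+} (ρ : Ren Γ Δ) (t : Tm Γ n) (e : Env M Δ) :
    (t.rename ρ).eval e = t.eval fun n x => e n (ρ n x) := by
  induction t with
  | var x => rfl
  | minor σ t ih => simp only [Tm.rename, Tm.eval, ih]

theorem PP.sat_rename (ρ : Ren Γ Δ) (φ : PP Γ) (e : Env M Δ) :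
    (φ.rename ρ).Sat M e ↔ φ.Sat M fun n x => e n (ρ n x) := by
  induction φ generalizing Δ with
  | top => rfl
  | eq s t => simp only [PP.rename, PP.Sat, Tm.eval_rename]
  | and φ ψ ih₁ ih₂ => simp only [PP.rename, PP.Sat, ih₁, ih₂]
  | ex n φ ih =>
    simp only [PP.rename, PP.Sat, ih]
    refine exists_congr fun f => iff_of_eq (congrArg (PP.Sat M · φ) ?_)
    funext m x
    cases x <;> rfl

theorem PP.sat_at {m : ℕ+} (ψ : PP [m]) (x : Var Γ m) (e : Env M Γ) :
    (ψ.at x).Sat M e ↔ ModelsAt M ψ (e m x) := by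
  unfold PP.at ModelsAt
  rw [PP.sat_rename]
  refine iff_of_eq (congrArg (PP.Sat M · ψ) ?_)
  funext n y
  cases y with
  | zero => rfl
  | succ y => exact nomatch y

theorem PP.sat_conj (l : List (PP Γ)) (e : Env M Γ) :
    (PP.conj l).Sat M e ↔ ∀ φ ∈ l, φ.Sat M e := by
  unfold PP.conj
  induction l with
  | nil => simp [PP.Sat]
  | cons φ l ih => simp [PP.Sat, ih]

theorem Var.index_right {n : ℕ+} (Γ : List ℕ+) (x : Var Δ n) :
    (Var.right Γ x).index = Γ.length + x.index := by
  induction Γ with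
  | nil => simp [Var.right]
  | cons m Γ ih => simp [Var.right, Var.index, ih]; omega

theorem Var.index_ofReplicate (m : ℕ+) (k : ℕ) (i : Fin k) :
    (Var.ofReplicate m k i).index = i := by
  induction k with
  | zero => exact i.elim0
  | succ k ih =>
    rcases i with ⟨_ | i, hi⟩
    · rfl
    · simp [Var.ofReplicate, Var.index, ih]

theorem elemVar_index (J : Interpretation S M) (X : Instance S) (v : Fin X.size) :
    (elemVar J X v).index = X.facts.length + v := by
  refine (Var.index_right _ _).trans ?_
  rw [Var.index_ofReplicate, List.length_map]

theorem patternCtx_length (J : Interpretation S M) (X : Instance S) :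
    (patternCtx J X).length = X.facts.length + X.size := by
  simp [patternCtx]

theorem getD_reverse_range {n i : ℕ} (hi : i < n) :
    (List.range n).reverse.getD i 0 = n - 1 - i := by
  rw [List.getD_eq_getElem _ _ (by simpa using hi)]
  simp

/-- What a solution of the constraints of a pattern formula satisfies, in any minion. -/
theorem models_of_holds_patternFormula {M' : Minion.{v}} {J : Interpretation S M}
    {X : Instance S} {ψV : Fin X.size → PP [J.U.ar]}
    {ψR : (k : Fin X.facts.length) → PP [(J.R (X.facts.get k).1).ar]}
    (hφ : (patternFormula J X ψV ψR).ArityLE h) {val : ℕ → M'.obj h}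
    (hval : ∀ k ∈ (patternFormula J X ψV ψR).constraints h [] 0, k.Holds M' val) :
    (∀ v : Fin X.size,
      ModelsAt M' (ψV v) (M'.minor (clip h J.U.ar) (val (X.size - 1 - v)))) ∧
    ∀ k : Fin X.facts.length, ∃ g : M'.obj (J.R (X.facts.get k).1).ar, ModelsAt M' (ψR k) g ∧
      ∀ i, M'.minor (J.proj (X.facts.get k).1 i) g =
        M'.minor (clip h J.U.ar) (val (X.size - 1 - (X.facts.get k).2 i)) := by
  let e : Env M' (patternCtx J X) := fun m x =>
    M'.minor (clip h m) (val ((List.range (patternCtx J X).length).reverse.getD x.index 0))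
  have hs := PP.sat_of_holds hφ.of_exAll (PP.forall_constraints_of_exAll hval) (e := e)
    fun _ _ => rfl
  have hv : ∀ v : Fin X.size,
      e _ (elemVar J X v) = M'.minor (clip h J.U.ar) (val (X.size - 1 - v)) := by
    intro v
    simp only [e]
    rw [getD_reverse_range (Var.index_lt _), elemVar_index, patternCtx_length]
    congr 2
    omega
  simp only [PP.Sat, PP.sat_conj, List.mem_ofFn, forall_exists_index,
    forall_apply_eq_imp_iff, PP.sat_at, hv] at hs
  refine ⟨hs.1, fun k => ⟨e _ (factVar J X k), (hs.2 k).1, fun i => ?_⟩⟩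
  have := (hs.2 k).2 i
  rw [← hv]
  exact this

end MinionPattern

namespace MinionPattern

open Turing Function

/-! ### Words -/

section Unary

variable {A : Type} {d s : A}

/-- The delimiter is not a digit, so unary numbers form a prefix code. -/
theorem unary_append_inj (hds : d ≠ s) {m n : ℕ} {w w' : List A}
    (he : List.replicate m d ++ s :: w = List.replicate n d ++ s :: w') : m = n ∧ w = w' := by
  induction m generalizing n with
  | zero =>
    cases n with
    | zero => simpa using he
    | succ n => simp [List.replicate_succ, hds.symm] at he
  | succ m ih =>
    cases n with
    | zero => simp [List.replicate_succ, hds] at he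
    | succ n =>
      simp only [List.replicate_succ, List.cons_append, List.cons.injEq, true_and] at he
      obtain ⟨rfl, rfl⟩ := ih he
      simp

theorem flatMap_unary_append_inj (hds : d ≠ s) {l l' : List ℕ} (hl : l.length = l'.length)
    {w w' : List A}
    (he : (l.flatMap fun n => List.replicate n d ++ [s]) ++ w =
      (l'.flatMap fun n => List.replicate n d ++ [s]) ++ w') : l = l' ∧ w = w' := by
  induction l generalizing l' with
  | nil =>
    cases l' with
    | nil => simpa using he
    | cons n l' => simp at hl
  | cons m l ih =>
    cases l' with
    | nil => simp at hl
    | cons n l' =>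
      simp only [List.flatMap_cons, List.append_assoc, List.cons_append, List.nil_append] at he
      obtain ⟨rfl, he₂⟩ := unary_append_inj hds he
      obtain ⟨rfl, rfl⟩ := ih (by simpa using hl) he₂
      simp

theorem flatMap_ofFn_val {k n : ℕ} (t : Fin k → Fin n) (f : ℕ → List A) :
    ((List.ofFn t).flatMap fun x : Fin n => f x.1) = (List.ofFn fun i => (t i : ℕ)).flatMap f := by
  simp only [List.ofFn_eq_map, List.flatMap_map]

end Unary

variable {S : Signature} {M : Minion.{u}} {Γ Δ : List ℕ+} {h r : ℕ+}

/-- The relation of `sPCSP` speaks of some instance with the given word; injectivity makes this the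
intended one. -/
theorem Instance.encode_injective : Injective (Instance.encode (S := S)) := by
  rintro ⟨n, fs⟩ ⟨n', fs'⟩ he
  simp only [Instance.encode, InstSym.nat, List.append_assoc, List.cons_append,
    List.nil_append] at he
  obtain ⟨rfl, he₁⟩ := unary_append_inj (by simp) he
  clear he
  congr 1
  induction fs generalizing fs' with
  | nil => cases fs' <;> simp at he₁ ⊢
  | cons a fs ih =>
    cases fs' with
    | nil => simp at he₁
    | cons b fs' =>
      obtain ⟨P, t⟩ := a
      obtain ⟨P', t'⟩ := b
      simp only [List.flatMap_cons, List.cons_append, List.cons.injEq, Sum.inr.injEq] at he₁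
      obtain ⟨rfl, he₂⟩ := he₁
      rw [flatMap_ofFn_val t fun x => List.replicate x (Sum.inl true) ++ [Sum.inl false],
        flatMap_ofFn_val t' fun x => List.replicate x (Sum.inl true) ++ [Sum.inl false]] at he₂
      obtain ⟨h₂, he₃⟩ := flatMap_unary_append_inj (by simp) (by simp) he₂
      have h₃ := List.ofFn_injective h₂
      have : t = t' := by
        funext i
        exact Fin.ext (congrFun h₃ i)
      rw [this, ih _ he₃]

/-! ### Systems of constraints as structures -/

/-- The lexicographic enumeration of the maps `[h] → [r]`. -/
def tupleEquiv (r h : ℕ) : Fin (r ^ h) ≃ (Fin h → Fin r) :=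
  finFunctionFinEquiv.symm.trans (Equiv.arrowCongr Fin.revPerm (Equiv.refl _))

/-- The variable whose minor stands at a position of the fact of a constraint, and the place of
that minor. -/
def Constraint.entry (r : ℕ+) (k : Constraint h) (p : Fin ((r : ℕ) ^ (h : ℕ))) :
    ℕ × Fin ((r : ℕ) ^ (h : ℕ)) :=
  -- The positions are maps `[h] → [r]`, split by their first value. When `r > 1`, either group of
  -- minors determines a class (`toQuot_eq_of_minors`), so one fact ties the two sides of the
  -- equation together.
  if tupleEquiv r h p ⟨0, h.pos⟩ = ⟨0, r.pos⟩ then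
    (k.x, (tupleEquiv r h).symm (tupleEquiv r h p ∘ k.κ₁))
  else (k.y, (tupleEquiv r h).symm (tupleEquiv r h p ∘ k.κ₂))

/-- The element at a position of the fact of a constraint. -/
def Constraint.elt (r : ℕ+) (k : Constraint h) (p : Fin ((r : ℕ) ^ (h : ℕ))) : ℕ :=
  (k.entry r p).1 * (r : ℕ) ^ (h : ℕ) + (k.entry r p).2

theorem mul_add_lt {a n N : ℕ} (ha : a < n) (i : Fin N) : a * N + i < n * N := by
  have := i.2
  have : (a + 1) * N ≤ n * N := Nat.mul_le_mul_right _ ha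
  rw [add_mul] at this
  omega

theorem Constraint.elt_lt (k : Constraint h) {n : ℕ} (hk : k.x < n ∧ k.y < n)
    (p : Fin ((r : ℕ) ^ (h : ℕ))) : k.elt r p < n * (r : ℕ) ^ (h : ℕ) := by
  refine mul_add_lt ?_ _
  unfold entry
  split
  · exact hk.1
  · exact hk.2

/-- The structure whose elements are the minors of arity `r` of `n` variables, and with one fact
for each constraint. -/
def constraintInstance (r : ℕ+) (n : ℕ) (l : List (Constraint h))
    (hl : ∀ k ∈ l, k.x < n ∧ k.y < n) : Instance (completeSig r h) where
  size := n * (r : ℕ) ^ (h : ℕ)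
  facts := l.pmap (fun k hk => ⟨(), fun p => ⟨k.elt r p, k.elt_lt hk p⟩⟩) hl

/-- The word of the fact of a constraint. -/
def Constraint.word (r : ℕ+) (k : Constraint h) : List (InstSym (completeSig r h)) :=
  .inr () :: (List.finRange ((r : ℕ) ^ (h : ℕ))).flatMap fun p => InstSym.nat _ (k.elt r p)

theorem encode_constraintInstance (n : ℕ) (l : List (Constraint h))
    (hl : ∀ k ∈ l, k.x < n ∧ k.y < n) :
    (constraintInstance r n l hl).encode =
      InstSym.nat _ (n * (r : ℕ) ^ (h : ℕ)) ++ l.flatMap (Constraint.word r) := by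
  unfold Instance.encode constraintInstance
  congr 1
  induction l with
  | nil => rfl
  | cons k l ih =>
    simp only [List.pmap_cons, List.flatMap_cons]
    rw [ih]
    congr 1
    simp only [Constraint.word]
    congr 1
    rw [List.ofFn_eq_map, List.flatMap_map]
    rfl

theorem isHom_constraintInstance {n : ℕ} {l : List (Constraint h)}
    {hl : ∀ k ∈ l, k.x < n ∧ k.y < n} {B : RelStr.{v} (completeSig r h)}
    {F : Fin (n * (r : ℕ) ^ (h : ℕ)) → B.carrier} :
    IsHom (constraintInstance r n l hl).toStr B F ↔
      ∀ k (hk : k ∈ l), (fun p => F ⟨k.elt r p, k.elt_lt (hl k hk) p⟩) ∈ B.rel () := by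
  constructor
  · intro hF k hk
    refine hF () (fun p => ⟨k.elt r p, k.elt_lt (hl k hk) p⟩) ?_
    exact List.mem_pmap.2 ⟨k, hk, rfl⟩
  · intro hF R t ht
    obtain ⟨k, hk, he⟩ := List.mem_pmap.1 ht
    cases he
    exact hF k hk

/-- The minor condition, as a structure over the signature of the complete structures. -/
def PP.toInstance (r h : ℕ+) (φ : MinorCondition) : Instance (completeSig r h) :=
  constraintInstance r φ.exCount (φ.constraints h [] 0) (by
    simpa using φ.constraints_lt (h := h) (ids := []) (c := 0) rfl (by simp))

theorem PP.encode_toInstance (φ : MinorCondition) :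
    (φ.toInstance r h).encode = InstSym.nat _ (φ.exCount * (r : ℕ) ^ (h : ℕ)) ++
      (φ.constraints h [] 0).flatMap (Constraint.word r) :=
  encode_constraintInstance _ _ _

/-- Tuples of the relation of the free structure generated by a complete structure. -/
theorem mem_rel_freeStr_completeStr {t : Fin ((r : ℕ) ^ (h : ℕ)) → M.obj r} :
    t ∈ (freeStr M (completeStr r h) (Equiv.refl (Fin r))).rel () ↔
      ∃ g : M.obj h, ∀ p, t p = M.minor (tupleEquiv r h p) g := by
  constructor
  · rintro ⟨m, ε, g, hg⟩
    -- The free structure enumerates distinct tuples, while several coordinates in `[h]` may yield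
    -- the same one, as happens for `r = 1`. Choosing a coordinate for each tuple passes from one
    -- indexing to the other.
    have hs : ∀ j, ∃ i : Fin h, (fun p => lexMap r h p i) = (ε j).1 := fun j => (ε j).2
    choose s hs using hs
    refine ⟨M.minor s g, fun p => ?_⟩
    rw [← M.minor_comp, hg p]
    congr 1
    funext j
    exact (congrFun (hs j) p).symm
  · rintro ⟨g, hg⟩
    have hfin : Finite ((completeStr r h).rel ()) := Set.finite_range _
    have hne : Nonempty ((completeStr r h).rel ()) := ⟨⟨_, ⟨⟨0, h.pos⟩, rfl⟩⟩⟩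
    obtain ⟨m, ⟨ε⟩⟩ := Finite.exists_equiv_fin ((completeStr r h).rel ())
    have hm : 0 < m := by
      have := (ε hne.some).2
      omega
    refine ⟨⟨m, hm⟩, ε.symm, M.minor (fun i => ε ⟨_, ⟨i, rfl⟩⟩) g, fun p => ?_⟩
    refine (hg p).trans ((congrArg (fun π => M.minor π g) ?_).trans (M.minor_comp _ _ g))
    funext i
    change tupleEquiv r h p i = (ε.symm (ε _)).1 p
    rw [ε.symm_apply_apply]
    rfl

/-- A true minor condition gives a homomorphism to the free structure. -/
theorem homTo_freeStr_of_models {φ : MinorCondition} (hφ : φ.ArityLE h) (hM : Models M φ) :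
    HomTo (φ.toInstance r h).toStr (freeStr M (completeStr r h) (Equiv.refl (Fin r))) := by
  -- Without quantifiers there are neither elements nor facts, and `M(h)` may be empty.
  rcases Nat.eq_zero_or_pos φ.exCount with h₀ | h₀
  · have hl := φ.constraints_lt (h := h) (ids := []) (c := 0) rfl (by simp)
    have hN : (φ.toInstance r h).size = 0 := by
      simp [PP.toInstance, constraintInstance, h₀]
    refine ⟨fun i => (Fin.cast hN i).elim0, ?_⟩
    refine isHom_constraintInstance.2 fun k hk => ?_
    have := hl k hk
    omega
  · obtain ⟨f⟩ := hM.nonempty_obj h₀ h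
    obtain ⟨val, -, -, hval⟩ := hM.exists_holds hφ (ids := []) (c := 0) rfl (by simp)
      (val := fun _ => f) (fun m x => nomatch x)
    have hN : 0 < (r : ℕ) ^ (h : ℕ) := Nat.pow_pos r.pos
    refine ⟨fun i : Fin (φ.exCount * (r : ℕ) ^ (h : ℕ)) =>
      M.minor (tupleEquiv r h ⟨i % (r : ℕ) ^ (h : ℕ), Nat.mod_lt _ hN⟩)
      (val (i / (r : ℕ) ^ (h : ℕ))), ?_⟩
    refine isHom_constraintInstance.2 fun k hk => ?_
    -- Both sides of the equation have this common value, so all entries of the fact are minors of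
    -- it, whichever side they are taken from.
    refine mem_rel_freeStr_completeStr.2 ⟨M.minor k.κ₁ (val k.x), fun p => ?_⟩
    have hk' := hval k hk
    have h₁ : k.elt r p / (r : ℕ) ^ (h : ℕ) = (k.entry r p).1 := by
      unfold Constraint.elt
      rw [mul_comm, Nat.mul_add_div hN, Nat.div_eq_of_lt (Fin.is_lt _), add_zero]
    have h₂ : (⟨k.elt r p % (r : ℕ) ^ (h : ℕ), Nat.mod_lt _ hN⟩ : Fin ((r : ℕ) ^ (h : ℕ))) =
        (k.entry r p).2 := by
      refine Fin.ext ?_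
      change k.elt r p % _ = _
      unfold Constraint.elt
      rw [mul_comm, Nat.mul_add_mod, Nat.mod_eq_of_lt (Fin.is_lt _)]
    simp only [h₁, h₂]
    unfold Constraint.entry
    split
    · simp [M.minor_comp]
    · rw [hk']
      simp [M.minor_comp]

end MinionPattern

namespace MinionPattern

open Turing Function

/-! ### The machine that translates formulas into systems of constraints -/

/-- Marks on the stack of variables.  A variable is in scope (`live`) or not (`dead`), and `fork`
marks a conjunction whose second part is still to be read. -/
inductive Mark
  | live | dead | fork
  deriving DecidableEq

instance : Finite Mark :=
  Finite.of_surjective (fun i : Fin 3 => [Mark.live, .dead, .fork][i])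
    (by intro k; cases k <;> decide)

instance : Finite FmSym :=
  Finite.of_surjective
    (fun i : Fin 8 => match i with
      | 0 => FmSym.top | 1 => .eq | 2 => .and | 3 => .ex | 4 => .var | 5 => .minor | 6 => .digit
      | 7 => .stop_mark)
    (by
      intro k
      cases k
      exacts [⟨0, rfl⟩, ⟨1, rfl⟩, ⟨2, rfl⟩, ⟨3, rfl⟩, ⟨4, rfl⟩, ⟨5, rfl⟩, ⟨6, rfl⟩, ⟨7, rfl⟩])

/-- The number of variables on a stack of marks. -/
def markCount : List Mark → ℕ
  | [] => 0
  | .fork :: H => markCount H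
  | _ :: H => markCount H + 1

/-- The numbers of the variables in scope, the innermost one first. -/
def liveIds : List Mark → List ℕ
  | [] => []
  | .live :: H => markCount H :: liveIds H
  | _ :: H => liveIds H

/-- The stack of marks after the end of a subformula. -/
def finishMarks : List Mark → List Mark
  | [] => []
  | .fork :: H => H
  | _ :: H => .dead :: finishMarks H

theorem markCount_le (H : List Mark) : markCount H ≤ H.length := by
  induction H with
  | nil => simp [markCount]
  | cons a H ih => cases a <;> simp [markCount] <;> omega

theorem liveIds_lt (H : List Mark) : ∀ j ∈ liveIds H, j < markCount H := by
  induction H with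
  | nil => simp [liveIds]
  | cons a H ih =>
    cases a with
    | live =>
      intro j hj
      rcases List.mem_cons.1 hj with rfl | hj
      · simp [markCount]
      · have := ih j hj
        simp [markCount]
        omega
    | dead =>
      intro j hj
      have := ih j hj
      simp [markCount]
      omega
    | fork => exact ih

theorem markCount_dead_append (k : ℕ) (H : List Mark) :
    markCount (List.replicate k .dead ++ H) = markCount H + k := by
  induction k with
  | zero => rfl
  | succ k ih => simp [List.replicate_succ, markCount, ih]; omega

theorem liveIds_dead_append (k : ℕ) (H : List Mark) :
    liveIds (List.replicate k .dead ++ H) = liveIds H := by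
  induction k with
  | zero => rfl
  | succ k ih => simp [List.replicate_succ, liveIds, ih]

theorem finishMarks_dead_append (k : ℕ) (H : List Mark) :
    finishMarks (List.replicate k .dead ++ H) = List.replicate k .dead ++ finishMarks H := by
  induction k with
  | zero => rfl
  | succ k ih => simp [List.replicate_succ, finishMarks, ih]

/-- The stacks of the translation. -/
inductive ConvStk
  | inp | marks | tmp | reg (b : Bool) | hold | rev | out
  deriving DecidableEq

instance : Finite ConvStk :=
  Finite.of_surjective
    (fun i : Fin 8 => [ConvStk.inp, .marks, .tmp, .reg true, .reg false, .hold, .rev, .out][i])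
    (by
      intro k
      rcases k with _ | _ | _ | (_ | _) | _ | _ | _ <;> decide)

/-- The alphabets of the translation. -/
@[reducible] def ConvAlph (r h : ℕ+) : ConvStk → Type
  | .inp => FmSym
  | .marks => Mark
  | .tmp => Mark
  | .reg _ => Unit
  | .hold => Unit
  | .rev => InstSym (completeSig r h)
  | .out => InstSym (completeSig r h)

/-- The table of a minor operation. -/
abbrev MinorMap := (n : ℕ+) × (m : ℕ+) × (Fin n → Fin m)

/-- The word of a minor operation. -/
def MinorMap.word (c : MinorMap) : List FmSym :=
  .minor :: FmSym.nat c.1 ++ FmSym.nat c.2.1 ++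
    (List.ofFn fun i => (c.2.2 i : ℕ)).flatMap FmSym.nat

/-- The two arities are self-delimiting, and the first one tells how many entries follow. Hence a
reader can recognise the last symbol of a table. -/
theorem MinorMap.word_append_inj {c c' : MinorMap} {w w' : List FmSym}
    (he : c.word ++ w = c'.word ++ w') : c = c' ∧ w = w' := by
  obtain ⟨n, m, π⟩ := c
  obtain ⟨n', m', π'⟩ := c'
  simp only [MinorMap.word, FmSym.nat, List.cons_append, List.append_assoc, List.nil_append,
    List.cons.injEq, true_and] at he
  obtain ⟨h₁, he₁⟩ := unary_append_inj (by simp) he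
  obtain ⟨h₂, he₂⟩ := unary_append_inj (by simp) he₁
  obtain rfl := PNat.coe_injective h₁
  obtain rfl := PNat.coe_injective h₂
  obtain ⟨h₃, he₃⟩ := flatMap_unary_append_inj (by simp) (by simp) he₂
  have h₄ := List.ofFn_injective h₃
  have : π = π' := by
    funext i
    exact Fin.ext (congrFun h₄ i)
  exact ⟨by rw [this], he₃⟩

theorem length_flatMap_le {A B : Type} (l : List A) (f : A → List B) (b : ℕ)
    (hf : ∀ a ∈ l, (f a).length ≤ b) : (l.flatMap f).length ≤ l.length * b := by
  induction l with
  | nil => simp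
  | cons a l ih =>
    have h₁ := ih fun a ha => hf a (List.mem_cons_of_mem _ ha)
    have h₂ := hf a List.mem_cons_self
    simp only [List.flatMap_cons, List.length_append, List.length_cons, add_mul]
    omega

/-- The length of the buffer for the table of a minor operation. -/
def bufLen (h : ℕ+) : ℕ := 3 + 2 * h + h * h

/-- The bound depends on `h` only, so a whole table fits into the finite internal state. -/
theorem MinorMap.length_word_le {h : ℕ+} {c : MinorMap} (h₁ : c.1 ≤ h) (h₂ : c.2.1 ≤ h) :
    c.word.length ≤ bufLen h := by
  obtain ⟨n, m, π⟩ := c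
  have h₁' : (n : ℕ) ≤ h := h₁
  have h₂' : (m : ℕ) ≤ h := h₂
  have h₃ := length_flatMap_le (List.ofFn fun i => (π i : ℕ)) FmSym.nat h (by
    intro a ha
    obtain ⟨i, rfl⟩ := (List.mem_ofFn' _ _).1 ha
    simp only [FmSym.nat, List.length_append, List.length_replicate, List.length_singleton]
    have := (π i).2
    omega)
  rw [List.length_ofFn] at h₃
  have h₄ : (n : ℕ) * h ≤ h * h := Nat.mul_le_mul_right _ h₁'
  simp only [MinorMap.word, FmSym.nat, bufLen, List.length_append, List.length_replicate,
    List.length_cons, List.length_nil] at h₃ ⊢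
  omega

/-- The effect of a minor operation on lifted terms. -/
def MinorMap.kappa (h : ℕ+) (c : MinorMap) : Fin h → Fin h := clip c.2.1 h ∘ c.2.2 ∘ clip h c.1

/-- The registers of the translation. -/
structure ConvReg (h : ℕ+) where
  tok : Option FmSym
  κ : Bool → Fin h → Fin h
  buf : {l : List FmSym // l.length ≤ bufLen h}
  aux : Bool × Option Mark × Option FmSym

instance (h : ℕ+) : Finite (ConvReg h) := by
  have : Finite {l : List FmSym // l.length ≤ bufLen h} := List.finite_length_le FmSym _
  refine Finite.of_injective (fun v : ConvReg h => (v.tok, v.κ, v.buf, v.aux)) ?_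
  rintro ⟨⟩ ⟨⟩ he
  simpa using he

/-- The symbols that the translation moves between stacks. -/
inductive ConvSym (r h : ℕ+)
  | fm (a : FmSym) | mark (a : Mark) | one (a : Unit) | res (a : InstSym (completeSig r h))

instance (r h : ℕ+) : Finite (InstSym (completeSig r h)) :=
  inferInstanceAs (Finite (Bool ⊕ Unit))

instance (r h : ℕ+) : Finite (ConvSym r h) := by
  refine Finite.of_surjective
    (fun a : FmSym ⊕ Mark ⊕ Unit ⊕ InstSym (completeSig r h) => match a with
      | .inl a => ConvSym.fm a
      | .inr (.inl a) => .mark a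
      | .inr (.inr (.inl a)) => .one a
      | .inr (.inr (.inr a)) => .res a) ?_
  rintro (a | a | a | a)
  exacts [⟨.inl a, rfl⟩, ⟨.inr (.inl a), rfl⟩, ⟨.inr (.inr (.inl a)), rfl⟩,
    ⟨.inr (.inr (.inr a)), rfl⟩]

variable {h r : ℕ+}

/-- The internal states of the translation. -/
abbrev ConvState (r h : ℕ+) := ConvReg h × Option (Option (ConvSym r h))

/-- Fragments of the translation. -/
abbrev ConvFrag (r h : ℕ+) := Frag (ConvAlph r h) (ConvState r h)

/-- The contents of the stacks of the translation. -/
def convStk (I : List FmSym) (H T : List Mark) (x : Bool → List Unit) (w : List Unit)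
    (O P : List (InstSym (completeSig r h))) : ∀ k, List (ConvAlph r h k)
  | .inp => I
  | .marks => H
  | .tmp => T
  | .reg b => x b
  | .hold => w
  | .rev => O
  | .out => P

section

variable (I : List FmSym) (H T : List Mark) (x : Bool → List Unit) (w : List Unit)
    (O P : List (InstSym (completeSig r h)))

@[simp] theorem convStk_inp : convStk I H T x w O P .inp = I := rfl
@[simp] theorem convStk_marks : convStk I H T x w O P .marks = H := rfl
@[simp] theorem convStk_tmp : convStk I H T x w O P .tmp = T := rfl
@[simp] theorem convStk_reg (b : Bool) : convStk I H T x w O P (.reg b) = x b := rfl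
@[simp] theorem convStk_hold : convStk I H T x w O P .hold = w := rfl
@[simp] theorem convStk_rev : convStk I H T x w O P .rev = O := rfl
@[simp] theorem convStk_out : convStk I H T x w O P .out = P := rfl

@[simp] theorem update_convStk_inp (l) :
    update (convStk I H T x w O P) .inp l = convStk l H T x w O P := by
  funext k; cases k <;> rfl
@[simp] theorem update_convStk_marks (l) :
    update (convStk I H T x w O P) .marks l = convStk I l T x w O P := by
  funext k; cases k <;> rfl
@[simp] theorem update_convStk_tmp (l) :
    update (convStk I H T x w O P) .tmp l = convStk I H l x w O P := by
  funext k; cases k <;> rfl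
@[simp] theorem update_convStk_reg (b : Bool) (l) :
    update (convStk I H T x w O P) (.reg b) l = convStk I H T (update x b l) w O P := by
  funext k
  cases k with
  | reg c =>
    by_cases hc : c = b
    · subst hc; simp
    · rw [update_of_ne (by simpa using hc)]; simp [hc]
  | _ => rfl
@[simp] theorem update_convStk_hold (l) :
    update (convStk I H T x w O P) .hold l = convStk I H T x l O P := by
  funext k; cases k <;> rfl
@[simp] theorem update_convStk_rev (l) :
    update (convStk I H T x w O P) .rev l = convStk I H T x w l P := by
  funext k; cases k <;> rfl
@[simp] theorem update_convStk_out (l) :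
    update (convStk I H T x w O P) .out l = convStk I H T x w O l := by
  funext k; cases k <;> rfl

end

namespace Conv

open Frag

/-- Move marks back to the stack of variables. -/
def restore : ConvFrag r h :=
  drain .tmp .mark fun _ y => match y with
    | .mark a => [⟨.marks, a⟩]
    | _ => []

theorem runs_restore (ρ : ConvReg h) (z) (I : List FmSym) (H T : List Mark)
    (x : Bool → List Unit) (w : List Unit) (O P : List (InstSym (completeSig r h))) :
    (restore : ConvFrag r h).Runs (ρ, z) (convStk I H T x w O P) (ρ, none)
      (convStk I (T.reverse ++ H) [] x w O P) (5 * T.length + 8) := by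
  refine (runs_drain _ ?_).congr rfl rfl rfl ?_ le_rfl
  · rintro (_ | _ | _ | _) <;> simp
  · simp only [convStk_tmp]
    rw [pushAll_flatMap_singleton (Γ := ConvAlph r h)]
    simp

/-- End of a subformula. -/
def finish : ConvFrag r h :=
  (scan .marks .mark (fun ρ _ => ρ)
    (fun _ y => match y with
      | .mark .fork => true
      | _ => false)
    (fun _ y => match y with
      | .mark .fork => []
      | _ => [⟨.tmp, .dead⟩])).seq restore

theorem runs_finish (ρ : ConvReg h) (z) (I : List FmSym) (H : List Mark)
    (x : Bool → List Unit) (w : List Unit) (O P : List (InstSym (completeSig r h))) :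
    (finish : ConvFrag r h).Runs (ρ, z) (convStk I H [] x w O P) (ρ, none)
      (convStk I (finishMarks H) [] x w O P) (10 * H.length + 16) := by
  -- How the marks are divided between the two stacks when the scan stops depends on the place of
  -- the nearest `fork`. Only the recombined stack matters, since `restore` follows.
  suffices ∀ H T, ∃ H' T', T'.length ≤ T.length + H.length ∧
      T'.reverse ++ H' = T.reverse ++ finishMarks H ∧ ∀ y : Option (ConvSym r h),
      (scanLoop .marks .mark (fun ρ _ => ρ)
        (fun _ y => match y with
          | .mark .fork => true
          | _ => false)
        (fun _ y => match y with
          | .mark .fork => []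
          | _ => [⟨.tmp, .dead⟩]) : ConvFrag r h).Runs (ρ, some y) (convStk I H T x w O P)
        (ρ, none) (convStk I H' T' x w O P) (5 * H.length + 6) by
    obtain ⟨H', T', h₁, h₂, h₃⟩ := this H []
    simp only [List.length_nil, List.reverse_nil, List.nil_append] at h₁ h₂
    refine ((Runs.scan h₃).seq (runs_restore ρ none I H' T' x w O P)).congr rfl rfl rfl ?_ ?_
    · rw [h₂]
    · omega
  intro H
  induction H with
  | nil =>
    intro T
    exact ⟨[], T, by simp, by simp [finishMarks], fun y => runs_scanLoop_nil rfl y⟩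
  | cons a H ih =>
    intro T
    rcases eq_or_ne a .fork with rfl | ha
    · refine ⟨H, T, by simp, by simp [finishMarks], fun y => ?_⟩
      refine (runs_scanLoop_stop (a := Mark.fork) (l := H) rfl rfl y).congr rfl rfl rfl ?_ ?_
      · simp
      · omega
    · obtain ⟨H', T', h₁, h₂, h₃⟩ := ih (.dead :: T)
      refine ⟨H', T', ?_, ?_, fun y => ?_⟩
      · simp at h₁ ⊢; omega
      · rw [h₂]
        cases a <;> simp [finishMarks] at ha ⊢
      · refine (Runs.scanLoop_cons (a := a) (l := H) rfl ?_ (fun y => ?_) y (t := 5 * H.length + 6)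
          ).mono ?_
        · cases a <;> simp at ha ⊢
        · refine (h₃ y).congr rfl ?_ rfl rfl le_rfl
          cases a <;> simp at ha ⊢
        · simp; omega

/-- The new auxiliary registers after a mark and an input symbol are seen. -/
def lookupAux : Bool × Option Mark × Option FmSym → Option FmSym →
    Bool × Option Mark × Option FmSym
  | (false, some .live, _), some .digit => (false, some .live, none)
  | (false, some .live, _), c => (true, some .live, c)
  | (p, a, _), c => (p, a, c)

@[simp] theorem lookupAux_true (a : Option Mark) (d c : Option FmSym) :
    lookupAux (true, a, d) c = (true, a, c) := rfl

/-- One round of the search for a variable. -/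
def lookupBody (b : Bool) : ConvFrag r h :=
  (op .marks
    (fun v a => ({v.1 with aux := (v.1.aux.1, a, v.1.aux.2.2)},
      if a.isSome then some none else none))
    (fun v => match v.1.aux with
      | (_, none, _) => []
      | (_, some .fork, _) => [⟨.tmp, .fork⟩]
      | (true, some a, _) => [⟨.tmp, a⟩, ⟨.reg b, ()⟩]
      | (false, some a, _) => [⟨.tmp, a⟩])).seq
  (op .inp
    (fun v c => ({v.1 with aux := lookupAux v.1.aux c}, v.2))
    (fun v => match v.1.aux.2.2 with
      | none => []
      | some c => [⟨.inp, c⟩]))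

/-- Write the number of a variable in unary on a stack.  The de Bruijn index of the variable is
on the input stack. -/
def lookup (b : Bool) : ConvFrag r h :=
  (act (fun v => (v.1, some none)) (fun _ => [])).seq
    ((loop (fun v => v.2.isSome) (lookupBody b)).seq
      (restore.seq (act (fun v => ({v.1 with aux := (false, none, none)}, none)) (fun _ => []))))

/-- Once the variable is found, the marks below it, apart from forks, are the variables quantified
earlier. Dead ones count as well, so their number is the number of the variable. -/
theorem runs_lookup_count (b : Bool) (ρ : ConvReg h) (y) (I : List FmSym) (H T : List Mark)
    (x : Bool → List Unit) (w : List Unit) (O P : List (InstSym (completeSig r h)))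
    (hρ : ρ.aux.1 = true) :
    ∃ aux, (loop (fun v => v.2.isSome) (lookupBody b) : ConvFrag r h).Runs (ρ, some y)
      (convStk I H T x w O P) ({ρ with aux := aux}, none)
      (convStk I [] (H.reverse ++ T) (update x b (List.replicate (markCount H) () ++ x b)) w O P)
      (5 * H.length + 6) := by
  induction H generalizing ρ y T x with
  | nil =>
    refine ⟨(true, none, I.head?), (Runs.loop_true (t := 4) (Runs.seq (t := 2) (t' := 2)
      (runs_op' (v' := ({ρ with aux := (true, none, ρ.aux.2.2)}, none))
        (S' := convStk I [] T x w O P) ?_ ?_ le_rfl)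
      (runs_op' (v' := ({ρ with aux := (true, none, I.head?)}, none))
        (S' := convStk I [] T x w O P) ?_ ?_ le_rfl)) rfl
      (runs_loop_false rfl _)).congr rfl rfl rfl ?_ (by simp)⟩
    · simp [hρ]
    · simp
    · cases I <;> simp
    · cases I <;> simp
    · simp [markCount]
  | cons a H ih =>
    obtain ⟨aux, ha⟩ := ih {ρ with aux := (true, some a, I.head?)} none (a :: T)
      (if a = .fork then x else update x b (() :: x b)) rfl
    refine ⟨aux, (Runs.loop_true (t := 4) (Runs.seq (t := 2) (t' := 2)
      (runs_op' (v' := ({ρ with aux := (true, some a, ρ.aux.2.2)}, some none))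
        (S' := convStk I H (a :: T) (if a = .fork then x else update x b (() :: x b)) w O P)
        ?_ ?_ le_rfl)
      (runs_op' (v' := ({ρ with aux := (true, some a, I.head?)}, some none))
        (S' := convStk I H (a :: T) (if a = .fork then x else update x b (() :: x b)) w O P)
        ?_ ?_ le_rfl)) rfl
      ha).congr rfl rfl rfl ?_ ?_⟩
    · simp [hρ]
    · cases a <;> simp
    · cases I <;> simp
    · cases I <;> simp
    · cases a <;> simp [markCount, List.replicate_succ']
    · simp; omega

/-- Each live mark that is passed consumes one digit of the de Bruijn index, and the live mark met
when no digit is left belongs to the variable. The condition `hI` makes the end of the index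
visible. -/
theorem runs_lookup_search (b : Bool) (ρ : ConvReg h) (y) (i : ℕ) (I : List FmSym)
    (H T : List Mark) (x : Bool → List Unit) (w : List Unit)
    (O P : List (InstSym (completeSig r h))) (hρ : ρ.aux.1 = false)
    (hI : I.head? ≠ some .digit) (hi : i < (liveIds H).length) :
    ∃ aux, (loop (fun v => v.2.isSome) (lookupBody b) : ConvFrag r h).Runs (ρ, some y)
      (convStk (List.replicate i .digit ++ I) H T x w O P) ({ρ with aux := aux}, none)
      (convStk I [] (H.reverse ++ T)
        (update x b (List.replicate ((liveIds H).getD i 0) () ++ x b)) w O P)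
      (5 * H.length + 6) := by
  induction H generalizing ρ y T i with
  | nil => simp [liveIds] at hi
  | cons a H ih =>
    have step : ∀ (J J' : List FmSym) (aux : Bool × Option Mark × Option FmSym),
        aux.2.1 = some a →
        (∀ d, lookupAux (false, some a, d) J.head? = aux) →
        (match aux.2.2 with
          | none => J.tail
          | some c => c :: J.tail) = J' →
        (lookupBody b : ConvFrag r h).Runs (ρ, some y) (convStk J (a :: H) T x w O P)
          ({ρ with aux := aux}, some none) (convStk J' H (a :: T) x w O P) 4 := by
      intro J J' aux ha hu hJ
      refine Runs.seq (t := 2) (t' := 2)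
        (runs_op' (v' := ({ρ with aux := (false, some a, ρ.aux.2.2)}, some none))
          (S' := convStk J H (a :: T) x w O P) ?_ ?_ le_rfl)
        (runs_op' (v' := ({ρ with aux := aux}, some none))
          (S' := convStk J' H (a :: T) x w O P) ?_ ?_ le_rfl)
      · simp [hρ]
      · cases a <;> simp
      · simp [hu]
      · rw [← hJ]
        cases hd : aux.2.2 <;> simp
    have skip : ∀ (J : List FmSym), a ≠ .live → ∃ d,
        (lookupBody b : ConvFrag r h).Runs (ρ, some y) (convStk J (a :: H) T x w O P)
          ({ρ with aux := (false, some a, d)}, some none) (convStk J H (a :: T) x w O P) 4 := by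
      intro J ha
      refine ⟨J.head?, step J J (false, some a, J.head?) rfl ?_ ?_⟩
      · intro d
        cases a <;> first | (exact absurd rfl ha) | rfl
      · cases J <;> rfl
    by_cases ha : a = .live
    · subst ha
      cases i with
      | zero =>
        have hs := step I I (true, some .live, I.head?) rfl (by
          intro d
          rcases I with _ | ⟨c, I⟩
          · rfl
          · cases c <;> first | rfl | (exact absurd rfl hI)) (by cases I <;> rfl)
        obtain ⟨aux, hc⟩ := runs_lookup_count b
          {ρ with aux := (true, some .live, I.head?)} none I H (.live :: T) x w O P rfl
        refine ⟨aux, (Runs.loop_true hs rfl hc).congr rfl rfl rfl ?_ (by simp; omega)⟩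
        simp [liveIds]
      | succ i =>
        have hs := step (.digit :: (List.replicate i .digit ++ I)) (List.replicate i .digit ++ I)
          (false, some .live, none) rfl (by intro d; rfl) rfl
        obtain ⟨aux, hc⟩ := ih {ρ with aux := (false, some .live, none)} none i (.live :: T) rfl
          (by simpa [liveIds] using hi)
        refine ⟨aux, (Runs.loop_true hs rfl hc).congr rfl ?_ rfl ?_ (by simp; omega)⟩
        · simp [List.replicate_succ]
        · simp [liveIds]
    · obtain ⟨d, hs⟩ := skip (List.replicate i .digit ++ I) ha
      have hl : liveIds (a :: H) = liveIds H := by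
        cases a <;> first | (exact absurd rfl ha) | rfl
      rw [hl] at hi ⊢
      obtain ⟨aux, hc⟩ := ih {ρ with aux := (false, some a, d)} none i (a :: T) rfl hi
      refine ⟨aux, (Runs.loop_true hs rfl hc).congr rfl rfl rfl ?_ (by simp; omega)⟩
      simp

theorem runs_lookup (b : Bool) (ρ : ConvReg h) (z) (i : ℕ) (I : List FmSym)
    (H : List Mark) (x : Bool → List Unit) (w : List Unit)
    (O P : List (InstSym (completeSig r h))) (hρ : ρ.aux = (false, none, none))
    (hI : I.head? ≠ some .digit) (hi : i < (liveIds H).length) :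
    (lookup b : ConvFrag r h).Runs (ρ, z)
      (convStk (List.replicate i .digit ++ I) H [] x w O P) (ρ, none)
      (convStk I H [] (update x b (List.replicate ((liveIds H).getD i 0) () ++ x b)) w O P)
      (10 * H.length + 18) := by
  obtain ⟨aux, hl⟩ := runs_lookup_search b ρ none i I H [] x w O P (by rw [hρ]) hI hi
  refine ((runs_act' (t := 2) rfl rfl le_rfl).seq (hl.seq ((runs_restore _ none _ _ _ _ _ _ _).seq
    (runs_act' (t := 2) rfl rfl le_rfl)))).congr rfl rfl ?_ ?_ ?_
  · rw [← hρ]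
  · simp
  · simp; omega

end Conv
end MinionPattern

/-! ### Writing the fact of an equation, and reading terms -/

namespace MinionPattern

open Turing Function

variable {h r : ℕ+} {Γ : List ℕ+}

namespace Conv

open Frag

/-- The register from which the entry at a position of a fact is taken. -/
def entryReg (r h : ℕ+) (p : Fin ((r : ℕ) ^ (h : ℕ))) : Bool :=
  !decide (tupleEquiv r h p ⟨0, h.pos⟩ = ⟨0, r.pos⟩)

/-- Write an element of a fact on the output stack. -/
def emitNumber (p : Fin ((r : ℕ) ^ (h : ℕ))) : ConvFrag r h :=
  (drain (.reg (entryReg r h p)) .one fun _ y => match y with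
    | .one _ => ⟨.hold, ()⟩ :: List.replicate ((r : ℕ) ^ (h : ℕ)) ⟨.rev, .inl true⟩
    | _ => []).seq
  ((act id fun v => List.replicate
    ((tupleEquiv r h).symm (tupleEquiv r h p ∘ v.1.κ (entryReg r h p))) ⟨.rev, .inl true⟩ ++
      [⟨.rev, .inl false⟩]).seq
  (drain .hold .one fun _ y => match y with
    | .one _ => [⟨.reg (entryReg r h p), ()⟩]
    | _ => []))

theorem pushAll_hold_rev (I : List FmSym) (H T : List Mark) (x : Bool → List Unit)
    (w : List Unit) (O P : List (InstSym (completeSig r h))) (l : List Unit) (N : ℕ)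
    (a : InstSym (completeSig r h)) :
    pushAll (convStk I H T x w O P) (l.flatMap fun _ => ⟨.hold, ()⟩ :: List.replicate N ⟨.rev, a⟩) =
      convStk I H T x (l ++ w) (List.replicate (l.length * N) a ++ O) P := by
  induction l generalizing w O with
  | nil => simp
  | cons _ l ih =>
    rw [List.flatMap_cons, pushAll_append, pushAll_cons, pushAll_replicate]
    simp only [update_convStk_hold, convStk_hold, convStk_rev, update_convStk_rev]
    rw [ih, ← List.append_assoc, List.replicate_append_replicate, List.length_cons, add_mul,
      one_mul]
    congr 1
    have : ∀ l : List Unit, l ++ () :: w = () :: (l ++ w) := by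
      intro l
      induction l with
      | nil => rfl
      | cons a l ih => simp [ih]
    rw [this]
    rfl

/-- The registers that hold a constraint. -/
def conReg (k : Constraint h) (b : Bool) : List Unit := List.replicate (cond b k.y k.x) ()

theorem entry_eq (k : Constraint h) (p : Fin ((r : ℕ) ^ (h : ℕ))) :
    k.entry r p = (cond (entryReg r h p) k.y k.x, (tupleEquiv r h).symm
      (tupleEquiv r h p ∘ cond (entryReg r h p) k.κ₂ k.κ₁)) := by
  unfold Constraint.entry entryReg
  by_cases hp : tupleEquiv r h p ⟨0, h.pos⟩ = ⟨0, r.pos⟩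
  · rw [if_pos hp, decide_eq_true hp]
    rfl
  · rw [if_neg hp, decide_eq_false hp]
    rfl

/-- Each unit of the register stands for a block of `r ^ h` digits, and the place within the block
is known from `κ`. The register is refilled from `.hold`, since the other positions of the fact need
it too. -/
theorem runs_emitNumber (p : Fin ((r : ℕ) ^ (h : ℕ))) (k : Constraint h) (ρ : ConvReg h) (z)
    (hρ : ∀ b, ρ.κ b = cond b k.κ₂ k.κ₁) (I : List FmSym) (H T : List Mark)
    (O P : List (InstSym (completeSig r h))) {n : ℕ} (hx : k.x ≤ n) (hy : k.y ≤ n) :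
    (emitNumber p : ConvFrag r h).Runs (ρ, z) (convStk I H T (conReg k) [] O P) (ρ, none)
      (convStk I H T (conReg k) [] ((InstSym.nat _ (k.elt r p)).reverse ++ O) P)
      (10 * n + 18) := by
  have hn : (conReg k (entryReg r h p)).length ≤ n := by
    unfold conReg
    cases entryReg r h p <;> simpa
  have e : k.elt r p = (conReg k (entryReg r h p)).length * (r : ℕ) ^ (h : ℕ) +
      (tupleEquiv r h).symm (tupleEquiv r h p ∘ cond (entryReg r h p) k.κ₂ k.κ₁) := by
    rw [Constraint.elt, entry_eq]
    simp [conReg]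
  refine ((Runs.congr (t' := 5 * n + 8)
      (T' := convStk I H T (update (conReg k) (entryReg r h p) []) (conReg k (entryReg r h p))
        (List.replicate ((conReg k (entryReg r h p)).length * (r : ℕ) ^ (h : ℕ)) (.inl true) ++ O)
        P)
      (runs_drain _ ?_) rfl rfl rfl ?_ ?_).seq
    (Runs.seq (runs_act' (t := 2)
      (S' := convStk I H T (update (conReg k) (entryReg r h p) []) (conReg k (entryReg r h p))
        ((InstSym.nat _ (k.elt r p)).reverse ++ O) P) rfl ?_ le_rfl)
    (Runs.congr (t' := 5 * n + 8) (runs_drain _ ?_) rfl rfl rfl ?_ ?_))).mono (by omega)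
  · rintro (_ | _ | _ | _) q hq <;> simp at hq
    rcases hq with rfl | ⟨-, rfl⟩ <;> simp
  · simp only [update_convStk_reg, convStk_reg]
    rw [pushAll_hold_rev]
    simp
  · simp only [convStk_reg]
    omega
  · simp only [id_eq]
    rw [pushAll_append, pushAll_replicate, hρ, e]
    simp only [InstSym.nat, pushAll_cons, pushAll_nil, convStk_rev, update_convStk_rev,
      List.reverse_append, List.reverse_replicate, List.reverse_singleton, List.cons_append]
    rw [← List.append_assoc, List.replicate_append_replicate, add_comm]
    rfl
  · rintro (_ | _ | _ | _) <;> simp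
  · simp only [update_convStk_hold, convStk_hold]
    rw [pushAll_flatMap_singleton (Γ := ConvAlph r h)]
    simp only [update_convStk_reg, convStk_reg, update_self, update_idem]
    have hu : update (conReg k) (entryReg r h p) (conReg k (entryReg r h p)) = conReg k :=
      update_eq_self _ _
    simpa [conReg] using congrArg (fun x => convStk I H T x [] _ P) hu
  · simp only [convStk_hold]
    omega

/-- Run fragments one after the other. -/
def seqList {K : Type} [DecidableEq K] {A : K → Type} {σ : Type} (l : List (Frag A σ)) :
    Frag A σ :=
  l.foldr Frag.seq skip

/-- Empty a register stack. -/
def clear (b : Bool) : ConvFrag r h := drain (.reg b) .one fun _ _ => []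

theorem runs_clear (b : Bool) (ρ : ConvReg h) (z) (I : List FmSym) (H T : List Mark)
    (x : Bool → List Unit) (w : List Unit) (O P : List (InstSym (completeSig r h))) :
    (clear b : ConvFrag r h).Runs (ρ, z) (convStk I H T x w O P) (ρ, none)
      (convStk I H T (update x b []) w O P) (5 * (x b).length + 8) := by
  refine (runs_drain _ (by simp)).congr rfl rfl rfl ?_ le_rfl
  have hf : ∀ l : List Unit, (l.flatMap fun _ => ([] : List (Σ k, ConvAlph r h k))) = [] := by
    simp
  rw [hf, pushAll_nil, update_convStk_reg]

/-- Write the fact of a constraint on the output stack. -/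
def emitFact : ConvFrag r h :=
  (act id fun _ => [⟨.rev, .inr ()⟩]).seq
    ((seqList ((List.finRange ((r : ℕ) ^ (h : ℕ))).map emitNumber)).seq
      ((clear false).seq (clear true)))

/-- The time to write a fact. -/
def emitTime (r h : ℕ+) (n : ℕ) : ℕ := (r : ℕ) ^ (h : ℕ) * (10 * n + 18) + 10 * n + 19

/-- As `r ^ h` is a constant, the machine can contain a separate copy of `emitNumber` for each
position. -/
theorem runs_emitFact (k : Constraint h) (ρ : ConvReg h) (z)
    (hρ : ∀ b, ρ.κ b = cond b k.κ₂ k.κ₁) (I : List FmSym) (H T : List Mark)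
    (O P : List (InstSym (completeSig r h))) {n : ℕ} (hx : k.x ≤ n) (hy : k.y ≤ n) :
    (emitFact : ConvFrag r h).Runs (ρ, z) (convStk I H T (conReg k) [] O P) (ρ, none)
      (convStk I H T (fun _ => []) [] ((k.word r).reverse ++ O) P) (emitTime r h n) := by
  have main : ∀ (l : List (Fin ((r : ℕ) ^ (h : ℕ)))) (O : List (InstSym (completeSig r h))) (z),
      ∃ z', (seqList (l.map emitNumber) : ConvFrag r h).Runs (ρ, z)
        (convStk I H T (conReg k) [] O P) (ρ, z') (convStk I H T (conReg k) []
          ((l.flatMap fun p => InstSym.nat _ (k.elt r p)).reverse ++ O) P)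
        (l.length * (10 * n + 18) + 1) := by
    intro l
    induction l with
    | nil => exact fun O z => ⟨z, (runs_skip _ _).mono (by simp)⟩
    | cons p l ih =>
      intro O z
      obtain ⟨z', hz⟩ := ih ((InstSym.nat _ (k.elt r p)).reverse ++ O) none
      refine ⟨z', ((runs_emitNumber p k ρ z hρ I H T O P hx hy).seq hz).congr rfl rfl rfl ?_ ?_⟩
      · simp
      · simp only [List.length_cons, add_mul]
        omega
  obtain ⟨z', hz⟩ := main (List.finRange _) (.inr () :: O) z
  rw [List.length_finRange] at hz
  refine ((runs_act' (t := 2) (S' := convStk I H T (conReg k) [] (.inr () :: O) P) rfl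
    (by simp) le_rfl).seq (hz.seq ((runs_clear false ρ z' I H T _ [] _ P).seq
      (runs_clear true ρ none I H T _ [] _ P)))).congr rfl rfl rfl ?_ ?_
  · congr 1
    · funext b
      cases b <;> simp
    · simp [Constraint.word]
  · have h₀ : ((conReg k) false).length ≤ n := by simpa [conReg]
    have h₁ : ((conReg k) true).length ≤ n := by simpa [conReg]
    rw [update_of_ne (by simp)]
    unfold emitTime
    omega

open Classical in
/-- The update of the registers by a symbol of a term. -/
noncomputable def termUpd (b : Bool) (ρ : ConvReg h) : ConvSym r h → ConvReg h
  | .fm a =>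
    if ρ.buf.1 = [] ∧ a = .var then ρ
    else if hc : ∃ c : MinorMap, c.word = ρ.buf.1 ++ [a] then
      {ρ with κ := update ρ.κ b (ρ.κ b ∘ hc.choose.kappa h), buf := ⟨[], Nat.zero_le _⟩}
    else if hl : (ρ.buf.1 ++ [a]).length ≤ bufLen h then {ρ with buf := ⟨ρ.buf.1 ++ [a], hl⟩}
    else ρ
  | _ => ρ

/-- The end of the minor operations of a term. -/
def termStop (ρ : ConvReg h) : ConvSym r h → Bool
  | .fm .var => ρ.buf.1.isEmpty
  | _ => false

/-- Read the minor operations of a term. -/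
noncomputable def termLoop (b : Bool) : ConvFrag r h :=
  scanLoop .inp .fm (termUpd b) termStop fun _ _ => []

/-- Here `l₁` is the part of the table already in the buffer. By the prefix property the buffer
becomes a complete table exactly at the last symbol, and then only that of `c`. The rest of the run
enters as the hypothesis `hL`, so that the lemma can be chained along a term. -/
theorem runs_termLoop_minor (b : Bool) {c : MinorMap} (h₁ : c.1 ≤ h) (h₂ : c.2.1 ≤ h)
    (l₁ l₂ : List FmSym) (hc : c.word = l₁ ++ l₂) (hl₂ : l₂ ≠ []) {ρ : ConvReg h}
    (hρ : ρ.buf.1 = l₁) {I : List FmSym} {H T : List Mark} {x : Bool → List Unit}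
    {w : List Unit} {O P : List (InstSym (completeSig r h))} {ρ' : ConvReg h} {S'} {t : ℕ}
    (hL : ∀ y, (termLoop b : ConvFrag r h).Runs
      ({ρ with κ := update ρ.κ b (ρ.κ b ∘ c.kappa h), buf := ⟨[], Nat.zero_le _⟩}, some y)
      (convStk I H T x w O P) (ρ', none) S' t) (y) :
    (termLoop b : ConvFrag r h).Runs (ρ, some y) (convStk (l₂ ++ I) H T x w O P) (ρ', none) S'
      (t + 5 * l₂.length) := by
  induction l₂ generalizing l₁ ρ y with
  | nil => exact absurd rfl hl₂
  | cons a l₂ ih =>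
    -- A table starts with `.minor`, so `.var` cannot be its first symbol.
    have hv : ¬ (ρ.buf.1 = [] ∧ a = .var) := by
      rintro ⟨hb, rfl⟩
      rw [← hρ, hb] at hc
      simp [MinorMap.word] at hc
    have hlen := MinorMap.length_word_le h₁ h₂
    rw [hc] at hlen
    by_cases hl : l₂ = []
    · subst hl
      have hex : ∃ c : MinorMap, c.word = ρ.buf.1 ++ [a] := ⟨c, by rw [hc, hρ]⟩
      have hch : hex.choose = c := by
        refine (MinorMap.word_append_inj (w := []) (w' := []) ?_).1
        rw [hex.choose_spec, hc, hρ]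
      have hu : termUpd (r := r) b ρ (.fm a) =
          {ρ with κ := update ρ.κ b (ρ.κ b ∘ c.kappa h), buf := ⟨[], Nat.zero_le _⟩} := by
        simp only [termUpd]
        rw [if_neg hv, dif_pos hex, hch]
      refine (Runs.scanLoop_cons (k := ConvStk.inp) (a := a) (l := I) rfl ?_ (fun y => ?_) y
        (t := t)).mono (by simp)
      · rw [hu]
        have ha : a ≠ .var := by
          rintro rfl
          have hmem : FmSym.var ∈ c.word := by rw [hc]; simp
          simp [MinorMap.word, FmSym.nat] at hmem
        cases a <;> first | rfl | (exact absurd rfl ha)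
      · rw [hu]
        exact (hL y).congr rfl (by simp) rfl rfl le_rfl
    · have hnex : ¬ ∃ c : MinorMap, c.word = ρ.buf.1 ++ [a] := by
        rintro ⟨c', hc'⟩
        have : c.word ++ [] = c'.word ++ l₂ := by rw [hc', hc, hρ]; simp
        exact hl (MinorMap.word_append_inj this).2.symm
      have hlen' : (ρ.buf.1 ++ [a]).length ≤ bufLen h := by
        rw [hρ]
        simp at hlen ⊢
        omega
      have hu : termUpd (r := r) b ρ (.fm a) = {ρ with buf := ⟨ρ.buf.1 ++ [a], hlen'⟩} := by
        simp only [termUpd]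
        rw [if_neg hv, dif_neg hnex, dif_pos hlen']
      refine (Runs.scanLoop_cons (k := ConvStk.inp) (a := a) (l := l₂ ++ I) rfl ?_ (fun y => ?_) y
        (t := t + 5 * l₂.length)).mono (by simp; omega)
      · rw [hu]
        cases a <;> simp [termStop]
      · rw [hu]
        exact (ih (l₁ ++ [a]) (by rw [hc]; simp) hl
          (ρ := {ρ with buf := ⟨ρ.buf.1 ++ [a], hlen'⟩}) (by simp [hρ]) hL y).congr rfl (by simp)
          rfl rfl le_rfl

theorem bind_ofFn_val {n m : ℕ} (π : Fin n → Fin m) :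
    (do let a ← List.ofFn π; pure (a : ℕ)) = List.ofFn fun i => (π i : ℕ) := by
  rw [List.ofFn_eq_map, List.ofFn_eq_map]
  simp [List.map_eq_flatMap, List.flatMap_assoc]

theorem encode_minor {n m : ℕ+} (π : Fin n → Fin m) (t : Tm Γ n) :
    (Tm.minor π t).encode = MinorMap.word ⟨n, m, π⟩ ++ t.encode := by
  simp only [Tm.encode, MinorMap.word]
  rw [bind_ofFn_val]

/-- In prefix notation the outermost operation is read first, which is why each new effect is
composed on the right. -/
theorem runs_termLoop (b : Bool) {n : ℕ+} (t : Tm Γ n) (ht : t.ArityLE h) {ρ : ConvReg h}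
    (hρ : ρ.buf.1 = []) (I : List FmSym) (H T : List Mark) (x : Bool → List Unit)
    (w : List Unit) (O P : List (InstSym (completeSig r h))) (y) :
    (termLoop b : ConvFrag r h).Runs (ρ, some y) (convStk (t.encode ++ I) H T x w O P)
      ({ρ with κ := update ρ.κ b (ρ.κ b ∘ t.kappa h)}, none)
      (convStk (FmSym.nat t.varIndex ++ I) H T x w O P) (5 * t.encode.length + 6) := by
  induction t generalizing ρ y with
  | var v =>
    have hu : termUpd (r := r) b ρ (.fm .var) = ρ := by simp [termUpd, hρ]
    refine (runs_scanLoop_stop (k := ConvStk.inp) (a := FmSym.var) (l := FmSym.nat v.index ++ I)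
      rfl ?_ y).congr rfl rfl ?_ ?_ (by omega)
    · rw [hu]
      simp [termStop, hρ]
    · rw [hu]
      simp [Tm.kappa]
    · simp [Tm.varIndex]
  | minor π t ih =>
    rw [encode_minor]
    have hn := ht.2.le
    have hm := ht.1
    have hρ' : ({ρ with buf := ⟨[], Nat.zero_le _⟩} : ConvReg h) = ρ := by
      obtain ⟨_, _, ⟨_, _⟩, _⟩ := ρ
      simp only at hρ
      subst hρ
      rfl
    refine (runs_termLoop_minor b (c := ⟨_, _, π⟩) hn hm [] (MinorMap.word ⟨_, _, π⟩) rfl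
      (by simp [MinorMap.word]) hρ
      (I := t.encode ++ I) (fun y => ih ht.2 rfl y) y).congr rfl ?_ ?_ rfl ?_
    · simp
    · conv_rhs => rw [← hρ']
      simp [Tm.kappa, MinorMap.kappa, comp_assoc]
    · simp; omega

/-- Read a term. -/
noncomputable def term (b : Bool) : ConvFrag r h :=
  (scan .inp .fm (termUpd b) termStop fun _ _ => []).seq
    ((lookup b).seq (op .inp (fun v _ => v) fun _ => []))

theorem runs_term (b : Bool) {n : ℕ+} (t : Tm Γ n) (ht : t.ArityLE h) {ρ : ConvReg h} (z)
    (hb : ρ.buf.1 = []) (hκ : ρ.κ b = id) (ha : ρ.aux = (false, none, none)) (I : List FmSym)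
    (H : List Mark) (hH : (liveIds H).length = Γ.length) (x : Bool → List Unit) (hx : x b = [])
    (w : List Unit) (O P : List (InstSym (completeSig r h))) :
    (term b : ConvFrag r h).Runs (ρ, z) (convStk (t.encode ++ I) H [] x w O P)
      ({ρ with κ := update ρ.κ b (t.kappa h)}, none)
      (convStk I H [] (update x b (List.replicate ((liveIds H).getD t.varIndex 0) ())) w O P)
      (5 * t.encode.length + 10 * H.length + 28) := by
  have h₁ := Runs.scan (z := z) (runs_termLoop (r := r) b t ht hb I H [] x w O P)
  have h₂ := runs_lookup (r := r) b {ρ with κ := update ρ.κ b (ρ.κ b ∘ t.kappa h)} none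
    t.varIndex (.stop_mark :: I) H x w O P ha (by simp) (by rw [hH]; exact t.varIndex_lt)
  refine (h₁.seq (h₂.congr rfl ?_ rfl rfl le_rfl |>.seq
    (runs_op' (t := 2) rfl rfl le_rfl))).congr rfl rfl ?_ ?_ (by omega)
  · simp [FmSym.nat]
  · simp [hκ]
  · simp [hx]

end Conv
end MinionPattern

/-! ### The main loop of the translation and its running time -/

namespace MinionPattern

open Turing Function

variable {h r : ℕ+} {Γ : List ℕ+}

/-- After a quantifier, `lookup` can be run directly on the next subformula: it sees no digit there,
so it finds the variable of index zero, the one just bound. -/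
theorem PP.head?_encode_ne_digit (φ : PP Γ) (I : List FmSym) :
    (φ.encode ++ I).head? ≠ some .digit := by
  cases φ <;> simp [PP.encode]

theorem PP.exCount_le_length_encode (φ : PP Γ) : φ.exCount ≤ φ.encode.length := by
  induction φ with
  | top => simp [PP.exCount]
  | eq s t => simp [PP.exCount]
  | and φ ψ ih₁ ih₂ => simp [PP.exCount, PP.encode]; omega
  | ex n φ ih => simp [PP.exCount, PP.encode]; omega

theorem FmSym.length_nat (n : ℕ) : (FmSym.nat n).length = n + 1 := by simp [FmSym.nat]

theorem PP.length_constraints_le (φ : PP Γ) (ids : List ℕ) (c : ℕ) :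
    (φ.constraints h ids c).length ≤ φ.encode.length := by
  induction φ generalizing ids c with
  | top => simp [PP.constraints]
  | eq s t => simp [PP.constraints, PP.encode]
  | and φ ψ ih₁ ih₂ =>
    have := ih₁ ids c
    have := ih₂ ids (c + φ.exCount)
    simp [PP.constraints, PP.encode]
    omega
  | ex n φ ih =>
    have := ih (c :: ids) (c + 1)
    simp [PP.constraints, PP.encode]
    omega

theorem PP.length_flatMap_word_le (φ : MinorCondition) :
    ((φ.constraints h [] 0).flatMap (Constraint.word r)).length ≤ φ.encode.length *
      (1 + (r : ℕ) ^ (h : ℕ) * (φ.encode.length * (r : ℕ) ^ (h : ℕ) + 1)) := by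
  have hl := φ.constraints_lt (h := h) (ids := []) (c := 0) rfl (by simp)
  refine (length_flatMap_le _ _ _ fun k hk => ?_).trans
    (Nat.mul_le_mul_right _ (φ.length_constraints_le [] 0))
  have h₁ := length_flatMap_le (List.finRange ((r : ℕ) ^ (h : ℕ)))
    (fun p => InstSym.nat (completeSig r h) (k.elt r p))
    (φ.encode.length * (r : ℕ) ^ (h : ℕ) + 1) (by
      intro p _
      have h₂ := k.elt_lt (hl k hk) p
      have h₃ := Nat.mul_le_mul_right ((r : ℕ) ^ (h : ℕ)) φ.exCount_le_length_encode
      rw [zero_add] at h₂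
      simp only [InstSym.nat, List.length_append, List.length_replicate, List.length_singleton]
      omega)
  rw [List.length_finRange] at h₁
  simp only [Constraint.word, List.length_cons]
  omega

namespace Conv

open Frag

/-- The registers between two rounds. -/
def std (tok : Option FmSym) : ConvReg h := ⟨tok, fun _ => id, ⟨[], Nat.zero_le _⟩, false, none, none⟩

open Classical in
/-- The last symbol that was read. -/
noncomputable def tokIs (a : FmSym) (v : ConvState r h) : Bool := decide (v.1.tok = some a)

/-- The treatment of a quantifier. -/
def quant : ConvFrag r h :=
  (scan .inp .fm (fun ρ _ => ρ)
    (fun _ y => match y with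
      | .fm .stop_mark => true
      | _ => false) (fun _ _ => [])).seq
  ((act id fun _ => [⟨.marks, .live⟩]).seq
    ((lookup false).seq ((lookup true).seq emitFact)))

/-- The treatment of an equation. -/
noncomputable def equation : ConvFrag r h :=
  (term false).seq ((term true).seq (emitFact.seq finish))

/-- The treatment of a symbol at the head of a subformula. -/
noncomputable def dispatch : ConvFrag r h :=
  ite (tokIs .top) finish (ite (tokIs .and) (act id fun _ => [⟨.marks, .fork⟩])
    (ite (tokIs .ex) quant (ite (tokIs .eq) equation skip)))

/-- One round of the translation. -/
noncomputable def round : ConvFrag r h :=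
  (op .inp (fun v a => ({v.1 with tok := a}, none)) fun _ => []).seq
    (dispatch.seq (act (fun v => (std (v.1.tok.map fun _ => .top), none)) fun _ => []))

/-- All the rounds of the translation. -/
noncomputable def rounds : ConvFrag r h := loop (fun v => v.1.tok.isSome) round

/-- The bound on the time of one round. -/
def roundTime (r h : ℕ+) (n : ℕ) : ℕ := emitTime r h n + 50 * n + 200

/-- The stacks between two rounds. -/
abbrev roundStk (I : List FmSym) (H : List Mark) (O : List (InstSym (completeSig r h))) :
    ∀ k, List (ConvAlph r h k) :=
  convStk I H [] (fun _ => []) [] O []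

theorem runs_rounds_cons {a : FmSym} {I I' : List FmSym} {H H' : List Mark}
    {O O' : List (InstSym (completeSig r h))} {ρ : ConvReg h} {z} {t T : ℕ} {v' S'}
    (hd : (dispatch : ConvFrag r h).Runs (std (some a), none) (roundStk I H O) (ρ, z)
      (roundStk I' H' O') t) (hρ : ρ.tok.isSome)
    (hc : (rounds : ConvFrag r h).Runs (std (some .top), none) (roundStk I' H' O') v' S' T) :
    (rounds : ConvFrag r h).Runs (std (some .top), none) (roundStk (a :: I) H O) v' S'
      (T + (t + 5)) := by
  obtain ⟨b, hb⟩ := Option.isSome_iff_exists.1 hρ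
  refine (Runs.loop_true (Runs.seq (t := 2) (runs_op' (S' := roundStk I H O) rfl ?_ le_rfl)
    (hd.seq (runs_act' (v' := (std (some .top), none)) (t := 2) ?_ rfl le_rfl))) rfl hc).mono
    (by omega)
  · simp
  · simp [hb]

/-- The arity of the variable is skipped, since every variable is lifted to arity `h`. Looking the
new variable up into both registers produces its trivial equation. -/
theorem runs_quant (n : ℕ+) {I : List FmSym} (hI : I.head? ≠ some .digit) (H : List Mark)
    (O : List (InstSym (completeSig r h))) {m : ℕ} (hn : (n : ℕ) ≤ m) (hH : H.length < m) :
    (quant : ConvFrag r h).Runs (std (some .ex), none) (roundStk (FmSym.nat n ++ I) H O)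
      (std (some .ex), none) (roundStk I (.live :: H)
        (((⟨id, id, markCount H, markCount H⟩ : Constraint h).word r).reverse ++ O))
      (emitTime r h m + 25 * m + 46) := by
  have hc := (markCount_le H).trans hH.le
  have hs : ∀ (n : ℕ) (y : Option (ConvSym r h)), (scanLoop .inp .fm (fun ρ _ => ρ)
      (fun _ y => match y with
        | .fm .stop_mark => true
        | _ => false) (fun _ _ => []) : ConvFrag r h).Runs (std (some .ex), some y)
      (roundStk (FmSym.nat n ++ I) H O) (std (some .ex), none) (roundStk I H O) (5 * n + 6) := by
    intro n
    induction n with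
    | zero =>
      intro y
      exact (runs_scanLoop_stop (k := ConvStk.inp) (a := FmSym.stop_mark) (l := I) rfl rfl y).congr
        rfl rfl rfl (by simp) (by omega)
    | succ n ih =>
      intro y
      refine (Runs.scanLoop_cons (k := ConvStk.inp) (a := FmSym.digit) (l := FmSym.nat n ++ I)
        (t := 5 * n + 6) rfl rfl (fun y => ?_) y).mono (by omega)
      exact (ih y).congr rfl (by simp) rfl rfl le_rfl
  have hl : ∀ (b : Bool) (x : Bool → List Unit), x b = [] →
      (lookup b : ConvFrag r h).Runs (std (some .ex), none)
      (convStk I (.live :: H) [] x [] O []) (std (some .ex), none)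
      (convStk I (.live :: H) [] (update x b (List.replicate (markCount H) ())) [] O [])
      (10 * m + 18) := by
    intro b x hx
    refine (runs_lookup b (std (some .ex)) none 0 I (.live :: H) x [] O [] rfl hI
      (by simp [liveIds])).congr rfl rfl rfl ?_ (by simp; omega)
    simp [liveIds, hx]
  refine ((Runs.scan (hs n)).seq (Runs.seq (runs_act' (t := 2)
    (S' := roundStk I (.live :: H) O) rfl (by simp) le_rfl)
    ((hl false _ rfl).seq ((hl true _ (by simp)).seq ((runs_emitFact
      ⟨id, id, markCount H, markCount H⟩ (std (some .ex)) none ?_ I (.live :: H) [] O [] hc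
      hc).congr rfl ?_ rfl rfl le_rfl))))).mono (by omega)
  · rintro (_ | _) <;> rfl
  · congr 1
    funext b
    cases b <;> simp [conReg]

theorem runs_equation {n : ℕ+} (s t : Tm Γ n) (hs : s.ArityLE h) (ht : t.ArityLE h)
    (I : List FmSym) {H : List Mark} (hH : (liveIds H).length = Γ.length)
    (O : List (InstSym (completeSig r h))) {m : ℕ}
    (hm : H.length + s.encode.length + t.encode.length ≤ m) :
    ∃ ρ : ConvReg h, ρ.tok.isSome ∧ (equation : ConvFrag r h).Runs (std (some .eq), none)
      (roundStk (s.encode ++ t.encode ++ I) H O) (ρ, none) (roundStk I (finishMarks H)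
        (((⟨s.kappa h, t.kappa h, (liveIds H).getD s.varIndex 0,
          (liveIds H).getD t.varIndex 0⟩ : Constraint h).word r).reverse ++ O))
      (emitTime r h m + 40 * m + 80) := by
  have hx := getD_lt (liveIds_lt H) (hH ▸ s.varIndex_lt : s.varIndex < _)
  have hy := getD_lt (liveIds_lt H) (hH ▸ t.varIndex_lt : t.varIndex < _)
  have hc := markCount_le H
  set ρ : ConvReg h := ⟨some .eq, update (update (fun _ => id) false (s.kappa h)) true (t.kappa h),
    ⟨[], Nat.zero_le _⟩, false, none, none⟩ with hρ
  have h₁ := runs_term (r := r) false s hs (ρ := std (some .eq)) none rfl rfl rfl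
    (t.encode ++ I) H hH (fun _ => []) rfl [] O []
  have h₂ := runs_term (r := r) true t ht
    (ρ := {std (some .eq) with κ := update (fun _ => id) false (s.kappa h)}) none rfl (by simp) rfl
    I H hH (update (fun _ => []) false (List.replicate ((liveIds H).getD s.varIndex 0) ()))
    (by simp) [] O []
  have h₃ := runs_emitFact (r := r) ⟨s.kappa h, t.kappa h, (liveIds H).getD s.varIndex 0,
    (liveIds H).getD t.varIndex 0⟩ ρ none (by rintro (_ | _) <;> simp [hρ]) I H [] O [] (n := m)
    (by simp only; omega) (by simp only; omega)
  refine ⟨ρ, rfl, (h₁.seq (h₂.seq ((h₃.congr rfl ?_ rfl rfl le_rfl).seq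
    (runs_finish ρ none I H _ [] _ [])))).congr rfl ?_ rfl rfl ?_⟩
  · congr 1
    funext b
    cases b <;> simp [conReg]
  · simp
  · omega

/-- The machine has no recursion besides its marks, so the claim is stated with the remaining input
`I` and the remaining run `hc`. The end of `φ` kills all variables down to the nearest fork and
removes that fork. The height of the marks is at most `m` throughout, so `m` bounds the cost of each
round. -/
theorem runs_rounds (φ : PP Γ) (hφ : φ.ArityLE h) {m : ℕ} (I : List FmSym) {H : List Mark}
    (hH : (liveIds H).length = Γ.length) (hm : H.length + φ.encode.length ≤ m)
    (O : List (InstSym (completeSig r h))) {v' S'} {T : ℕ}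
    (hc : (rounds : ConvFrag r h).Runs (std (some .top), none)
      (roundStk I (finishMarks (List.replicate φ.exCount .dead ++ H))
        (((φ.constraints h (liveIds H) (markCount H)).flatMap (Constraint.word r)).reverse ++ O))
      v' S' T) :
    (rounds : ConvFrag r h).Runs (std (some .top), none) (roundStk (φ.encode ++ I) H O) v' S'
      (T + φ.encode.length * roundTime r h m) := by
  have hT : roundTime r h m = emitTime r h m + 50 * m + 200 := rfl
  induction φ generalizing I H O T with
  | top =>
    refine (runs_rounds_cons (a := .top) ((runs_finish _ none I H _ [] O []).ite_true
      (by simp [tokIs, std])) rfl hc).mono ?_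
    simp only [PP.encode, List.length_singleton] at hm ⊢
    omega
  | eq s t =>
    simp only [PP.encode, List.length_cons, List.cons_append, List.length_append] at hm ⊢
    obtain ⟨ρ, hρ, hr⟩ := runs_equation s t hφ.1 hφ.2 I hH O (m := m) (by omega)
    refine (runs_rounds_cons (a := .eq) ((((hr.ite_true ?_).ite_false ?_).ite_false ?_).ite_false
      ?_) hρ (hc.congr rfl ?_ rfl rfl le_rfl)).mono ?_
    iterate 4 simp [tokIs, std]
    · simp [PP.constraints, PP.exCount]
    · have := Nat.le_mul_of_pos_left (roundTime r h m)
        (Nat.succ_pos (s.encode.length + t.encode.length))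
      simp only [Nat.succ_eq_add_one] at this
      omega
  | and φ ψ ih₁ ih₂ =>
    have hk := φ.exCount_le_length_encode
    simp only [PP.encode, List.length_cons, List.cons_append, List.length_append,
      List.append_assoc] at hm ⊢
    have he : List.replicate (φ.exCount + ψ.exCount) Mark.dead ++ H =
        List.replicate ψ.exCount .dead ++ (List.replicate φ.exCount .dead ++ H) := by
      rw [← List.append_assoc, List.replicate_append_replicate, add_comm]
    -- The end of the first conjunct consumes the fork pushed at the conjunction. Its variables stay
    -- as dead marks, which keeps the numbering consecutive and the scope unchanged.
    have h₁ := ih₂ hφ.2 I (H := List.replicate φ.exCount .dead ++ H)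
      (by rw [liveIds_dead_append, hH]) (by simp; omega)
      (((φ.constraints h (liveIds H) (markCount H)).flatMap (Constraint.word r)).reverse ++ O)
      (hc.congr rfl (by
        simp only [PP.constraints, PP.exCount, liveIds_dead_append, markCount_dead_append, he,
          List.flatMap_append, List.reverse_append, List.append_assoc]) rfl rfl le_rfl)
    have h₂ := ih₁ hφ.1 (ψ.encode ++ I) (H := .fork :: H) hH (by simp; omega) O
      (h₁.congr rfl (by
        simp [finishMarks_dead_append, finishMarks, liveIds, markCount]) rfl rfl le_rfl)
    refine (runs_rounds_cons (a := .and) (t := 4) (((runs_act' (t := 2) rfl (by simp)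
      le_rfl).ite_true ?_).ite_false ?_) ?_ h₂).mono ?_
    iterate 3 simp [tokIs, std]
    simp only [add_mul]
    omega
  | ex n φ ih =>
    simp only [PP.encode, List.length_cons, List.cons_append, List.length_append,
      List.append_assoc, FmSym.length_nat] at hm ⊢
    have h₁ := ih hφ.2 I (H := .live :: H) (by simp [liveIds, hH]) (by simp; omega)
      (((⟨id, id, markCount H, markCount H⟩ : Constraint h).word r).reverse ++ O)
      (hc.congr rfl (by
        simp [PP.constraints, PP.exCount, finishMarks_dead_append, finishMarks, liveIds,
          markCount, List.replicate_succ']) rfl rfl le_rfl)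
    refine (runs_rounds_cons (a := .ex) ((((runs_quant n (φ.head?_encode_ne_digit I) H O
      (m := m) (by omega) (by omega)).ite_true ?_).ite_false ?_).ite_false ?_) ?_ h₁).mono ?_
    iterate 4 simp [tokIs, std]
    have := Nat.le_mul_of_pos_left (roundTime r h m) (Nat.succ_pos (n + 1))
    simp only [add_mul, Nat.succ_eq_add_one] at this ⊢
    omega

/-- The translation of formulas into structures. -/
noncomputable def machine : ConvFrag r h :=
  rounds.seq
    ((drain .rev .res fun _ y => match y with
      | .res a => [⟨.out, a⟩]
      | _ => []).seq
    ((act id fun _ => [⟨.out, .inl false⟩]).seq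
    ((drain .marks .mark fun _ _ =>
      List.replicate ((r : ℕ) ^ (h : ℕ)) ⟨.out, .inl true⟩).seq
    (act (fun _ => (std (some .top), none)) fun _ => []))))

theorem pushAll_flatMap_replicate {K A : Type} [DecidableEq K] {Γ : K → Type} (k : K) (a : Γ k)
    (N : ℕ) (l : List A) (S : ∀ k, List (Γ k)) :
    pushAll S (l.flatMap fun _ => List.replicate N ⟨k, a⟩) =
      update S k (List.replicate (l.length * N) a ++ S k) := by
  induction l generalizing S with
  | nil => simp
  | cons b l ih =>
    rw [List.flatMap_cons, pushAll_append, pushAll_replicate, ih, update_idem, update_self,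
      ← List.append_assoc, List.replicate_append_replicate, List.length_cons, add_mul, one_mul]

theorem finishMarks_dead (k : ℕ) :
    finishMarks (List.replicate k .dead) = List.replicate k .dead := by
  simpa [finishMarks] using finishMarks_dead_append k []

/-- When the formula has been read, no fork is left and all variables are dead, so the marks count
the quantifiers. Only then can the size be written; it goes on top of the facts, which have been put
back in order. -/
theorem runs_machine (φ : MinorCondition) (hφ : φ.ArityLE h) :
    (machine : ConvFrag r h).Runs (std (some .top), none)
      (update (fun _ => []) .inp φ.encode) (std (some .top), none)
      (update (fun _ => []) .out (φ.toInstance r h).encode)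
      (φ.encode.length * roundTime r h φ.encode.length + (5 * (φ.encode.length *
        (1 + (r : ℕ) ^ (h : ℕ) * (φ.encode.length * (r : ℕ) ^ (h : ℕ) + 1))) +
        5 * φ.encode.length + 31)) := by
  have hnil : (fun k => ([] : List (ConvAlph r h k))) = roundStk [] [] [] := by
    funext k
    cases k <;> rfl
  -- The round that finds the input empty and ends the loop.
  have h₀ : ∀ H O, (rounds : ConvFrag r h).Runs (std (some .top), none) (roundStk [] H O)
      (std none, none) (roundStk [] H O) 11 := by
    intro H O
    refine Runs.loop_true (t := 9) (t' := 1) (Runs.seq (t := 2) (t' := 7)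
      (runs_op' (v' := (std none, none)) rfl (by simp; rfl) le_rfl) (Runs.seq (t := 5) (t' := 2)
      (((((runs_skip _ _).ite_false ?_).ite_false ?_).ite_false ?_).ite_false ?_)
      (runs_act' rfl rfl le_rfl))) rfl (runs_loop_false rfl _)
    iterate 4 simp [tokIs, std]
  have h₁ := runs_rounds φ hφ (m := φ.encode.length) [] (H := []) rfl (by simp) [] (h₀ _ _)
  have hk := φ.exCount_le_length_encode
  have hL := φ.length_flatMap_word_le (r := r) (h := h)
  simp only [List.append_nil, finishMarks_dead, liveIds, markCount] at h₁
  rw [hnil, update_convStk_inp, update_convStk_out]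
  refine (h₁.seq ((Runs.congr (T' := convStk [] (List.replicate φ.exCount .dead) []
    (fun _ => []) [] [] ((φ.constraints h [] 0).flatMap (Constraint.word r)))
    (runs_drain _ ?_) rfl rfl rfl ?_ le_rfl).seq ((runs_act' (t := 2)
    (S' := convStk [] (List.replicate φ.exCount .dead) [] (fun _ => []) [] []
      (.inl false :: (φ.constraints h [] 0).flatMap (Constraint.word r))) rfl ?_ le_rfl).seq
    (((runs_drain _ ?_).congr rfl rfl rfl rfl le_rfl).seq (runs_act' (t := 2) rfl ?_ le_rfl))))).mono
    ?_
  · rintro (_ | _) <;> simp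
  · simp only [convStk_rev]
    rw [pushAll_flatMap_singleton (Γ := ConvAlph r h)]
    simp
  · simp
  · rintro a p hp
    rw [List.eq_of_mem_replicate hp]
    simp
  · simp only [convStk_marks]
    rw [pushAll_flatMap_replicate (Γ := ConvAlph r h), pushAll_nil]
    simp [PP.encode_toInstance, InstSym.nat]
  · simp only [convStk_rev, convStk_marks, List.length_reverse, List.length_replicate]
    omega

/-- The bound on the arity is what allows a finite buffer. The polynomial transcribes the time in
`runs_machine`. -/
theorem polyTime_toInstance (r h : ℕ+) :
    PolyTime (fun φ : {φ : MinorCondition // φ.ArityLE h} => φ.1.encode) Instance.encode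
      (fun φ => φ.1.toInstance r h) := by
  have hf : ∀ k, Finite (ConvAlph r h k) := by
    intro k
    cases k <;> dsimp only [ConvAlph] <;> infer_instance
  refine polyTime_of_frag_refl (Γ := ConvAlph r h) ConvStk.inp ConvStk.out machine
    (std (some .top), none)
    (.X * (.C ((r : ℕ) ^ (h : ℕ)) * (.C 10 * .X + .C 18) + .C 10 * .X + .C 19 + .C 50 * .X +
      .C 200) + (.C 5 * (.X * (.C 1 + .C ((r : ℕ) ^ (h : ℕ)) * (.X * .C ((r : ℕ) ^ (h : ℕ)) +
      .C 1))) + .C 5 * .X + .C 31)) fun φ => (runs_machine φ.1 φ.2).mono (le_of_eq ?_)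
  simp only [Polynomial.eval_add, Polynomial.eval_mul, Polynomial.eval_C, Polynomial.eval_X]
  rfl

end Conv
end MinionPattern

namespace MinionPattern

open Turing Function

/-! ### Counting a prefix of a word -/

/-- In contrast to `runs_drain` the registers may change on the way, provided that the pushed
symbols do not depend on them. -/
theorem Frag.runs_sweep {K : Type} [DecidableEq K] {Γ : K → Type} {R Y : Type} [Finite R]
    [Finite Y] {k : K} {e : Γ k → Y} {u : R → Y → R} {w : R → Y → List (Σ k, Γ k)}
    {w' : Γ k → List (Σ k, Γ k)} (hw : ∀ ρ a, w ρ (e a) = w' a) (hk : ∀ a, ∀ p ∈ w' a, p.1 ≠ k)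
    {ρ : R} {z : Option (Option Y)} (S : ∀ k, List (Γ k)) :
    (scan k e u (fun _ _ => false) w).Runs (ρ, z) S ((S k).foldl (fun ρ a => u ρ (e a)) ρ, none)
      (pushAll (update S k []) ((S k).flatMap w')) (5 * (S k).length + 8) := by
  suffices H : ∀ (l : List (Γ k)) (ρ : R) (S : ∀ k, List (Γ k)) (y), S k = l →
      (scanLoop k e u (fun _ _ => false) w).Runs (ρ, some y) S
        (l.foldl (fun ρ a => u ρ (e a)) ρ, none)
        (pushAll (update S k []) (l.flatMap w')) (5 * l.length + 6) from
    (Runs.scan fun y => H _ ρ S y rfl).mono (by omega)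
  intro l
  induction l with
  | nil =>
    intro ρ S y hS
    refine (runs_scanLoop_nil hS y).congr rfl rfl rfl ?_ (by simp)
    have : update S k [] = S := by rw [← hS, update_eq_self]
    simp [this]
  | cons a l ih =>
    intro ρ S y hS
    refine (Runs.scanLoop_cons hS rfl (fun y => ih _ _ y ?_) y).congr rfl rfl rfl ?_
      (by simp; omega)
    · rw [hw, pushAll_apply_of_ne (hk _)]; simp
    · rw [hw, List.flatMap_cons, pushAll_append]
      congr 1
      rw [← pushAll_update (hk _)]
      simp

/-- The stacks of the machine that counts the letters of a prefix. -/
inductive CountStk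
  | inp | fst | snd | cnt | out
  deriving DecidableEq

instance : Finite CountStk :=
  Finite.of_surjective (fun i : Fin 5 => [CountStk.inp, .fst, .snd, .cnt, .out][i])
    (by intro k; cases k <;> decide)

/-- The alphabets of the machine that counts the letters of a prefix. -/
@[reducible] def CountAlph (A C : Type) : CountStk → Type
  | .inp => A ⊕ C
  | .fst => A
  | .snd => C
  | .cnt => Unit
  | .out => A ⊕ Option C

namespace CountStk

variable {A C : Type} (i : List (A ⊕ C)) (f : List A) (s : List C) (c : List Unit)
  (o : List (A ⊕ Option C))

/-- The contents of the stacks. -/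
def mk : ∀ k, List (CountAlph A C k)
  | .inp => i
  | .fst => f
  | .snd => s
  | .cnt => c
  | .out => o

@[simp] theorem update_inp (x) : update (mk i f s c o) inp x = mk x f s c o := by
  funext k; cases k <;> rfl

@[simp] theorem update_fst (x) : update (mk i f s c o) fst x = mk i x s c o := by
  funext k; cases k <;> rfl

@[simp] theorem update_snd (x) : update (mk i f s c o) snd x = mk i f x c o := by
  funext k; cases k <;> rfl

@[simp] theorem update_cnt (x) : update (mk i f s c o) cnt x = mk i f s x o := by
  funext k; cases k <;> rfl

@[simp] theorem update_out (x) : update (mk i f s c o) out x = mk i f s c x := by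
  funext k; cases k <;> rfl

@[simp] theorem mk_inp : mk i f s c o inp = i := rfl
@[simp] theorem mk_fst : mk i f s c o fst = f := rfl
@[simp] theorem mk_snd : mk i f s c o snd = s := rfl
@[simp] theorem mk_cnt : mk i f s c o cnt = c := rfl
@[simp] theorem mk_out : mk i f s c o out = o := rfl

theorem mk_nil : mk [] [] [] [] [] = fun k => ([] : List (CountAlph A C k)) := by
  funext k; cases k <;> rfl

end CountStk

/-- Put, in front of a side input, one mark for each letter of the longest prefix of the word that
consists of letters with a given property. -/
def markPrefix {α A C : Type} (ea : α → List A) (d : A → Bool) (p : α × List C) :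
    α × List (Option C) :=
  (p.1, List.replicate ((ea p.1).takeWhile d).length none ++ p.2.map some)

/-- This carries the size of the source instance, in unary, past its translation: the decoder has to
know how many values to write. The register remembers whether the prefix still lasts. -/
theorem polyTime_markPrefix {α A C : Type} [Finite A] [Finite C] (ea : α → List A)
    (d : A → Bool) :
    PolyTime (withSide ea) (withSide ea) (markPrefix (C := C) ea d) := by
  let Y := (A ⊕ C) ⊕ Unit
  let Γ := CountAlph A C
  let u : Bool → Y → Bool := fun ρ y => match y with
    | .inl (.inl a) => ρ && d a
    | _ => ρ
  let w : Bool → Y → List (Σ k, Γ k) := fun ρ y => match y with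
    | .inl (.inl a) => ⟨.fst, a⟩ :: if ρ then [⟨.cnt, ()⟩] else []
    | .inl (.inr c) => [⟨.snd, c⟩]
    | .inr _ => []
  let D₁ : Frag Γ (Bool × Option (Option Y)) := Frag.scan .inp .inl u (fun _ _ => false) w
  let D₂ : Frag Γ (Bool × Option (Option Y)) :=
    Frag.drain .snd (fun c => .inl (.inr c)) fun _ y => match y with
      | .inl (.inr c) => [⟨.out, .inr (some c)⟩]
      | _ => []
  let D₃ : Frag Γ (Bool × Option (Option Y)) :=
    Frag.drain .cnt .inr fun _ y => match y with
      | .inr _ => [⟨.out, .inr none⟩]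
      | _ => []
  let D₄ : Frag Γ (Bool × Option (Option Y)) :=
    Frag.drain .fst (fun a => .inl (.inl a)) fun _ y => match y with
      | .inl (.inl a) => [⟨.out, .inl a⟩]
      | _ => []
  have : Finite (Γ .inp) := inferInstanceAs (Finite (A ⊕ C))
  refine polyTime_of_frag_refl (Γ := Γ) .inp .out
    (D₁.seq (D₂.seq (D₃.seq (D₄.seq (Frag.act (fun _ => (true, none)) fun _ => [])))))
    (true, none) (15 * Polynomial.X + 40) fun ⟨a, z⟩ => ?_
  have hz : ∀ (z : List C) (ρ : Bool) (f : List A) (s : List C) (c : List Unit) (y : Option Y),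
      (Frag.scanLoop .inp .inl u (fun _ _ => false) w : Frag Γ _).Runs (ρ, some y)
        (CountStk.mk (z.map .inr) f s c []) (ρ, none)
        (CountStk.mk [] f (z.reverse ++ s) c []) (5 * z.length + 6) := by
    intro z
    induction z with
    | nil => exact fun ρ f s c y => Frag.runs_scanLoop_nil rfl y
    | cons b z ih =>
      intro ρ f s c y
      refine (Frag.Runs.scanLoop_cons (k := CountStk.inp) (a := .inr b) (l := z.map .inr)
        (t := 5 * z.length + 6) rfl rfl (fun y => ?_) y).mono (by simp; omega)
      exact (ih ρ f (b :: s) c y).congr rfl (by simp [w, u]) rfl (by simp) le_rfl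
  have hx : ∀ (x : List A) (ρ : Bool) (f : List A) (c : List Unit) (y : Option Y),
      (Frag.scanLoop .inp .inl u (fun _ _ => false) w : Frag Γ _).Runs (ρ, some y)
        (CountStk.mk (x.map .inl ++ z.map .inr) f [] c []) (ρ && x.all d, none)
        (CountStk.mk [] (x.reverse ++ f) z.reverse
          ((if ρ then List.replicate (x.takeWhile d).length () else []) ++ c) [])
        (5 * x.length + (5 * z.length + 6)) := by
    intro x
    induction x with
    | nil =>
      exact fun ρ f c y => (hz z ρ f [] c y).congr rfl rfl (by simp) (by simp) (by simp)
    | cons b x ih =>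
      intro ρ f c y
      refine ((Frag.Runs.scanLoop_cons (k := CountStk.inp) (a := .inl b)
        (l := x.map .inl ++ z.map .inr) rfl rfl (fun y => (ih (ρ && d b) (b :: f)
        ((if ρ && d b then [()] else []) ++ c) y).congr rfl ?_ rfl rfl le_rfl) y)).congr rfl rfl
        ?_ ?_ ?_
      · cases ρ <;> cases hb : d b <;> simp [w, u, hb]
      · simp [Bool.and_assoc]
      · cases ρ <;> cases hb : d b <;> simp [hb, List.replicate_succ']
      · simp
        omega
  have R₁ := Frag.Runs.scan (z := none) (hx (ea a) true [] [])
  refine ((R₁.seq (((Frag.runs_drain _ ?_).congr rfl rfl rfl (T' := CountStk.mk [] (ea a).reverse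
    [] (List.replicate ((ea a).takeWhile d).length ()) (z.map fun c => .inr (some c))) ?_
    le_rfl).seq (((Frag.runs_drain _ ?_).congr rfl rfl rfl (T' := CountStk.mk [] (ea a).reverse
    [] [] ((markPrefix ea d (a, z)).2.map .inr)) ?_ le_rfl).seq
    (((Frag.runs_drain _ ?_).congr rfl rfl rfl (T' := CountStk.mk [] []
    [] [] (withSide ea (markPrefix ea d (a, z)))) ?_ le_rfl).seq
    (Frag.runs_act' (t := 2) rfl rfl le_rfl)))))).congr rfl ?_ rfl ?_ ?_
  · rintro ((_ | _) | _) <;> simp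
  · simp only [CountStk.mk_snd]
    rw [pushAll_flatMap_singleton (Γ := Γ)]
    simp
  · rintro ((_ | _) | _) <;> simp
  · simp only [CountStk.mk_cnt]
    rw [pushAll_flatMap_singleton (Γ := Γ)]
    simp [markPrefix, Function.comp_def]
  · rintro ((_ | _) | _) <;> simp
  · simp only [CountStk.mk_fst]
    rw [pushAll_flatMap_singleton (Γ := Γ)]
    simp [withSide, markPrefix]
  · rw [← CountStk.mk_nil, CountStk.update_inp]
    rfl
  · rw [← CountStk.mk_nil, CountStk.update_out]
    rfl
  · have := (List.takeWhile_prefix d (l := ea a)).length_le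
    simp [withSide]
    omega

end MinionPattern

namespace MinionPattern

open Turing Function

/-! ### Reading the entries of a table -/

/-- The stacks of the machine that looks up entries of a table. -/
inductive TableStk
  | inp | rest | wrd | val | tmp | cnt | out
  deriving DecidableEq

instance : Finite TableStk :=
  Finite.of_surjective
    (fun i : Fin 7 => [TableStk.inp, .rest, .wrd, .val, .tmp, .cnt, .out][i])
    (by intro k; cases k <;> decide)

variable {S : Signature} {B W R : Type}

/-- The alphabet of the input: a word and a table, after the number of blocks of the table. -/
abbrev TableSym (S : Signature) (B : Type) := InstSym S ⊕ Option (Option B)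

/-- The alphabets of the machine that looks up entries of a table. -/
@[reducible] def TableAlph (S : Signature) (B W : Type) : TableStk → Type
  | .inp => TableSym S B
  | .rest => TableSym S B
  | .wrd => InstSym S
  | .val => Option B
  | .tmp => Option B
  | .cnt => Unit
  | .out => W

namespace Table

/-- The contents of the stacks. -/
def mk (i j : List (TableSym S B)) (x : List (InstSym S)) (z t : List (Option B)) (c : List Unit)
    (o : List W) : ∀ k, List (TableAlph S B W k)
  | .inp => i
  | .rest => j
  | .wrd => x
  | .val => z
  | .tmp => t
  | .cnt => c
  | .out => o

section

variable (i j : List (TableSym S B)) (x : List (InstSym S)) (z t : List (Option B))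
    (c : List Unit) (o : List W)

@[simp] theorem mk_inp : mk i j x z t c o .inp = i := rfl
@[simp] theorem mk_rest : mk i j x z t c o .rest = j := rfl
@[simp] theorem mk_wrd : mk i j x z t c o .wrd = x := rfl
@[simp] theorem mk_val : mk i j x z t c o .val = z := rfl
@[simp] theorem mk_tmp : mk i j x z t c o .tmp = t := rfl
@[simp] theorem mk_cnt : mk i j x z t c o .cnt = c := rfl
@[simp] theorem mk_out : mk i j x z t c o .out = o := rfl

@[simp] theorem update_inp (l) : update (mk i j x z t c o) .inp l = mk l j x z t c o := by
  funext k; cases k <;> rfl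
@[simp] theorem update_rest (l) : update (mk i j x z t c o) .rest l = mk i l x z t c o := by
  funext k; cases k <;> rfl
@[simp] theorem update_wrd (l) : update (mk i j x z t c o) .wrd l = mk i j l z t c o := by
  funext k; cases k <;> rfl
@[simp] theorem update_val (l) : update (mk i j x z t c o) .val l = mk i j x l t c o := by
  funext k; cases k <;> rfl
@[simp] theorem update_tmp (l) : update (mk i j x z t c o) .tmp l = mk i j x z l c o := by
  funext k; cases k <;> rfl
@[simp] theorem update_cnt (l) : update (mk i j x z t c o) .cnt l = mk i j x z t l o := by
  funext k; cases k <;> rfl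
@[simp] theorem update_out (l) : update (mk i j x z t c o) .out l = mk i j x z t c l := by
  funext k; cases k <;> rfl

theorem mk_nil : mk [] [] [] [] [] [] [] = fun k => ([] : List (TableAlph S B W k)) := by
  funext k; cases k <;> rfl

end

/-- The registers: those of the reader, the last symbol, whether the table is exceeded, and the
last entry. -/
abbrev Reg (S : Signature) (B R : Type) := R × Option (InstSym S) × Bool × Option (Option B)

/-- The internal states. -/
abbrev State (S : Signature) (B R : Type) :=
  Reg S B R × Option (Option (TableSym S B ⊕ Unit))

/-- A reader of symbols and entries. -/
structure Reader (S : Signature) (B R : Type) where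
  see : R → Option B → R
  start : R → S.Symb → R
  read : R → Bool → Option (Option B) → R

/-- The word of a sequence of symbols and numbers. -/
def word (l : List (S.Symb ⊕ ℕ)) : List (InstSym S) :=
  l.flatMap (Sum.elim (fun P => [.inr P]) (InstSym.nat S))

/-- The state of the reader after a symbol or a number. -/
def Reader.step (A : Reader S B R) (z : List (Option B)) (ρ : R) : S.Symb ⊕ ℕ → R
  | .inl P => A.start ρ P
  | .inr k => A.read ρ (decide (z.length < k)) z[k]?

/-- The entries with offset `j` in the first blocks, in reverse order. -/
def blockEntries (N j : ℕ) (f : Option (Option B) → W) : ℕ → List (Option B) → List W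
  | 0, _ => []
  | n + 1, z => blockEntries N j f n (z.drop N) ++ [f z[j]?]

open Frag

variable [Finite B] [Finite R]

instance : Finite (InstSym S) := inferInstanceAs (Finite (Bool ⊕ S.Symb))

instance : Finite (State S B R) := inferInstance

/-- Move entries back to the table. -/
def restore : Frag (TableAlph S B W) (State S B R) :=
  drain .tmp (fun b => .inl (.inr (some b))) fun _ y => match y with
    | .inl (.inr (some b)) => [⟨.val, b⟩]
    | _ => []

theorem runs_restore (ρ : Reg S B R) (y) (i j : List (TableSym S B)) (x : List (InstSym S))
    (z t : List (Option B)) (c : List Unit) (o : List W) :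
    (restore : Frag (TableAlph S B W) (State S B R)).Runs (ρ, y) (mk i j x z t c o) (ρ, none)
      (mk i j x (t.reverse ++ z) [] c o) (5 * t.length + 8) := by
  refine (runs_drain _ ?_).congr rfl rfl rfl ?_ le_rfl
  · rintro ((_ | _ | _) | _) <;> simp
  · simp only [mk_tmp]
    rw [pushAll_flatMap_singleton (Γ := TableAlph S B W)]
    simp

/-- The state between two rounds. -/
def std (ρ : R) (a : Option (InstSym S)) (ovr : Bool) : State S B R := ((ρ, a, ovr, none), none)

open Classical in
/-- The last symbol that was read. -/
noncomputable def tokIs (a : InstSym S) (v : State S B R) : Bool := decide (v.1.2.1 = some a)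

/-- The treatment of a digit. -/
def digit : Frag (TableAlph S B W) (State S B R) :=
  op .val (fun v a => ((v.1.1, v.1.2.1, v.1.2.2.1 || a.isNone, a), none)) fun v =>
    match v.1.2.2.2 with
    | some a => [⟨.tmp, a⟩]
    | none => []

/-- Look at the entry on top of the table. -/
def peek : Frag (TableAlph S B W) (State S B R) :=
  op .val (fun v a => ((v.1.1, v.1.2.1, v.1.2.2.1, a), none)) fun v =>
    match v.1.2.2.2 with
    | some a => [⟨.val, a⟩]
    | none => []

/-- The treatment of a delimiter. -/
def delimiter (A : Reader S B R) : Frag (TableAlph S B W) (State S B R) :=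
  peek.seq (restore.seq (act (fun v =>
    ((A.read v.1.1 v.1.2.2.1 v.1.2.2.2, v.1.2.1, false, none), none)) fun _ => []))

/-- The treatment of a relation symbol. -/
def symbol (A : Reader S B R) : Frag (TableAlph S B W) (State S B R) :=
  act (fun v => match v.1.2.1 with
    | some (.inr P) => ((A.start v.1.1 P, v.1.2), v.2)
    | _ => v) fun _ => []

/-- The treatment of a symbol or digit. -/
noncomputable def dispatch (A : Reader S B R) : Frag (TableAlph S B W) (State S B R) :=
  Frag.ite (tokIs (.inl true)) digit (Frag.ite (tokIs (.inl false)) (delimiter A) (symbol A))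

/-- One round of the reading of the word. -/
noncomputable def round (A : Reader S B R) : Frag (TableAlph S B W) (State S B R) :=
  (op TableStk.wrd (fun v a => ((v.1.1, a, v.1.2.2), none)) fun _ => []).seq
    ((dispatch A).seq
      (act (fun v => std v.1.1 (v.1.2.1.map fun _ => .inl false) v.1.2.2.1) fun _ => []))

/-- The reading of the word. -/
noncomputable def rounds (A : Reader S B R) : Frag (TableAlph S B W) (State S B R) :=
  loop (fun v => v.1.2.1.isSome) (round A)

variable {A : Reader S B R}

theorem runs_rounds_cons {a : InstSym S} {x : List (InstSym S)} {z t z' t' : List (Option B)}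
    {c : List Unit} {o : List W} {ρ ρ' : R} {ovr ovr' : Bool} {res} {m T : ℕ} {v' S'}
    (hd : (dispatch A : Frag (TableAlph S B W) (State S B R)).Runs (std ρ (some a) ovr)
      (mk [] [] x z t c o) ((ρ', some a, ovr', res), none) (mk [] [] x z' t' c o) m)
    (hc : (rounds A : Frag (TableAlph S B W) (State S B R)).Runs (std ρ' (some (.inl false)) ovr')
      (mk [] [] x z' t' c o) v' S' T) :
    (rounds A : Frag (TableAlph S B W) (State S B R)).Runs (std ρ (some (.inl false)) ovr)
      (mk [] [] (a :: x) z t c o) v' S' (T + (m + 5)) :=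
  (Runs.loop_true (Runs.seq (t := 2) (runs_op' (S' := mk [] [] x z t c o) rfl (by simp) le_rfl)
    (hd.seq (runs_act' (v' := std ρ' (some (.inl false)) ovr') (t := 2) rfl rfl le_rfl)))
    rfl hc).mono (by omega)

theorem runs_digit (x : List (InstSym S)) (z t : List (Option B)) (c : List Unit) (o : List W)
    (ρ : R) (ovr : Bool) :
    (dispatch A : Frag (TableAlph S B W) (State S B R)).Runs (std ρ (some (.inl true)) ovr)
      (mk [] [] x z t c o) ((ρ, some (.inl true), ovr || z.head?.isNone, z.head?), none)
      (mk [] [] x z.tail (z.head?.toList ++ t) c o) 3 := by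
  refine Runs.ite_true (t := 2) (runs_op' rfl ?_ le_rfl) ?_
  · cases z <;> simp
  · simp [tokIs, std]

theorem runs_delimiter (x : List (InstSym S)) (z t : List (Option B)) (c : List Unit) (o : List W)
    (ρ : R) (ovr : Bool) :
    (dispatch A : Frag (TableAlph S B W) (State S B R)).Runs (std ρ (some (.inl false)) ovr)
      (mk [] [] x z t c o) ((A.read ρ ovr z.head?, some (.inl false), false, none), none)
      (mk [] [] x (t.reverse ++ z) [] c o) (5 * t.length + 14) := by
  have hp : (peek : Frag (TableAlph S B W) (State S B R)).Runs (std ρ (some (.inl false)) ovr)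
      (mk [] [] x z t c o) ((ρ, some (.inl false), ovr, z.head?), none) (mk [] [] x z t c o) 2 := by
    refine runs_op' rfl ?_ le_rfl
    cases z <;> simp
  refine Runs.ite_false (Runs.ite_true ((hp.seq ((runs_restore _ none _ _ _ _ _ _ _).seq
    (runs_act' (t := 2) rfl rfl le_rfl))).mono (by omega)) ?_) ?_
  · simp [tokIs, std]
  · simp [tokIs, std]

theorem runs_symbol (P : S.Symb) (x : List (InstSym S)) (z t : List (Option B)) (c : List Unit)
    (o : List W) (ρ : R) (ovr : Bool) :
    (dispatch A : Frag (TableAlph S B W) (State S B R)).Runs (std ρ (some (.inr P)) ovr)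
      (mk [] [] x z t c o) ((A.start ρ P, some (.inr P), ovr, none), none)
      (mk [] [] x z t c o) 4 := by
  refine Runs.ite_false (Runs.ite_false (t := 2) (runs_act' rfl rfl le_rfl) ?_) ?_
  · simp [tokIs, std]
  · simp [tokIs, std]

theorem runs_digits (k : ℕ) {x : List (InstSym S)} {z t : List (Option B)}
    {c : List Unit} {o : List W} {ρ : R} {ovr : Bool} {T : ℕ} {v' S'}
    (hc : (rounds A : Frag (TableAlph S B W) (State S B R)).Runs
      (std ρ (some (.inl false)) (ovr || decide (z.length < k)))
      (mk [] [] x (z.drop k) ((z.take k).reverse ++ t) c o) v' S' T) :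
    (rounds A : Frag (TableAlph S B W) (State S B R)).Runs (std ρ (some (.inl false)) ovr)
      (mk [] [] (List.replicate k (.inl true) ++ x) z t c o) v' S' (T + 10 * k) := by
  induction k generalizing z t ovr with
  | zero => exact hc.congr (by simp) (by simp) rfl rfl (by omega)
  | succ k ih =>
    refine (runs_rounds_cons (runs_digit _ _ _ _ _ _ _)
      (ih (hc.congr ?_ ?_ rfl rfl le_rfl))).mono (by omega)
    · cases z <;> (simp; try congr)
    · cases z <;> simp

/-- If `k` is the length of the table, then no entry is left although no removal failed. The reader
is told both facts, so it can test for exactly this length. -/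
theorem runs_number (k : ℕ) {x : List (InstSym S)} {z : List (Option B)}
    {c : List Unit} {o : List W} {ρ : R} {T : ℕ} {v' S'}
    (hc : (rounds A : Frag (TableAlph S B W) (State S B R)).Runs
      (std (A.read ρ (decide (z.length < k)) z[k]?) (some (.inl false)) false)
      (mk [] [] x z [] c o) v' S' T) :
    (rounds A : Frag (TableAlph S B W) (State S B R)).Runs (std ρ (some (.inl false)) false)
      (mk [] [] (InstSym.nat S k ++ x) z [] c o) v' S' (T + 20 * (k + 1)) := by
  unfold InstSym.nat
  rw [List.append_assoc]
  refine (runs_digits k (runs_rounds_cons (runs_delimiter _ _ _ _ _ _ _)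
    (hc.congr ?_ ?_ rfl rfl le_rfl))).mono ?_
  · simp [List.head?_drop]
  · simp
  · have : ((z.take k).reverse ++ []).length ≤ k := by simp
    omega

theorem runs_rounds (l : List (S.Symb ⊕ ℕ)) {z : List (Option B)}
    {c : List Unit} {o : List W} {ρ : R} :
    (rounds A : Frag (TableAlph S B W) (State S B R)).Runs (std ρ (some (.inl false)) false)
      (mk [] [] (word l) z [] c o) (std (l.foldl (A.step z) ρ) none false)
      (mk [] [] [] z [] c o) (10 + 20 * (word l).length) := by
  induction l generalizing ρ with
  | nil =>
    refine Runs.loop_true (t := 8) (t' := 1) (Runs.seq (t := 2) (t' := 6)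
      (runs_op' (v' := std ρ none false) (S' := mk [] [] [] z [] c o) rfl (by simp [word]) le_rfl)
      (Runs.seq (t := 4) (t' := 2) (((runs_act' (t := 2) rfl rfl le_rfl).ite_false ?_).ite_false
      ?_) (runs_act' rfl rfl le_rfl))) rfl (runs_loop_false rfl _)
    · simp [tokIs, std]
    · simp [tokIs, std]
  | cons a l ih =>
    cases a with
    | inl P =>
      refine (runs_rounds_cons (runs_symbol P _ _ _ _ _ _ _) (ih (ρ := A.start ρ P))).mono ?_
      simp [word]
      omega
    | inr k =>
      refine (runs_number k (ih (ρ := A.read ρ (decide (z.length < k)) z[k]?))).congr rfl ?_ rfl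
        rfl ?_
      · simp [word]
      · simp [word, InstSym.nat]
        omega

end Table
end MinionPattern

/-! ### Inspecting a table, extracting its entries, and the complete table machine -/

namespace MinionPattern

open Turing Function

variable {S : Signature} {B W R : Type}

namespace Table

open Frag

variable [Finite B] [Finite R]

/-- Distribute the input to the stacks. -/
def distribute : Frag (TableAlph S B W) (State S B R) :=
  (drain .inp .inl fun _ y => match y with
    | .inl a => [⟨.rest, a⟩]
    | _ => []).seq
  (drain .rest .inl fun _ y => match y with
    | .inl (.inl a) => [⟨.wrd, a⟩]
    | .inl (.inr none) => [⟨.cnt, ()⟩]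
    | .inl (.inr (some b)) => [⟨.val, b⟩]
    | _ => [])

theorem runs_distribute (ρ : Reg S B R) (y) (x : List (InstSym S)) (n : ℕ)
    (z : List (Option B)) :
    (distribute : Frag (TableAlph S B W) (State S B R)).Runs (ρ, y)
      (mk (x.map .inl ++ (List.replicate n none ++ z.map some).map .inr) [] [] [] [] [] [])
      (ρ, none) (mk [] [] x z [] (List.replicate n ()) [])
      (10 * (x.length + n + z.length) + 16) := by
  refine ((Runs.congr (T' := mk [] (x.map .inl ++ (List.replicate n none ++
    z.map some).map .inr).reverse [] [] [] [] [])
    (runs_drain _ ?_) rfl rfl rfl ?_ le_rfl).seq (runs_drain _ ?_)).congr rfl rfl rfl ?_ ?_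
  · rintro (_ | _) <;> simp
  · simp only [mk_inp]
    rw [pushAll_flatMap_singleton (Γ := TableAlph S B W)]
    simp
    rfl
  · rintro ((_ | _ | _) | _) <;> simp
  · simp only [mk_rest, List.map_append, List.reverse_append, List.flatMap_append, pushAll_append,
      ← List.map_reverse, List.flatMap_map, List.reverse_replicate, List.map_map]
    rw [pushAll_flatMap_singleton (Γ := TableAlph S B W), List.flatMap_replicate,
      List.flatten_replicate_singleton, pushAll_replicate]
    erw [pushAll_flatMap_singleton (Γ := TableAlph S B W)]
    simp
  · simp
    omega

/-- Show the table to the reader. -/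
def inspect (A : Reader S B R) : Frag (TableAlph S B W) (State S B R) :=
  (scan .val (fun b => .inl (.inr (some b))) (fun ρ y => match y with
      | .inl (.inr (some b)) => (A.see ρ.1 b, ρ.2)
      | _ => ρ) (fun _ _ => false) fun _ y => match y with
      | .inl (.inr (some b)) => [⟨.tmp, b⟩]
      | _ => []).seq restore

theorem runs_inspect (A : Reader S B R) (ρ : R) (σ) (y) (x : List (InstSym S))
    (z : List (Option B)) (c : List Unit) :
    (inspect A : Frag (TableAlph S B W) (State S B R)).Runs ((ρ, σ), y)
      (mk [] [] x z [] c []) ((z.foldl A.see ρ, σ), none) (mk [] [] x z [] c [])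
      (10 * z.length + 16) := by
  have hf : ∀ ρ, (z.foldl (fun (ρ : Reg S B R) b => (A.see ρ.1 b, ρ.2)) (ρ, σ)) =
      (z.foldl A.see ρ, σ) := by
    induction z with
    | nil => exact fun ρ => rfl
    | cons b z ih => exact fun ρ => ih _
  refine ((Runs.congr (T' := mk [] [] x [] z.reverse c [])
    (runs_sweep (w' := fun b => [⟨.tmp, b⟩]) (fun _ _ => rfl) ?_ _) rfl rfl (congrArg (·, none) (hf ρ)) ?_
    le_rfl).seq (runs_restore _ none _ _ _ _ _ _ _)).congr rfl rfl rfl ?_ ?_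
  · simp
  · simp only [mk_val]
    rw [pushAll_flatMap_singleton (Γ := TableAlph S B W)]
    simp
  · simp
  · simp
    omega

/-- Remove an entry from the table, and remember it if it is the right one. -/
def pop (j i : ℕ) : Frag (TableAlph S B W) (State S B R) :=
  op .val (fun v a => if i = j then ((v.1.1, v.1.2.1, v.1.2.2.1, a), v.2) else v) fun _ => []

section

variable (i i' : List (TableSym S B)) (x : List (InstSym S)) (z t : List (Option B))
    (c : List Unit) (o : List W)

theorem runs_pop_eq (j : ℕ) (ρ : R) (tok ovr res y) :
    (pop j j : Frag (TableAlph S B W) (State S B R)).Runs ((ρ, tok, ovr, res), y)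
      (mk i i' x z t c o) ((ρ, tok, ovr, z.head?), y) (mk i i' x z.tail t c o) 2 :=
  runs_op' (if_pos rfl) (by simp) le_rfl

theorem runs_pop_ne {j k : ℕ} (hj : k ≠ j) (v : State S B R) :
    (pop j k : Frag (TableAlph S B W) (State S B R)).Runs v
      (mk i i' x z t c o) v (mk i i' x z.tail t c o) 2 :=
  runs_op' (if_neg hj) (by simp) le_rfl

end

/-- Remove one block from the table, and remember one entry. -/
def pops (j : ℕ) (l : List ℕ) : Frag (TableAlph S B W) (State S B R) :=
  Conv.seqList (l.map (pop j))

theorem runs_pops_ne {j : ℕ} (l : List ℕ) (hl : j ∉ l) (v : State S B R)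
    (i i' : List (TableSym S B)) (x : List (InstSym S)) (z t : List (Option B)) (c : List Unit)
    (o : List W) :
    (pops j l : Frag (TableAlph S B W) (State S B R)).Runs v (mk i i' x z t c o) v
      (mk i i' x (z.drop l.length) t c o) (2 * l.length + 1) := by
  induction l generalizing z with
  | nil => exact (runs_skip _ _).congr rfl rfl rfl (by simp) (by simp)
  | cons b l ih =>
    simp only [List.mem_cons, not_or] at hl
    refine ((runs_pop_ne i i' x z t c o (Ne.symm hl.1) v).seq (ih hl.2 z.tail)).congr rfl rfl rfl
      ?_ ?_
    · simp
    · simp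
      omega

theorem runs_pops {j N : ℕ} (hj : j < N) (ρ : R) (tok ovr res y)
    (i i' : List (TableSym S B)) (x : List (InstSym S)) (z t : List (Option B)) (c : List Unit)
    (o : List W) :
    (pops j (List.range N) : Frag (TableAlph S B W) (State S B R)).Runs ((ρ, tok, ovr, res), y)
      (mk i i' x z t c o) ((ρ, tok, ovr, z[j]?), y) (mk i i' x (z.drop N) t c o) (2 * N + 1) := by
  -- The induction treats the end segments of a block, `s` being the offset at which the segment
  -- starts.
  suffices H : ∀ (m s : ℕ) (z : List (Option B)) (res), s ≤ j → j < s + m →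
      (pops j (List.range' s m) : Frag (TableAlph S B W) (State S B R)).Runs
      ((ρ, tok, ovr, res), y) (mk i i' x z t c o) ((ρ, tok, ovr, z[j - s]?), y)
      (mk i i' x (z.drop m) t c o) (2 * m + 1) by
    have := H N 0 z res (Nat.zero_le _) (by omega)
    rwa [← List.range_eq_range'] at this
  intro m
  induction m with
  | zero => intro s z res h₁ h₂; omega
  | succ m ih =>
    intro s z res h₁ h₂
    rw [List.range'_succ]
    rcases eq_or_lt_of_le h₁ with rfl | h₁
    · refine ((runs_pop_eq i i' x z t c o s ρ tok ovr res y).seq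
        (runs_pops_ne (List.range' (s + 1) m) ?_ _ i i' x z.tail t c o)).congr rfl rfl ?_ ?_ ?_
      · simp
      · simp [List.head?_eq_getElem?]
      · simp
      · simp
        omega
    · refine ((runs_pop_ne i i' x z t c o h₁.ne _).seq
        (ih (s + 1) z.tail res h₁ (by omega))).congr rfl rfl ?_ ?_ ?_
      · obtain ⟨d, rfl⟩ := Nat.exists_eq_add_of_lt h₁
        have e₁ : s + d + 1 - (s + 1) = d := by omega
        have e₂ : s + d + 1 - s = d + 1 := by omega
        rw [e₁, e₂]
        cases z <;> simp
      · simp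
      · omega

/-- Write the entry that belongs to one block. -/
def emitBlock (N j : ℕ) (f : Option (Option B) → W) : Frag (TableAlph S B W) (State S B R) :=
  (pops j (List.range N)).seq (act id fun v => [⟨.out, f v.1.2.2.2⟩])

/-- Remove a mark of a block. -/
def nextBlock : Frag (TableAlph S B W) (State S B R) :=
  op .cnt (fun v a => (v.1, a.map fun _ => none)) fun _ => []

theorem runs_emitBlock {j N : ℕ} (hj : j < N) (f : Option (Option B) → W) (ρ : R)
    (tok ovr res y) (i i' : List (TableSym S B)) (x : List (InstSym S)) (z t : List (Option B))
    (c : List Unit) (o : List W) :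
    (emitBlock N j f : Frag (TableAlph S B W) (State S B R)).Runs ((ρ, tok, ovr, res), y)
      (mk i i' x z t c o) ((ρ, tok, ovr, z[j]?), y) (mk i i' x (z.drop N) t c (f z[j]? :: o))
      (2 * N + 3) :=
  ((runs_pops hj ρ tok ovr res y i i' x z t c o).seq
    (runs_act' (t := 2) rfl rfl le_rfl)).congr rfl rfl rfl (by simp) (by omega)

theorem runs_nextBlock (ρ : Reg S B R) (y) (i i' : List (TableSym S B)) (x : List (InstSym S))
    (z t : List (Option B)) (c : List Unit) (o : List W) :
    (nextBlock : Frag (TableAlph S B W) (State S B R)).Runs (ρ, y) (mk i i' x z t c o)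
      (ρ, c.head?.map fun _ => none) (mk i i' x z t c.tail o) 2 :=
  runs_op' rfl (by simp) le_rfl

/-- Write the entries that belong to the blocks. -/
def emitBlocks (N j : ℕ) (f : Option (Option B) → W) : Frag (TableAlph S B W) (State S B R) :=
  (act (fun v => (v.1, some none)) fun _ => []).seq
    (loop (fun v => v.2.isSome)
      (nextBlock.seq (Frag.ite (fun v => v.2.isSome) (emitBlock N j f) skip)))

theorem runs_emitBlocks {j N : ℕ} (hj : j < N) (f : Option (Option B) → W) (ρ : R)
    (tok ovr res y) (x : List (InstSym S)) (z t : List (Option B)) (n : ℕ) :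
    ∃ res', (emitBlocks N j f : Frag (TableAlph S B W) (State S B R)).Runs
      ((ρ, tok, ovr, res), y) (mk [] [] x z t (List.replicate n ()) [])
      ((ρ, tok, ovr, res'), none) (mk [] [] x (z.drop (n * N)) t [] (blockEntries N j f n z))
      (n * (2 * N + 7) + 8) := by
  suffices H : ∀ (n : ℕ) (z : List (Option B)) (o : List W) (res), ∃ res',
      (loop (fun v => v.2.isSome)
      (nextBlock.seq (Frag.ite (fun v => v.2.isSome) (emitBlock N j f) skip)) :
        Frag (TableAlph S B W) (State S B R)).Runs
      ((ρ, tok, ovr, res), some none) (mk [] [] x z t (List.replicate n ()) o)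
      ((ρ, tok, ovr, res'), none) (mk [] [] x (z.drop (n * N)) t [] (blockEntries N j f n z ++ o))
      (n * (2 * N + 7) + 6) by
    obtain ⟨res', hr⟩ := H n z [] res
    refine ⟨res', ((runs_act' (t := 2) rfl rfl le_rfl).seq hr).congr rfl rfl rfl ?_ ?_⟩
    · simp
    · omega
  intro n
  induction n with
  | zero =>
    intro z o res
    refine ⟨res, (Runs.loop_true (t := 4) (t' := 1) ((runs_nextBlock _ _ [] [] x z t [] o).seq
      (Runs.ite_false (runs_skip _ _) rfl)) rfl (runs_loop_false rfl _)).congr rfl rfl rfl ?_ ?_⟩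
    · simp [blockEntries]
    · simp
  | succ n ih =>
    intro z o res
    obtain ⟨res', hr⟩ := ih (z.drop N) (f z[j]? :: o) z[j]?
    refine ⟨res', (Runs.loop_true ((runs_nextBlock _ _ [] [] x z t _ o).seq
      (Runs.ite_true (runs_emitBlock hj f ρ tok ovr res _ [] [] x z t _ o) rfl)) rfl
      hr).congr rfl rfl rfl ?_ ?_⟩
    · simp [blockEntries, add_mul, add_comm]
    · simp only [add_mul]
      omega

/-- Empty the table and the stack of marks. -/
def clear : Frag (TableAlph S B W) (State S B R) :=
  (drain .val (fun _ => .inr ()) fun _ _ => []).seq (drain .cnt (fun _ => .inr ()) fun _ _ => [])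

theorem runs_clear (ρ : Reg S B R) (y) (z : List (Option B)) (c : List Unit) (o : List W) :
    (clear : Frag (TableAlph S B W) (State S B R)).Runs (ρ, y)
      (mk [] [] [] z [] c o) (ρ, none) (mk [] [] [] [] [] [] o)
      (5 * z.length + 5 * c.length + 16) := by
  have hf : ∀ {A : Type} (l : List A),
      (l.flatMap fun _ => ([] : List (Σ k, TableAlph S B W k))) = [] := by
    simp
  refine ((Runs.congr (T' := mk [] [] [] [] [] c o) (runs_drain _ (by simp)) rfl rfl rfl ?_
    le_rfl).seq (runs_drain _ (by simp))).congr rfl rfl rfl ?_ ?_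
  · rw [hf]
    simp
  · rw [hf]
    simp
  · simp
    omega

/-- The whole machine. -/
noncomputable def machine (A : Reader S B R) (good : R → Bool) (ρ₀ : R) (N j : ℕ)
    (f : Option (Option B) → W) (w₀ : W) : Frag (TableAlph S B W) (State S B R) :=
  distribute.seq ((inspect A).seq ((rounds A).seq ((Frag.ite (fun v => good v.1.1)
    ((emitBlocks N j f).seq clear)
    (clear.seq (act id fun _ => [⟨.out, w₀⟩]))).seq
    (act (fun _ => std ρ₀ (some (.inl false)) false) fun _ => []))))

/-- The table is walked through anew for every number. As numbers are unary, each walk is paid for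
by the digits of its number, and the total time is linear. -/
theorem polyTime_table (A : Reader S B R) (good : R → Bool) (ρ₀ : R) {N j : ℕ} (hj : j < N)
    (f : Option (Option B) → W) (w₀ : W) :
    PolyTime (fun p : List (S.Symb ⊕ ℕ) × ℕ × List (Option B) =>
        withSide word (p.1, List.replicate p.2.1 none ++ p.2.2.map some))
      id (fun p => if good (p.1.foldl (A.step p.2.2) (p.2.2.foldl A.see ρ₀)) then
        blockEntries N j f p.2.1 p.2.2 else [w₀]) := by
  have : Finite (TableAlph S B W .inp) := inferInstanceAs (Finite (TableSym S B))
  refine polyTime_of_frag_refl (Γ := TableAlph S B W) TableStk.inp TableStk.out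
    (machine A good ρ₀ N j f w₀) (std ρ₀ (some (.inl false)) false)
    (.C (50 + 2 * N) * .X + .C 100) fun ⟨l, n, z⟩ => ?_
  have hm : ∀ ρ : R, ∃ v',
      (Frag.ite (fun v => good v.1.1) ((emitBlocks N j f).seq clear)
        (clear.seq (act id fun _ => [⟨.out, w₀⟩])) :
        Frag (TableAlph S B W) (State S B R)).Runs (std ρ none false)
        (mk [] [] [] z [] (List.replicate n ()) []) v'
        (mk [] [] [] [] [] [] (if good ρ then blockEntries N j f n z else [w₀]))
        (n * (2 * N + 7) + 5 * z.length + 5 * n + 30) := by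
    intro ρ
    cases hg : good ρ with
    | true =>
      obtain ⟨res', hr⟩ := runs_emitBlocks (S := S) hj f ρ none false none none [] z [] n
      refine ⟨_, (Runs.ite_true (hr.seq (runs_clear _ none _ [] _)) hg).congr rfl rfl rfl
        (by simp) ?_⟩
      simp
      omega
    | false =>
      refine ⟨_, (Runs.ite_false ((runs_clear _ none z (List.replicate n ()) []).seq
        (runs_act' (t := 2) rfl (by simp; rfl) le_rfl)) hg).congr rfl rfl rfl (by simp) ?_⟩
      simp
      omega
  have h₁ := runs_distribute (W := W) ((ρ₀, some (.inl false), false, none) : Reg S B R) none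
    (word l) n z
  have h₂ := runs_inspect (W := W) A ρ₀ (some (.inl false), false, none) none (word l) z
    (List.replicate n ())
  have h₃ := runs_rounds (W := W) (A := A) l (z := z) (c := List.replicate n ()) (o := [])
    (ρ := z.foldl A.see ρ₀)
  obtain ⟨v', h₄⟩ := hm (l.foldl (A.step z) (z.foldl A.see ρ₀))
  refine (h₁.seq (h₂.seq (h₃.seq (h₄.seq (runs_act' (t := 2) rfl rfl le_rfl))))).congr rfl ?_ rfl
    ?_ ?_
  · rw [← mk_nil, update_inp]
    rfl
  · rw [← mk_nil, update_out]
    rfl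
  · have : (withSide word (l, List.replicate n none ++ z.map some)).length =
        (word l).length + (n + z.length) := by
      simp [withSide]
    simp only [this, Polynomial.eval_add, Polynomial.eval_mul, Polynomial.eval_C,
      Polynomial.eval_X]
    ring_nf
    nlinarith

end Table
end MinionPattern

namespace MinionPattern

open Turing Function

variable {S : Signature}

/-! ### Checking a homomorphism -/

/-- The registers of the check: whether no error was found, and the part of a fact read so far. -/
abbrev CheckReg (S : Signature) (B : Type) :=
  Bool × Option ((P : S.Symb) × {l : List (Option B) // l.length ≤ S.ar P})

instance (B : Type) [Finite B] : Finite (CheckReg S B) := by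
  have : ∀ P : S.Symb, Finite {l : List (Option B) // l.length ≤ S.ar P} := fun P =>
    List.finite_length_le (Option B) _
  infer_instance

open Classical in
/-- The reader that checks whether a table is a homomorphism. -/
noncomputable def checkReader (B : RelStr.{0} S) :
    Table.Reader S B.carrier (CheckReg S B.carrier) where
  see ρ a := (ρ.1 && a.isSome, ρ.2)
  start ρ P := (ρ.1, some ⟨P, [], Nat.zero_le _⟩)
  read ρ ovr a := match ρ.2 with
    | none => (ρ.1 && (!ovr && a.isNone), none)
    | some l => if hl : (l.2.1 ++ [a.join]).length ≤ S.ar l.1 then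
        (ρ.1 && decide ((l.2.1 ++ [a.join]).length = S.ar l.1 →
          ∃ b ∈ B.rel l.1, l.2.1 ++ [a.join] = List.ofFn (some ∘ b)), some ⟨l.1, _, hl⟩)
      else ρ

/-- The symbols and numbers in the word of an instance. -/
def Instance.tokens (X : Instance S) : List (S.Symb ⊕ ℕ) :=
  .inr X.size :: X.facts.flatMap fun a => .inl a.1 :: List.ofFn fun i => .inr (a.2 i : ℕ)

theorem Instance.word_tokens (X : Instance S) : Table.word X.tokens = X.encode := by
  unfold Table.word Instance.tokens Instance.encode
  rw [List.flatMap_cons, List.flatMap_assoc]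
  congr 2
  funext a
  simp [List.ofFn_eq_map, List.flatMap_map]

theorem checkReader_see (B : RelStr.{0} S) (z : List (Option B.carrier)) (ok : Bool) :
    z.foldl (checkReader B).see (ok, none) = (ok && z.all Option.isSome, none) := by
  induction z generalizing ok with
  | nil => simp
  | cons a z ih =>
    rw [List.foldl_cons]
    refine (ih _).trans ?_
    simp [Bool.and_assoc]

open Classical in
-- A tuple is tested when its last value arrives; before that the test is vacuous, the list being
-- too short. A fact without values would never be tested, hence `hks`.
theorem checkReader_numbers (B : RelStr.{0} S) (z : List (Option B.carrier)) {P : S.Symb}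
    (ks : List ℕ) (hks : ks ≠ []) (l : List (Option B.carrier)) (hl : l.length ≤ S.ar P)
    (he : l.length + ks.length = S.ar P) (ok : Bool) :
    ((ks.map Sum.inr).foldl ((checkReader B).step z) (ok, some ⟨P, l, hl⟩)).1 =
      (ok && decide (∃ b ∈ B.rel P, l ++ ks.map (fun k => z[k]?.join) = List.ofFn (some ∘ b))) := by
  induction ks generalizing l ok with
  | nil => exact absurd rfl hks
  | cons k ks ih =>
    have hl' : (l ++ [z[k]?.join]).length ≤ S.ar P := by
      simp at he ⊢
      omega
    have hs : (checkReader B).step z (ok, some ⟨P, l, hl⟩) (.inr k) =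
        (ok && decide ((l ++ [z[k]?.join]).length = S.ar P →
          ∃ b ∈ B.rel P, l ++ [z[k]?.join] = List.ofFn (some ∘ b)), some ⟨P, _, hl'⟩) :=
      dif_pos hl'
    rw [List.map_cons, List.foldl_cons, hs]
    by_cases hk : ks = []
    · subst hk
      have : (l ++ [z[k]?.join]).length = S.ar P := by simpa using he
      simp only [this, true_imp_iff, List.map_nil, List.foldl_nil, List.map_cons]
    · have hn : ¬ (l ++ [z[k]?.join]).length = S.ar P := by
        have := List.length_pos_of_ne_nil hk
        simp at he ⊢
        omega
      rw [ih hk _ hl' (by simp at he ⊢; omega)]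
      have ht : decide ((l ++ [z[k]?.join]).length = S.ar P →
          ∃ b ∈ B.rel P, l ++ [z[k]?.join] = List.ofFn (some ∘ b)) = true :=
        decide_eq_true fun h => absurd h hn
      rw [ht]
      simp

/-- The values of a table at a fact form a tuple of the relation. -/
def FactHolds (B : RelStr.{0} S) (z : List (Option B.carrier)) {n : ℕ}
    (a : (P : S.Symb) × (Fin (S.ar P) → Fin n)) : Prop :=
  ∃ b ∈ B.rel a.1, (List.ofFn fun i => z[(a.2 i : ℕ)]?.join) = List.ofFn (some ∘ b)

open Classical in
-- A relation symbol discards whatever was collected before, so only the error flag passes from one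
-- fact to the next. Positive arities ensure that each fact is tested.
theorem checkReader_facts (B : RelStr.{0} S) (z : List (Option B.carrier)) {n : ℕ}
    (l : List ((P : S.Symb) × (Fin (S.ar P) → Fin n))) (ρ : CheckReg S B.carrier) :
    ((l.flatMap fun a => .inl a.1 :: List.ofFn fun i => .inr (a.2 i : ℕ)).foldl
      ((checkReader B).step z) ρ).1 = (ρ.1 && decide (∀ a ∈ l, FactHolds B z a)) := by
  induction l generalizing ρ with
  | nil => simp
  | cons a l ih =>
    have h₁ := checkReader_numbers B z (P := a.1) (List.ofFn fun i => (a.2 i : ℕ)) (by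
      have := S.ar_pos a.1
      intro h
      simp at h
      omega) [] (Nat.zero_le _) (by simp) ρ.1
    rw [List.flatMap_cons, List.foldl_append, ih, List.foldl_cons]
    have h₂ : (List.ofFn fun i => (a.2 i : ℕ)).map Sum.inr =
        List.ofFn fun i => (Sum.inr (a.2 i : ℕ) : S.Symb ⊕ ℕ) := by
      rw [List.map_ofFn]
      rfl
    rw [h₂, List.nil_append, List.map_ofFn] at h₁
    change _ = (ρ.1 && decide (FactHolds B z a)) at h₁
    refine (congrArg (· && decide (∀ a ∈ l, FactHolds B z a)) h₁).trans ?_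
    simp [Bool.and_assoc, Bool.decide_and]

/-- The size is the only number read before any symbol. The absence of overflow says that the table
is long enough, and the missing entry at this place that it is not longer. -/
theorem checkReader_tokens (B : RelStr.{0} S) (z : List (Option B.carrier)) (X : Instance S) :
    (X.tokens.foldl ((checkReader B).step z) (z.foldl (checkReader B).see (true, none))).1 = true ↔
      (∀ a ∈ z, a.isSome) ∧ z.length = X.size ∧ ∀ a ∈ X.facts, FactHolds B z a := by
  rw [checkReader_see]
  unfold Instance.tokens
  rw [List.foldl_cons, checkReader_facts]
  simp [Table.Reader.step, checkReader, and_assoc]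
  intro _
  rw [← and_assoc]
  refine and_congr_left fun _ => ?_
  omega

theorem checkReader_tokens_iff (B : RelStr.{0} S) (z : List (Option B.carrier)) (X : Instance S) :
    (X.tokens.foldl ((checkReader B).step z) (z.foldl (checkReader B).see (true, none))).1 = true ↔
      ∃ F : Fin X.size → B.carrier, IsHom X.toStr B F ∧ z = encodeMap F := by
  rw [checkReader_tokens]
  have key : ∀ (F : Fin X.size → B.carrier) (a : (P : S.Symb) × (Fin (S.ar P) → Fin X.size)),
      FactHolds B (encodeMap F) a ↔ F ∘ a.2 ∈ B.rel a.1 := by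
    intro F a
    have : (List.ofFn fun i => (encodeMap F)[(a.2 i : ℕ)]?.join) =
        List.ofFn (some ∘ F ∘ a.2) := by
      congr 1
      funext i
      simp [encodeMap]
    unfold FactHolds
    rw [this]
    constructor
    · rintro ⟨b, hb, he⟩
      have h₁ := List.ofFn_injective he
      have h₂ : F ∘ a.2 = b := by
        funext i
        exact Option.some.inj (congrFun h₁ i)
      rwa [h₂]
    · exact fun h => ⟨_, h, rfl⟩
  constructor
  · rintro ⟨h₁, h₂, h₃⟩
    have h₄ : ∀ i : Fin X.size, ∃ b, z[(i : ℕ)]? = some (some b) := by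
      intro i
      have hi : (i : ℕ) < z.length := by omega
      obtain ⟨b, hb⟩ := Option.isSome_iff_exists.1 (h₁ _ (List.getElem_mem hi))
      exact ⟨b, by rw [List.getElem?_eq_getElem hi, hb]⟩
    choose F hF using h₄
    have hz : z = encodeMap F := by
      refine List.ext_getElem? fun i => ?_
      by_cases hi : i < X.size
      · rw [hF ⟨i, hi⟩]
        simp [encodeMap, hi]
      · rw [List.getElem?_eq_none (by omega), List.getElem?_eq_none (by simp [encodeMap]; omega)]
    refine ⟨F, fun R t ht => ?_, hz⟩
    rw [hz] at h₃
    exact (key F ⟨R, t⟩).1 (h₃ _ ht)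
  · rintro ⟨F, hF, rfl⟩
    refine ⟨?_, by simp [encodeMap], fun a ha => (key F a).2 (hF a.1 a.2 ha)⟩
    intro a ha
    obtain ⟨i, rfl⟩ := (List.mem_ofFn' _ _).1 ha
    rfl

open Classical in
theorem polyTime_checkHom (B : RelStr.{0} S) [Finite B.carrier] {W : Type} {N j : ℕ} (hj : j < N)
    (f : Option (Option B.carrier) → W) (w₀ : W) :
    PolyTime (fun p : Instance S × ℕ × List (Option B.carrier) =>
        withSide Instance.encode (p.1, List.replicate p.2.1 none ++ p.2.2.map some))
      id (fun p => if ∃ F : Fin p.1.size → B.carrier, IsHom p.1.toStr B F ∧ p.2.2 = encodeMap F then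
        Table.blockEntries N j f p.2.1 p.2.2 else [w₀]) := by
  refine (Table.polyTime_table (checkReader B) Prod.fst (true, none) hj f w₀).reindex
    (fun p => (p.1.tokens, p.2)) (fun p => ?_) (fun p => ?_)
  · simp only [withSide, Instance.word_tokens]
  · exact if_congr (checkReader_tokens_iff B p.2.2 p.1).symm rfl rfl

/-- The output is a stack, so the first block is written last. The variable `x_v` also has number `n
- 1 - v`, and the two reversals cancel. -/
theorem Table.blockEntries_eq_ofFn {B W : Type} (N j : ℕ) (f : Option (Option B) → W) (n : ℕ)
    (z : List (Option B)) :
    Table.blockEntries N j f n z = List.ofFn fun v : Fin n => f z[(n - 1 - v) * N + j]? := by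
  induction n generalizing z with
  | zero => rfl
  | succ n ih =>
    rw [Table.blockEntries, ih, List.ofFn_succ_last]
    simp only [List.getElem?_drop, Fin.val_last, Fin.val_castSucc]
    congr 2
    · funext v
      congr 2
      have e : n + 1 - 1 - v = (n - 1 - v) + 1 := by omega
      rw [e, add_mul]
      omega
    · simp

end MinionPattern

namespace MinionPattern

open Turing Function

variable {S : Signature}

/-! ### Compactness -/

/-- Every finite induced substructure of `A` maps to `G` and hence to `T`. As `T` is finite, Rado's
selection lemma glues these maps: on each finite set the result agrees with the map chosen for some
larger finite set. One tuple involves only finitely many elements. -/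
theorem FinitelyEquivalent.homTo {A : RelStr.{u} S} {G : RelStr.{v} S}
    (hG : FinitelyEquivalent A G) {T : RelStr.{0} S} [Finite T.carrier] (hT : HomTo G T) :
    HomTo A T := by
  classical
  obtain ⟨F, hF⟩ := hT
  have key : ∀ s : Finset A.carrier, ∃ φ : s → T.carrier,
      ∀ (R : S.Symb) (t : Fin (S.ar R) → s), (fun i => (t i).1) ∈ A.rel R → φ ∘ t ∈ T.rel R := by
    intro s
    let X : RelStr.{0} S := ⟨Fin s.card, fun R => {t | (fun i => (s.equivFin.symm (t i)).1) ∈ A.rel R}⟩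
    have hX : HomTo X A := ⟨fun i => (s.equivFin.symm i).1, fun R t ht => ht⟩
    obtain ⟨K, hK⟩ := (hG X (inferInstanceAs (Finite (Fin _)))).1 hX
    refine ⟨fun x => F (K (s.equivFin x)), fun R t ht => ?_⟩
    refine hF R _ (hK R (fun i => s.equivFin (t i)) ?_)
    change (fun i => (s.equivFin.symm (s.equivFin (t i))).1) ∈ A.rel R
    simpa using ht
  choose g hg using key
  obtain ⟨χ, hχ⟩ := Finset.rado_selection_subtype (β := fun _ => T.carrier) g
  refine ⟨χ, fun R t ht => ?_⟩
  obtain ⟨s, hs, he⟩ := hχ (Finset.univ.image t)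
  have ht' : ∀ i, t i ∈ Finset.univ.image t := fun i => Finset.mem_image_of_mem _ (Finset.mem_univ i)
  have : χ ∘ t = g s ∘ fun i => ⟨t i, hs (ht' i)⟩ := by
    funext i
    exact he ⟨t i, ht' i⟩
  rw [this]
  exact hg s R _ ht

/-! ### Quotients by finer descriptions -/

variable {M : Minion.{u}}

theorem toQuot_eq_iff {D : Description M} {n : ℕ+} {f g : M.obj n} :
    M.toQuot D f = M.toQuot D g ↔
      ∀ P ∈ D, ∀ π : Fin n → Fin P.ar, M.minor π f ∈ P.carrier ↔ M.minor π g ∈ P.carrier :=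
  Quotient.eq (r := D.setoid n)

theorem exists_toQuot_eq (D : Description M) {n : ℕ+} (q : (M.quot D).obj n) :
    ∃ f, M.toQuot D f = q :=
  Quotient.exists_rep (s := D.setoid n) q

theorem minor_toQuot (D : Description M) {n m : ℕ+} (π : Fin n → Fin m) (f : M.obj n) :
    (M.quot D).minor π (M.toQuot D f) = M.toQuot D (M.minor π f) := rfl

/-- A class is determined by the set of pairs `(P, π)` such that the minor along `π` lies in `P`,
and there are finitely many such pairs. -/
theorem finite_quot {D : Description M} (hD : D.Finite) (n : ℕ+) :
    Finite ((M.quot D).obj n) := by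
  have := hD.to_subtype
  let c : M.obj n → Set ((P : D) × (Fin n → Fin P.1.ar)) :=
    fun f => {p | M.minor p.2 f ∈ p.1.1.carrier}
  have hc : ∀ f g, c f = c g ↔ M.toQuot D f = M.toQuot D g := by
    intro f g
    rw [toQuot_eq_iff, Set.ext_iff]
    exact ⟨fun h P hP π => h ⟨⟨P, hP⟩, π⟩, fun h p => h p.1.1 p.1.2 p.2⟩
  choose f hf using exists_toQuot_eq D (n := n)
  refine Finite.of_injective (fun q => c (f q)) fun q q' he => ?_
  rw [← hf q, ← hf q']
  exact (hc _ _).1 he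

/-- Maps between minions that commute with minors preserve primitive positive formulas. -/
theorem PP.Sat.map {M : Minion.{u}} {N : Minion.{v}} (ξ : (n : ℕ+) → M.obj n → N.obj n)
    (hξ : ∀ {n m : ℕ+} (π : Fin n → Fin m) (f : M.obj n), ξ m (M.minor π f) = N.minor π (ξ n f))
    {Γ : List ℕ+} {φ : PP Γ} {e : Env M Γ} (hs : φ.Sat M e) :
    φ.Sat N fun n x => ξ n (e n x) := by
  have ht : ∀ {Γ : List ℕ+} (e : Env M Γ) {n : ℕ+} (t : Tm Γ n),
      t.eval (fun n x => ξ n (e n x)) = ξ n (t.eval e) := by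
    intro Γ e n t
    induction t with
    | var x => rfl
    | minor π t ih => simp only [Tm.eval, ih, hξ]
  induction φ with
  | top => trivial
  | eq s t =>
    change s.eval _ = t.eval _
    rw [ht, ht]
    exact congrArg _ hs
  | and φ ψ ih₁ ih₂ => exact ⟨ih₁ hs.1, ih₂ hs.2⟩
  | ex n φ ih =>
    obtain ⟨f, hf⟩ := hs
    refine ⟨ξ n f, ?_⟩
    convert ih hf using 1
    funext m x
    cases x <;> rfl

/-- An internal reference describes its property in finer quotients as well. -/
theorem InternalRef.exists_mem {Q : MProperty M} {D D' : Description M} (hDD' : D ⊆ D')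
    (hQ : Q.Stable D) {ψ : PP [Q.ar]} (hψ : InternalRef Q D ψ) {q : (M.quot D').obj Q.ar}
    (hq : ModelsAt (M.quot D') ψ q) : ∃ f ∈ Q.carrier, M.toQuot D' f = q := by
  have hle : ∀ {n : ℕ+} {f g : M.obj n}, M.toQuot D' f = M.toQuot D' g →
      M.toQuot D f = M.toQuot D g := fun h =>
    toQuot_eq_iff.2 fun P hP => toQuot_eq_iff.1 h P (hDD' hP)
  let ξ : (n : ℕ+) → (M.quot D').obj n → (M.quot D).obj n := fun n =>
    Quotient.map' (s₁ := D'.setoid n) (s₂ := D.setoid n) id fun f g h P hP => h P (hDD' hP)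
  have hξ : ∀ {n m : ℕ+} (π : Fin n → Fin m) (f : (M.quot D').obj n),
      ξ m ((M.quot D').minor π f) = (M.quot D).minor π (ξ n f) := by
    intro n m π f
    obtain ⟨f, rfl⟩ := exists_toQuot_eq D' f
    rfl
  obtain ⟨f, rfl⟩ := exists_toQuot_eq D' q
  have hs := PP.Sat.map ξ hξ hq
  have hs' : ModelsAt (M.quot D) ψ (M.toQuot D f) := by
    unfold ModelsAt
    convert hs using 1
    funext m x
    cases x with
    | zero => rfl
    | succ x => exact nomatch x
  obtain ⟨g, hg, he⟩ := hψ _ hs'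
  exact ⟨f, hQ g f (toQuot_eq_iff.1 he) hg, rfl⟩

/-! ### Decoding -/

/-- The description, refined by the fibres of a map on the universe of the global structure. -/
def fibreDescription (J : Interpretation S M) (D : Description M) {T : Type}
    (φ : J.global.carrier → T) : Description M :=
  D ∪ Set.range fun t => ⟨J.U.ar, {f | ∃ hf, φ ⟨f, hf⟩ = t}⟩

section Decode

variable {J : Interpretation S M} {D : Description M} {T : RelStr.{0} S}
  {φ : J.global.carrier → T.carrier}

/-- The fibre over `φ g` belongs to the description and is tested along the identity. -/
theorem eq_of_toQuot_fibreDescription {f g : J.global.carrier}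
    (he : M.toQuot (fibreDescription J D φ) f.1 = M.toQuot (fibreDescription J D φ) g.1) :
    φ f = φ g := by
  have h := toQuot_eq_iff.1 he _ (Or.inr ⟨φ g, rfl⟩) id
  rw [M.minor_id, M.minor_id] at h
  exact (h.2 ⟨g.2, rfl⟩).2

open Classical in
/-- The image of a class of elements of the global structure. -/
noncomputable def decode (D : Description M) (φ : J.global.carrier → T.carrier)
    (q : (M.quot (fibreDescription J D φ)).obj J.U.ar) : Option T.carrier :=
  if hq : ∃ f : J.global.carrier, M.toQuot _ f.1 = q then some (φ hq.choose) else none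

theorem decode_toQuot (f : J.global.carrier) : decode D φ (M.toQuot _ f.1) = some (φ f) := by
  have hq : ∃ g : J.global.carrier, M.toQuot (fibreDescription J D φ) g.1 =
    M.toQuot (fibreDescription J D φ) f.1 := ⟨f, rfl⟩
  unfold decode
  rw [dif_pos hq]
  exact congrArg some (eq_of_toQuot_fibreDescription hq.choose_spec)

/-- A solution of the constraints of a pattern formula gives a homomorphism. -/
theorem exists_isHom_of_holds {h : ℕ+} (hφ : IsHom J.global T φ) (hJ : J.Stable D)
    {X : Instance S} {ψV : Fin X.size → PP [J.U.ar]}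
    {ψR : (k : Fin X.facts.length) → PP [(J.R (X.facts.get k).1).ar]}
    (hψV : ∀ v, InternalRef J.U D (ψV v))
    (hψR : ∀ k, InternalRef (J.R (X.facts.get k).1) D (ψR k))
    (hle : (patternFormula J X ψV ψR).ArityLE h)
    {val : ℕ → (M.quot (fibreDescription J D φ)).obj h}
    (hval : ∀ k ∈ (patternFormula J X ψV ψR).constraints h [] 0, k.Holds _ val) :
    ∃ F : Fin X.size → T.carrier, IsHom X.toStr T F ∧ ∀ v : Fin X.size,
      decode D φ ((M.quot _).minor (clip h J.U.ar) (val (X.size - 1 - v))) = some (F v) := by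
  have hD : D ⊆ fibreDescription J D φ := Set.subset_union_left
  obtain ⟨hV, hR⟩ := models_of_holds_patternFormula hle hval
  have hV' := fun v => (hψV v).exists_mem hD hJ.1 (hV v)
  choose f hf he using hV'
  refine ⟨fun v => φ ⟨f v, hf v⟩, fun R t ht => ?_, fun v => ?_⟩
  · have key : ∀ a : (R : S.Symb) × (Fin (S.ar R) → Fin X.size), a = ⟨R, t⟩ → (∃ g ∈ (J.R a.1).carrier, ∀ i,
        M.toQuot (fibreDescription J D φ) (M.minor (J.proj a.1 i) g) = M.toQuot _ (f (a.2 i))) →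
        (fun v => φ ⟨f v, hf v⟩) ∘ t ∈ T.rel R := by
      rintro _ rfl ⟨g, hg, hgt⟩
      -- The minors of `g` are equivalent to elements of `U`. Stability puts them into `U`, so `g`
      -- witnesses a tuple of the global structure.
      have hU : ∀ i, M.minor (J.proj R i) g ∈ J.U.carrier := fun i =>
        hJ.1 _ _ (fun P hP π => ((toQuot_eq_iff.1 (hgt i)) P (hD hP) π).symm) (hf _)
      have := hφ R (fun i => ⟨_, hU i⟩) ⟨g, hg, fun i => rfl⟩
      convert this using 1
      funext i
      exact (eq_of_toQuot_fibreDescription (f := ⟨_, hU i⟩) (g := ⟨_, hf (t i)⟩) (hgt i)).symm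
    obtain ⟨k, hk⟩ := List.mem_iff_get.1 ht
    obtain ⟨q, hq, hqt⟩ := hR k
    obtain ⟨g, hg, rfl⟩ := (hψR k).exists_mem hD (hJ.2 _) hq
    exact key _ hk ⟨g, hg, fun i => by rw [← minor_toQuot, hqt i, he]⟩
  · rw [← he v]
    exact decode_toQuot (⟨f v, hf v⟩ : J.global.carrier)

end Decode

end MinionPattern

/-! ### Every variable has a trivial equation, and every element a block -/

namespace MinionPattern

open Turing Function

variable {S : Signature} {M : Minion.{u}} {h r : ℕ+}

theorem PP.loop_mem_constraints {Γ : List ℕ+} (φ : PP Γ) {ids : List ℕ} {c j : ℕ} (h₁ : c ≤ j)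
    (h₂ : j < c + φ.exCount) : (⟨id, id, j, j⟩ : Constraint h) ∈ φ.constraints h ids c := by
  induction φ generalizing ids c with
  | top => simp [PP.exCount] at h₂; omega
  | eq s t => simp [PP.exCount] at h₂; omega
  | and φ ψ ih₁ ih₂ =>
    simp only [PP.exCount] at h₂
    simp only [PP.constraints, List.mem_append]
    rcases lt_or_ge j (c + φ.exCount) with hj | hj
    · exact .inl (ih₁ h₁ hj)
    · exact .inr (ih₂ hj (by omega))
  | ex n φ ih =>
    simp only [PP.exCount] at h₂
    simp only [PP.constraints, List.mem_cons]
    rcases h₁.eq_or_lt with rfl | hj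
    · exact .inl rfl
    · exact .inr (ih hj (by omega))

theorem PP.exCount_exAll {Γ : List ℕ+} (φ : PP Γ) :
    (PP.exAll Γ φ).exCount = Γ.length + φ.exCount := by
  induction Γ with
  | nil => simp [PP.exAll]
  | cons n Γ ih => simp only [PP.exAll, ih, PP.exCount, List.length_cons]; omega

/-- All the `x_v` are among the quantified variables, so the blocks that the decoder reads exist. -/
theorem size_le_exCount_patternFormula {J : Interpretation S M} {X : Instance S}
    {ψV : Fin X.size → PP [J.U.ar]}
    {ψR : (k : Fin X.facts.length) → PP [(J.R (X.facts.get k).1).ar]} :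
    X.size ≤ (patternFormula J X ψV ψR).exCount := by
  rw [patternFormula, PP.exCount_exAll, patternCtx_length]
  omega

/-! ### The target structure -/

/-- Every map to a set of size at most `r` factors through a map to `[r]` with a prescribed first
value. -/
theorem exists_comp_eq {m : ℕ+} (hm : m ≤ r) (σ : Fin h → Fin m) (b : Fin r) :
    ∃ (τ : Fin r → Fin m) (π : Fin h → Fin r), π ⟨0, h.pos⟩ = b ∧ τ ∘ π = σ := by
  -- Embed `[m]` into `[r]` and swap `b` with the image of the first value. The swap is an
  -- involution, so `τ` can undo it.
  let s := clip m r (σ ⟨0, h.pos⟩)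
  refine ⟨clip r m ∘ Equiv.swap b s, Equiv.swap b s ∘ clip m r ∘ σ, Equiv.swap_apply_right _ _, ?_⟩
  funext i
  simp only [comp_apply, Equiv.swap_apply_self]
  exact congrFun (clip_comp_clip hm) (σ i)

/-- The description tests only minors of arity at most `r`. Each of them factors through `[r]` with
a first value of choice: zero to compare `f` with `k`, one to compare `g` with `k`. The second
choice needs `1 < r`. -/
theorem toQuot_eq_of_minors {D : Description M} (hD : ∀ P ∈ D, P.ar ≤ r) (hr : 1 < r)
    {f g k : M.obj h}
    (hf : ∀ π : Fin h → Fin r, π ⟨0, h.pos⟩ = ⟨0, r.pos⟩ →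
      M.toQuot D (M.minor π f) = M.toQuot D (M.minor π k))
    (hg : ∀ π : Fin h → Fin r, π ⟨0, h.pos⟩ ≠ ⟨0, r.pos⟩ →
      M.toQuot D (M.minor π g) = M.toQuot D (M.minor π k)) :
    M.toQuot D f = M.toQuot D g := by
  refine toQuot_eq_iff.2 fun P hP σ => ?_
  have h₁ : M.minor σ f ∈ P.carrier ↔ M.minor σ k ∈ P.carrier := by
    obtain ⟨τ, π, hπ, rfl⟩ := exists_comp_eq (hD P hP) σ ⟨0, r.pos⟩
    rw [M.minor_comp, M.minor_comp]
    exact toQuot_eq_iff.1 (hf π hπ) P hP τ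
  have h₂ : M.minor σ g ∈ P.carrier ↔ M.minor σ k ∈ P.carrier := by
    obtain ⟨τ, π, hπ, rfl⟩ := exists_comp_eq (hD P hP) σ ⟨1, hr⟩
    rw [M.minor_comp, M.minor_comp]
    refine toQuot_eq_iff.1 (hg π ?_) P hP τ
    rw [hπ]
    exact fun he => one_ne_zero (congrArg Fin.val he)
  exact h₁.trans h₂.symm

/-- The free structure of a quotient generated by a complete structure, with the universe
enumerated by `e`. -/
def quotStr (h : ℕ+) {D : Description M} {n : ℕ} (e : (M.quot D).obj r ≃ Fin n) :
    RelStr.{0} (completeSig r h) where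
  carrier := Fin n
  rel _ := {t | ∃ g : M.obj h, ∀ p, t p = e (M.toQuot D (M.minor (tupleEquiv r h p) g))}

/-- The image of the fact of an equation consists of the minors of one `f` in `M(h)`. Where the
first value is zero they agree with those of `x^κ₁`, elsewhere with those of `y^κ₂`; by
`toQuot_eq_of_minors` the two sides have the same class. -/
theorem exists_holds_of_isHom_quotStr {D : Description M} (hD : ∀ P ∈ D, P.ar ≤ r) (hr : 1 < r)
    [Nonempty (M.obj h)] {n : ℕ} {e : (M.quot D).obj r ≃ Fin n} {φ : MinorCondition}
    {F : Fin (φ.exCount * (r : ℕ) ^ (h : ℕ)) → Fin n}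
    (hF : IsHom (φ.toInstance r h).toStr (quotStr h e) F) :
    ∃ val : ℕ → (M.quot D).obj h, (∀ k ∈ φ.constraints h [] 0, k.Holds _ val) ∧
      ∀ (j : ℕ) (hj : j < φ.exCount) (p : Fin ((r : ℕ) ^ (h : ℕ))),
        F ⟨j * (r : ℕ) ^ (h : ℕ) + p, mul_add_lt hj p⟩ =
          e ((M.quot D).minor (tupleEquiv r h p) (val j)) := by
  have hl := φ.constraints_lt (h := h) (ids := []) (c := 0) rfl (by simp)
  simp only [Nat.zero_add] at hl
  have hF' := isHom_constraintInstance.1 hF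
  have hG : ∀ j, ∃ g : M.obj h, ∀ (hj : j < φ.exCount) (p : Fin ((r : ℕ) ^ (h : ℕ))),
      F ⟨j * (r : ℕ) ^ (h : ℕ) + p, mul_add_lt hj p⟩ =
        e (M.toQuot D (M.minor (tupleEquiv r h p) g)) := by
    intro j
    by_cases hj : j < φ.exCount
    -- In a trivial equation both sides name the same element at each position, so its fact is block
    -- `j` in order and provides one `g` for the whole block.
    · obtain ⟨g, hg⟩ := hF' ⟨id, id, j, j⟩ (φ.loop_mem_constraints (Nat.zero_le j) (by omega))
      refine ⟨g, fun _ p => (hg p).symm ▸ congrArg F (Fin.ext ?_)⟩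
      simp [Constraint.elt, Constraint.entry]
    · exact ⟨Classical.arbitrary _, fun hj' => absurd hj' hj⟩
  choose g hg using hG
  refine ⟨fun j => M.toQuot D (g j), fun k hk => ?_, fun j hj p => hg j hj p⟩
  obtain ⟨f, hf⟩ := hF' k hk
  have hp : ∀ π : Fin h → Fin r,
      e (M.toQuot D (M.minor π f)) = F ⟨k.elt r ((tupleEquiv r h).symm π), k.elt_lt (hl k hk) _⟩ := by
    intro π
    have := hf ((tupleEquiv r h).symm π)
    rw [Equiv.apply_symm_apply] at this
    exact this.symm
  refine toQuot_eq_of_minors hD hr (k := f) (fun π hπ => ?_) fun π hπ => ?_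
  · refine e.injective ?_
    rw [hp, ← M.minor_comp, ← (tupleEquiv r h).apply_symm_apply (π ∘ k.κ₁), ← hg k.x (hl k hk).1]
    simp only [Constraint.elt, Constraint.entry, Equiv.apply_symm_apply, if_pos hπ]
  · refine e.injective ?_
    rw [hp, ← M.minor_comp, ← (tupleEquiv r h).apply_symm_apply (π ∘ k.κ₂), ← hg k.y (hl k hk).2]
    simp only [Constraint.elt, Constraint.entry, Equiv.apply_symm_apply, if_neg hπ]

/-- The structure with one element and all relations. -/
def pointStr (S : Signature) : RelStr.{0} S := ⟨Unit, fun _ => Set.univ⟩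

theorem homTo_pointStr (A : RelStr.{u} S) : HomTo A (pointStr S) :=
  ⟨fun _ => (), fun _ _ _ => trivial⟩

/-- A finite target structure such that homomorphisms from the structure of a minor condition to it
give solutions of the constraints in a quotient. -/
theorem exists_target {D : Description M} (hfin : D.Finite) (hD : ∀ P ∈ D, P.ar ≤ r)
    {m : ℕ+} (hm : m ≤ r) (u : M.obj 1) :
    ∃ B : RelStr.{0} (completeSig r h), Finite B.carrier ∧ HomTo (completeStr r h) B ∧
      HomTo (freeStr M (completeStr r h) (Equiv.refl (Fin r))) B ∧
      ∃ (lam : B.carrier → (M.quot D).obj m) (p : Fin ((r : ℕ) ^ (h : ℕ))),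
        ∀ (φ : MinorCondition) (F : Fin (φ.exCount * (r : ℕ) ^ (h : ℕ)) → B.carrier),
          IsHom (φ.toInstance r h).toStr B F →
          ∃ val : ℕ → (M.quot D).obj h, (∀ k ∈ φ.constraints h [] 0, k.Holds _ val) ∧
            ∀ (j : ℕ) (hj : j < φ.exCount),
              lam (F ⟨j * (r : ℕ) ^ (h : ℕ) + p, mul_add_lt hj p⟩) =
                (M.quot D).minor (clip h m) (val j) := by
  -- For `r = 1` no map has another first value. But then all properties have arity one, so minors
  -- of `u` of equal arity are equivalent, and a constant assignment solves every system.
  rcases (one_le (a := r)).eq_or_lt with hr | hr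
  · have hconst : ∀ {n : ℕ+} (f g : Fin (1 : ℕ+) → Fin n),
        M.toQuot D (M.minor f u) = M.toQuot D (M.minor g u) := by
      intro n f g
      refine toQuot_eq_iff.2 fun P hP σ => ?_
      have h₁ : P.ar = 1 := le_antisymm ((hD P hP).trans hr.ge) one_le
      have : Subsingleton (Fin P.ar) := by
        rw [h₁]
        exact inferInstanceAs (Subsingleton (Fin 1))
      rw [← M.minor_comp, ← M.minor_comp, Subsingleton.elim (σ ∘ f) (σ ∘ g)]
    refine ⟨pointStr _, inferInstanceAs (Finite Unit), homTo_pointStr _, homTo_pointStr _,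
      fun _ => M.toQuot D (M.minor (fun _ => ⟨0, m.pos⟩) u), ⟨0, Nat.pow_pos r.pos⟩,
      fun φ F _ => ⟨fun _ => M.toQuot D (M.minor (fun _ => ⟨0, h.pos⟩) u), fun k _ => ?_,
        fun j hj => ?_⟩⟩
    · unfold Constraint.Holds
      rw [minor_toQuot, minor_toQuot, ← M.minor_comp, ← M.minor_comp]
      exact hconst _ _
    · rw [minor_toQuot, ← M.minor_comp]
      exact hconst _ _
  · have := finite_quot hfin r
    obtain ⟨n, ⟨e⟩⟩ := Finite.exists_equiv_fin ((M.quot D).obj r)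
    have : Nonempty (M.obj h) := ⟨M.minor (fun _ => ⟨0, h.pos⟩) u⟩
    refine ⟨quotStr h e, inferInstanceAs (Finite (Fin n)), ?_, ?_,
      fun b => (M.quot D).minor (clip r m) (e.symm b),
      -- At this place stands the minor along `clip m r ∘ clip h m`; since `m ≤ r`, applying `clip r
      -- m` leaves the minor along `clip h m`.
      (tupleEquiv r h).symm (clip m r ∘ clip h m), fun φ F hF => ?_⟩
    · refine ⟨fun i => e (M.toQuot D (M.minor (fun _ => i) u)), fun _ t ht => ?_⟩
      obtain ⟨i, rfl⟩ := ht
      refine ⟨M.minor (fun _ => i) u, fun p => ?_⟩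
      rw [← M.minor_comp]
      rfl
    · refine ⟨fun f => e (M.toQuot D f), fun _ t ht => ?_⟩
      obtain ⟨g, hg⟩ := mem_rel_freeStr_completeStr.1 ht
      exact ⟨g, fun p => congrArg (fun f => e (M.toQuot D f)) (hg p)⟩
    · obtain ⟨val, hval, hF'⟩ := exists_holds_of_isHom_quotStr hD hr hF
      refine ⟨val, hval, fun j hj => ?_⟩
      change (M.quot D).minor (clip r m) (e.symm (F _)) = _
      rw [hF' j hj, Equiv.symm_apply_apply, Equiv.apply_symm_apply, ← Minion.minor_comp,
        ← comp_assoc, clip_comp_clip hm, id_comp]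

/-! ### The reduction -/

/-- The digits among the letters of inputs. -/
def InstSym.isDigit : InstSym S → Bool
  | .inl b => b
  | .inr _ => false

theorem length_takeWhile_encode (X : Instance S) :
    (X.encode.takeWhile InstSym.isDigit).length = X.size := by
  have : ∀ n (w : List (InstSym S)), ((InstSym.nat S n ++ w).takeWhile InstSym.isDigit).length = n := by
    intro n w
    unfold InstSym.nat
    induction n with
    | zero => rfl
    | succ n ih => exact congrArg Nat.succ ih
  exact this _ _

/-- It remains to read each value of the solution from one entry of the table, at offset `p` in the
block of `x_v`. The map `β` runs the translation again with `z` and the size as side input, and then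
checks `z` against the result. -/
theorem polyManyOneReducible_of_decoder {G : RelStr.{v} S} {J : Interpretation S M}
    {D : Description M} {Ψ : {X : Instance S // HomTo X.toStr J.global} → MinorCondition}
    (hΨ : IsPattern J D Ψ h) (hG : FinitelyEquivalent J.global G) {T : RelStr.{0} S}
    [Finite T.carrier] {B : RelStr.{0} (completeSig r h)} [Finite B.carrier]
    (lam : B.carrier → Option T.carrier) (p : Fin ((r : ℕ) ^ (h : ℕ)))
    (hlam : ∀ X (F : Fin ((Ψ X).exCount * (r : ℕ) ^ (h : ℕ)) → B.carrier),
      IsHom ((Ψ X).toInstance r h).toStr B F →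
      ∃ F' : Fin X.1.size → T.carrier, IsHom X.1.toStr T F' ∧ ∀ v : Fin X.1.size,
        (encodeMap F)[(X.1.size - 1 - v) * (r : ℕ) ^ (h : ℕ) + p]?.join.bind lam = some (F' v)) :
    PolyManyOneReducible (sPCSP G T)
      (sPCSP (freeStr M (completeStr r h) (Equiv.refl (Fin r))) B) := by
  classical
  -- A promised word only asserts that an instance exists. By `hX` the machines need nothing but its
  -- word.
  choose X hX hXG using fun x : {x // x ∈ (sPCSP G T).promise} => x.2
  let X' : {x // x ∈ (sPCSP G T).promise} → {X : Instance S // HomTo X.toStr J.global} := fun x =>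
    ⟨X x, (hG _ (inferInstanceAs (Finite (Fin _)))).2 (hXG x)⟩
  let Y := fun x => (Ψ (X' x)).toInstance r h
  have hY : PolyTime (fun x : {x // x ∈ (sPCSP G T).promise} => x.1) Instance.encode Y :=
    (Conv.polyTime_toInstance r h).comp
      (hΨ.polyTime.reindex X' (f' := fun x => (⟨Ψ (X' x), hΨ.arity _⟩ : {φ : MinorCondition // φ.ArityLE h}))
        hX fun _ => rfl)
  have : Finite (sPCSP G T).A := inferInstanceAs (Finite (Bool ⊕ S.Symb))
  let f : Option (Option B.carrier) → Option T.carrier := fun a => a.join.bind lam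
  let β : {x // x ∈ (sPCSP G T).promise} × List (Option B.carrier) → List (Option T.carrier) :=
    fun q => if ∃ F : Fin (Y q.1).size → B.carrier, IsHom (Y q.1).toStr B F ∧ q.2 = encodeMap F
      then Table.blockEntries ((r : ℕ) ^ (h : ℕ)) p f (X q.1).size q.2 else [none]
  have hβ : PolyTime (withSide fun x : {x // x ∈ (sPCSP G T).promise} => x.1) id β := by
    refine (polyTime_checkHom B p.2 f none).comp
      ((hY.withSide.comp (polyTime_markPrefix (C := Option B.carrier)
        (fun x : {x // x ∈ (sPCSP G T).promise} => x.1) InstSym.isDigit)).reindex id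
        (f' := fun q => (Y q.1, (X q.1).size, q.2)) (fun _ => rfl) fun q => ?_)
    change withSide _ (_, List.replicate (X q.1).size none ++ _) =
      withSide _ (_, List.replicate (q.1.1.takeWhile InstSym.isDigit).length none ++ _)
    rw [hX]
    exact congrArg (fun n => withSide _ (_, List.replicate n none ++ _))
      (length_takeWhile_encode _).symm
  refine ⟨fun x => ⟨(Y x).encode, Y x, rfl, homTo_freeStr_of_models (hΨ.arity _) (hΨ.holds _)⟩,
    β, hY.reindex id (fun _ => rfl) fun _ => rfl, hβ, fun x z => ?_⟩
  have hQ : (∃ Y' : Instance (completeSig r h), (Y x).encode = Y'.encode ∧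
      ∃ F : Fin Y'.size → B.carrier, IsHom Y'.toStr B F ∧ z = encodeMap F) ↔
      ∃ F : Fin (Y x).size → B.carrier, IsHom (Y x).toStr B F ∧ z = encodeMap F := by
    constructor
    · rintro ⟨Y', he, hF⟩
      rwa [Instance.encode_injective he]
    · exact fun hF => ⟨_, rfl, hF⟩
  refine hQ.trans ?_
  by_cases hF : ∃ F : Fin (Y x).size → B.carrier, IsHom (Y x).toStr B F ∧ z = encodeMap F
  · refine iff_of_true hF ?_
    have hβz : β (x, z) = _ := if_pos hF
    obtain ⟨F, hF, rfl⟩ := hF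
    obtain ⟨F', hF', hv⟩ := hlam (X' x) F hF
    refine ⟨X x, hX x, F', hF', hβz.trans ?_⟩
    rw [Table.blockEntries_eq_ofFn]
    exact congrArg List.ofFn (funext hv)
  · refine iff_of_false hF ?_
    have hβz : β (x, z) = [none] := if_neg hF
    -- The letter `none` occurs in no encoded map, so the default output solves nothing.
    rintro ⟨X', -, F', -, he⟩
    have : none ∈ encodeMap F' := (hβz.symm.trans he) ▸ List.mem_singleton_self _
    simp [encodeMap] at this

end MinionPattern

theorem mainTheorem9 {S : Signature} (G : RelStr.{v} S) (M : Minion.{u})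
    (J : Interpretation S M) (D : Description M) (hD : D.Finite)
    (Ψ : {X : Instance S // HomTo X.toStr J.global} → MinorCondition)
    (h r : ℕ+) (hrh : r ≤ h)
    (hΨ : IsPattern J D Ψ h)
    (hG : FinitelyEquivalent J.global G)
    (hrD : ∀ Q ∈ D, Q.ar ≤ r) (hrU : J.U.ar ≤ r)
    (T : RelStr.{0} S) (hTfin : Finite T.carrier) (hT : HomTo G T) :
    ∃ B : RelStr.{0} (completeSig r h),
      Finite B.carrier ∧
      HomTo (completeStr r h) B ∧
      HomTo (freeStr M (completeStr r h) (Equiv.refl (Fin r))) B ∧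
      PolyManyOneReducible (sPCSP G T)
        (sPCSP (freeStr M (completeStr r h) (Equiv.refl (Fin r))) B) := by
  -- If `M(1)` is empty, so is every `M(n)`, as any element has a minor of arity one.
  by_cases hu : Nonempty (M.obj 1)
  · obtain ⟨u⟩ := hu
    obtain ⟨φ, hφ⟩ := hG.homTo hT
    have hfin : (fibreDescription J D φ).Finite := hD.union (Set.finite_range _)
    have har : ∀ P ∈ fibreDescription J D φ, P.ar ≤ r := by
      rintro P (hP | ⟨t, rfl⟩)
      exacts [hrD P hP, hrU]
    obtain ⟨B, hB, hK, hF, lam, p, H⟩ := exists_target (h := h) hfin har hrU u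
    refine ⟨B, hB, hK, hF,
      polyManyOneReducible_of_decoder hΨ hG (fun b => decode D φ (lam b)) p fun X F hF => ?_⟩
    obtain ⟨ψV, ψR, hψV, hψR, hs⟩ := hΨ.shape X
    obtain ⟨val, hval, hlam⟩ := H _ F hF
    have hle : X.1.size ≤ (Ψ X).exCount := hs ▸ size_le_exCount_patternFormula
    have hX := hΨ.arity X
    have hval' := hval
    rw [hs] at hX hval'
    obtain ⟨F', hF', hv⟩ := exists_isHom_of_holds hφ hΨ.stable hψV hψR hX hval'
    refine ⟨F', hF', fun v => ?_⟩
    have hj : X.1.size - 1 - v < (Ψ X).exCount := by omega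
    rw [← hv v, ← hlam _ hj, encodeMap, List.getElem?_eq_getElem (by
      rw [List.length_ofFn]
      exact mul_add_lt hj p), List.getElem_ofFn]
    rfl
  · have hU : IsEmpty J.global.carrier :=
      ⟨fun f => hu ⟨M.minor (fun _ => (⟨0, Nat.one_pos⟩ : Fin (1 : ℕ+))) f.1⟩⟩
    refine ⟨pointStr _, inferInstanceAs (Finite Unit), homTo_pointStr _, homTo_pointStr _, ?_⟩
    have : Finite (pointStr (completeSig r h)).carrier := inferInstanceAs (Finite Unit)
    refine polyManyOneReducible_of_decoder hΨ hG (fun _ => none) ⟨0, Nat.pow_pos r.pos⟩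
      fun X F _ => ?_
    -- The global structure is empty, so a promised input has no elements, and no facts either
    -- because arities are positive.
    obtain ⟨K, -⟩ := X.2
    exact ⟨fun v => (hU.false (K v)).elim, fun _ t _ =>
      (hU.false (K (t ⟨0, S.ar_pos _⟩))).elim, fun v => (hU.false (K v)).elim⟩
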